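/- Let $\mathbb K=\mathbb R$ or $\mathbb C$. Let $D$ be a connected (real or complex) Lie group with Lie algebra $\mathfrak d$, and let $\langle\,,\rangle$ be a nondegenerate invariant symmetric bilinear form on $\mathfrak d$; for a subspace $V\subset\mathfrak d$ let $V^\perp$ be its orthogonal. Let $Q$ be a closed subgroup of $D$ (a complex Lie subgroup if $\mathbb K=\mathbb C$) whose Lie algebra $\mathfrak q$ is coisotropic, i.e. $\mathfrak q^\perp\subset\mathfrak q$, and equip $D/Q$ with its quotient manifold structure, i.e. the one for which $D\to D/Q$ is a submersion. Let $\mathfrak d=\mathfrak u+\mathfrak u'$ be a vector space direct sum of two Lie subalgebras with $\mathfrak u^\perp=\mathfrak u$ and $\mathfrak u'^\perp=\mathfrak u'$, and let $U,U'$ be the connected subgroups of $D$ with Lie algebras $\mathfrak u,\mathfrak u'$. Let $\{x_i\}$ and $\{\xi_i\}$ be bases of $\mathfrak u$ and $\mathfrak u'$ with $\langle x_i,\xi_j\rangle=\delta_{ij}$, let $R=\frac12\sum_i\xi_i\wedge x_i\in\wedge^2\mathfrak d$, and let $\Pi_{\mathfrak u,\mathfrak u'}=\kappa(R)$ be the induced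 bivector field on $D/Q$, where $\kappa(x)(p)=\frac{d}{dt}\big|_{0}\exp(tx)\cdot p$. Let $d\in D$ and $\underline d=dQ$. Put $\mathfrak a=\mathrm{Ad}_d\mathfrak q$ and $(\mathfrak u\cap\mathfrak a)^0=(\mathfrak u\cap\mathfrak a)^\perp\cap\mathfrak u'$. Then $\Pi_{\mathfrak u,\mathfrak u'}(\underline d)$ comes from an element of $\wedge^2(\mathfrak u/(\mathfrak u\cap\mathfrak a))$ under the identification $\mathfrak u/(\mathfrak u\cap\mathfrak a)\cong T_{\underline d}(U\cdot\underline d)$ given by $\kappa$. The Drinfeld Lagrangian subalgebra is $$\mathfrak l_{\underline d}=\{x+\xi \mid x\in\mathfrak u,\ \xi\in(\mathfrak u\cap\mathfrak a)^0,\ \iota_\xi\Pi_{\mathfrak u,\mathfrak u'}(\underline d)=x+\mathfrak u\cap\mathfrak a\},$$ where $\iota_\xi\Pi_{\mathfrak u,\mathfrak u'}(\underline d)\in\mathfrak u/(\mathfrak u\cap\mathfrak a)$ is defined by $\langle\iota_\xi\Pi_{\mathfrak u,\mathfrak u'}(\underline d),\eta\rangle=\Pi_{\mathfrak u,\mathfrak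 u'}(\underline d)(\xi,\eta)$ for all $\eta\in(\mathfrak u\cap\mathfrak a)^0$, and $(v\wedge w)(\xi,\eta)=\langle v,\xi\rangle\langle w,\eta\rangle-\langle w,\xi\rangle\langle v,\eta\rangle$. Then $\mathfrak l_{\underline d}$ is a Lie subalgebra of $\mathfrak d$ with $\mathfrak l_{\underline d}^\perp=\mathfrak l_{\underline d}$, and $$\mathfrak l_{\underline d}=\mathrm{Ad}_d\,\mathfrak q^\perp+(\mathfrak u\cap\mathrm{Ad}_d\,\mathfrak q).$$ Moreover, the rank of $\Pi_{\mathfrak u,\mathfrak u'}$ at $\underline d$ equals $$\dim(U\cdot\underline d\cap U'\cdot\underline d)+\dim(D/Q)-\dim(U'\cdot\underline d)-\dim(\mathfrak u'\cap\mathfrak l_{\underline d}),$$ where all dimensions are over $\mathbb K$. -/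

import Mathlib

open scoped Manifold ContDiff Topology

namespace DrinfeldPoisson

/-! ### Lie groups over `𝕜 = ℝ` or `ℂ` -/

/-- Smooth Lie groups over `ℝ` or `ℂ` are smooth enough for Mathlib's Lie algebra structure on
the tangent space at the identity. -/
instance instLEInftyMinSmoothness {𝕜 : Type*} [RCLike 𝕜] : ENat.LEInfty (minSmoothness 𝕜 3) :=
  ⟨by rw [minSmoothness_of_isRCLikeNormedField]; exact ENat.LEInfty.out⟩

noncomputable section

section Group

variable {𝕜 : Type*} [RCLike 𝕜] {E : Type*} [NormedAddCommGroup E] [NormedSpace 𝕜 E]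
  {D : Type*} [TopologicalSpace D] [ChartedSpace E D] [Group D]

/-- `γ : 𝕜 → D` is the one-parameter subgroup `t ↦ exp (t x)` generated by `x ∈ T_1 D`
(smooth if `𝕜 = ℝ`, holomorphic if `𝕜 = ℂ`). -/
structure IsOneParameterSubgroup (γ : 𝕜 → D) (x : GroupLieAlgebra 𝓘(𝕜, E) D) : Prop where
  contMDiff : ContMDiff 𝓘(𝕜, 𝕜) 𝓘(𝕜, E) ∞ γ
  map_add : ∀ s t : 𝕜, γ (s + t) = γ s * γ t
  velocity : mfderiv 𝓘(𝕜, 𝕜) 𝓘(𝕜, E) γ 0 (1 : 𝕜) = x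

/-- `q` is the Lie algebra of the closed subgroup `Q`: an element `x` lies in `q` if and only if
`exp (t x) ∈ Q` for all real `t`. Since `q` is a `𝕜`-subspace, this says for `𝕜 = ℂ` in
particular that `Q` is a complex Lie subgroup. -/
def HasLieAlgebra (Q : Subgroup D) (q : Submodule 𝕜 (GroupLieAlgebra 𝓘(𝕜, E) D)) : Prop :=
  ∀ x : GroupLieAlgebra 𝓘(𝕜, E) D,
    x ∈ q ↔ ∃ γ : 𝕜 → D, IsOneParameterSubgroup γ x ∧ ∀ t : ℝ, γ (t : 𝕜) ∈ Q

/-- The connected subgroup of `D` with Lie algebra `u`: the subgroup generated by `exp u`. -/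
def connectedSubgroup (u : Submodule 𝕜 (GroupLieAlgebra 𝓘(𝕜, E) D)) : Subgroup D :=
  Subgroup.closure {g | ∃ x ∈ u, ∃ γ : 𝕜 → D, IsOneParameterSubgroup γ x ∧ γ 1 = g}

/-- The adjoint action `Ad_d` on the Lie algebra: the derivative at `1` of `g ↦ d g d⁻¹`. -/
def Ad (d : D) : GroupLieAlgebra 𝓘(𝕜, E) D →ₗ[𝕜] GroupLieAlgebra 𝓘(𝕜, E) D :=
  (mfderiv 𝓘(𝕜, E) 𝓘(𝕜, E) (fun g : D => d * g * d⁻¹) 1 : E →L[𝕜] E).toLinearMap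

/-- The infinitesimal action at a point `p` of a manifold `M` on which `D` acts:
`x ↦ κ(x)(p)`, the derivative at `1` of the orbit map `g ↦ g • p` (so that
`κ(x)(p) = d/dt|₀ exp (t x) • p`). -/
def infinitesimalAction {F : Type*} [NormedAddCommGroup F] [NormedSpace 𝕜 F]
    {M : Type*} [TopologicalSpace M] [ChartedSpace F M] [MulAction D M] (p : M) :
    GroupLieAlgebra 𝓘(𝕜, E) D →ₗ[𝕜] TangentSpace 𝓘(𝕜, F) p :=
  (mfderiv 𝓘(𝕜, E) 𝓘(𝕜, F) (fun g : D => g • p) 1 : E →L[𝕜] F).toLinearMap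

end Group

/-! ### Dimension of immersed submanifolds -/

section Dimension

variable (𝕜 : Type*) [RCLike 𝕜] {F : Type*} [NormedAddCommGroup F] [NormedSpace 𝕜 F]
  {M : Type*} [TopologicalSpace M] [ChartedSpace F M]

/-- The tangent space at `p` of a subset `S` of a manifold `M`: the span of the velocities
`γ'(0)` of all smooth (holomorphic, if `𝕜 = ℂ`) curves `γ` defined near `0 ∈ 𝕜`, with values
in `S` and with `γ 0 = p`. -/
def subsetTangentSpace (S : Set M) (p : M) : Submodule 𝕜 (TangentSpace 𝓘(𝕜, F) p) :=
  Submodule.span 𝕜 {v | ∃ γ : 𝕜 → M, ContMDiffAt 𝓘(𝕜, 𝕜) 𝓘(𝕜, F) ∞ γ 0 ∧ γ 0 = p ∧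
    (∀ᶠ t in 𝓝 (0 : 𝕜), γ t ∈ S) ∧ (mfderiv 𝓘(𝕜, 𝕜) 𝓘(𝕜, F) γ 0 (1 : 𝕜) : F) = v}

/-- The dimension over `𝕜` of a subset `S` of a manifold: the largest dimension of a tangent
space of `S`. For an orbit of a Lie group, or a transversal intersection of such orbits, this is
its dimension as an immersed submanifold. -/
def subsetDim (S : Set M) : ℕ :=
  ⨆ p : S, Module.finrank 𝕜 (subsetTangentSpace 𝕜 (F := F) S (p : M))

end Dimension

/-! ### Bivectors -/

section Bivector

variable {𝕜 : Type*} [Field 𝕜] {V : Type*} [AddCommGroup V] [Module 𝕜 V]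

/-- The value `P(α, β)` of a bivector `P` on two covectors, normalised by
`(v ∧ w)(α, β) = α(v) β(w) - α(w) β(v)`. -/
def bivectorEval (P : ⋀[𝕜]^2 V) (α β : Module.Dual 𝕜 V) : 𝕜 :=
  exteriorPower.pairingDual 𝕜 V 2 (exteriorPower.ιMulti 𝕜 2 ![α, β]) P

lemma bivectorEval_wedge (v w : V) (α β : Module.Dual 𝕜 V) :
    bivectorEval (exteriorPower.ιMulti 𝕜 2 ![v, w]) α β = α v * β w - α w * β v := by
  simp [bivectorEval, Matrix.det_fin_two]; ring

lemma update_pair_one {W : Type*} (α β γ : W) : Function.update ![α, β] 1 γ = ![α, γ] := by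
  ext i; fin_cases i <;> rfl

/-- The map `P^♯ : V* → V**`, `α ↦ ι_α P = P(α, ·)`. -/
def bivectorSharp (P : ⋀[𝕜]^2 V) : Module.Dual 𝕜 V →ₗ[𝕜] Module.Dual 𝕜 (Module.Dual 𝕜 V) :=
  LinearMap.mk₂ 𝕜 (bivectorEval P)
    (fun α α' β => by
      simp only [bivectorEval]
      rw [AlternatingMap.map_vecCons_add, map_add, LinearMap.add_apply])
    (fun c α β => by
      simp only [bivectorEval]
      rw [AlternatingMap.map_vecCons_smul, map_smul, LinearMap.smul_apply])
    (fun α β β' => by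
      have h := (exteriorPower.ιMulti 𝕜 2 (M := Module.Dual 𝕜 V)).map_update_add ![α, 0] 1 β β'
      simp only [update_pair_one] at h
      simp only [bivectorEval]
      rw [h, map_add, LinearMap.add_apply])
    (fun c α β => by
      have h := (exteriorPower.ιMulti 𝕜 2 (M := Module.Dual 𝕜 V)).map_update_smul ![α, 0] 1 c β
      simp only [update_pair_one] at h
      simp only [bivectorEval]
      rw [h, map_smul, LinearMap.smul_apply])

/-- The rank of a bivector `P`: the rank of `P^♯`. -/
def bivectorRank (P : ⋀[𝕜]^2 V) : ℕ :=
  Module.finrank 𝕜 (LinearMap.range (bivectorSharp P))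

end Bivector

/-! ### Quadratic Lie algebras and Lagrangian splittings -/

section Quadratic

variable {𝕜 : Type*} [Field 𝕜] {𝔡 : Type*} [LieRing 𝔡] [LieAlgebra 𝕜 𝔡]

/-- `B` makes `𝔡` a quadratic Lie algebra: it is a symmetric, nondegenerate, invariant bilinear
form. -/
structure IsQuadratic (B : LinearMap.BilinForm 𝕜 𝔡) : Prop where
  symm : B.IsSymm
  nondegenerate : B.Nondegenerate
  invariant : ∀ x y z : 𝔡, B ⁅x, y⁆ z = B x ⁅y, z⁆

/-- A Lagrangian splitting `𝔡 = u + u'`: a vector space direct sum decomposition into two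
Lagrangian subalgebras. -/
structure IsLagrangianSplitting (B : LinearMap.BilinForm 𝕜 𝔡) (u u' : LieSubalgebra 𝕜 𝔡) :
    Prop where
  isCompl : IsCompl u.toSubmodule u'.toSubmodule
  lagrangian_left : B.orthogonal u.toSubmodule = u.toSubmodule
  lagrangian_right : B.orthogonal u'.toSubmodule = u'.toSubmodule

end Quadratic

section Drinfeld

variable {𝕜 : Type*} [Field 𝕜] {𝔡 : Type*} [AddCommGroup 𝔡] [Module 𝕜 𝔡]

/-- The `r`-matrix `R = 1/2 ∑ ξ_i ∧ x_i ∈ ∧² 𝔡` of two finite families of vectors. -/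
def rMatrix {n : ℕ} (x ξ : Fin n → 𝔡) : ⋀[𝕜]^2 𝔡 :=
  (1 / 2 : 𝕜) • ∑ i, exteriorPower.ιMulti 𝕜 2 ![ξ i, x i]

/-- The functional `y + (u ∩ a) ↦ ⟨y, ξ⟩` on `u / (u ∩ a)` given by an element `ξ` of
`(u ∩ a)^⊥`. -/
def quotientFunctional (B : LinearMap.BilinForm 𝕜 𝔡) (u a : Submodule 𝕜 𝔡)
    (ξ : B.orthogonal (u ⊓ a)) : Module.Dual 𝕜 (u ⧸ a.submoduleOf u) :=
  (a.submoduleOf u).liftQ ((B.flip (ξ : 𝔡)).comp u.subtype) (by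
    intro y hy
    exact ξ.2 (y : 𝔡) ⟨y.2, hy⟩)

/-- Let `𝔡` act infinitesimally by `κ : 𝔡 → T` at a point with tangent space `T`, where
`a` is the stabilizer subalgebra, and let `P₀ ∈ ∧² T`. A bivector `P` on
`u / (u ∩ a)` *represents* `P₀` if it is sent to `P₀` under the identification of
`u / (u ∩ a)` with the subspace `κ(u)` of `T` (the tangent space of the `U`-orbit). -/
def RepresentsBivector {T : Type*} [AddCommGroup T] [Module 𝕜 T] (κ : 𝔡 →ₗ[𝕜] T)
    (u a : Submodule 𝕜 𝔡) (P₀ : ⋀[𝕜]^2 T) (P : ⋀[𝕜]^2 (u ⧸ a.submoduleOf u)) : Prop :=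
  ∃ P' : ⋀[𝕜]^2 u, exteriorPower.map 2 (a.submoduleOf u).mkQ P' = P ∧
    exteriorPower.map 2 (κ.comp u.subtype) P' = P₀

/-- The Drinfeld Lagrangian subalgebra, for `κ`, `a`, `P₀` as above. Write
`(u ∩ a)^0 = (u ∩ a)^⊥ ∩ u'` and regard `P₀` as a bivector `P` on `u / (u ∩ a)`. It is the set
of all `x + ξ` with `x ∈ u`, `ξ ∈ (u ∩ a)^0` and `ι_ξ P = x + (u ∩ a)`, where
`ι_ξ P ∈ u / (u ∩ a)` is the vector `w` with `⟨w, η⟩ = P(ξ, η)` for all `η ∈ (u ∩ a)^0`. -/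
def drinfeldSubalgebra {T : Type*} [AddCommGroup T] [Module 𝕜 T] (B : LinearMap.BilinForm 𝕜 𝔡)
    (κ : 𝔡 →ₗ[𝕜] T) (u u' a : Submodule 𝕜 𝔡) (P₀ : ⋀[𝕜]^2 T) : Set 𝔡 :=
  {z | ∃ P : ⋀[𝕜]^2 (u ⧸ a.submoduleOf u), RepresentsBivector κ u a P₀ P ∧
    ∃ (x : u) (ξ : B.orthogonal (u ⊓ a)), (ξ : 𝔡) ∈ u' ∧ z = (x : 𝔡) + (ξ : 𝔡) ∧
      ∀ η : B.orthogonal (u ⊓ a), (η : 𝔡) ∈ u' →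
        quotientFunctional B u a η ((a.submoduleOf u).mkQ x) =
          bivectorEval P (quotientFunctional B u a ξ) (quotientFunctional B u a η)}

end Drinfeld

/-! ### The bivector field on `D / Q` -/

section Homogeneous

variable {𝕜 : Type*} [RCLike 𝕜] {E : Type*} [NormedAddCommGroup E] [NormedSpace 𝕜 E]
  {D : Type*} [TopologicalSpace D] [ChartedSpace E D] [Group D]
  [FiniteDimensional 𝕜 E] [CompleteSpace E] [LieGroup 𝓘(𝕜, E) ∞ D]
  {F : Type*} [NormedAddCommGroup F] [NormedSpace 𝕜 F]
  {M : Type*} [TopologicalSpace M] [ChartedSpace F M] [MulAction D M]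

/-- The value at `p` of the bivector field `κ(R)` on `M` induced by `R ∈ ∧² 𝔡`. -/
def inducedBivector (R : ⋀[𝕜]^2 (GroupLieAlgebra 𝓘(𝕜, E) D)) (p : M) :
    ⋀[𝕜]^2 (TangentSpace 𝓘(𝕜, F) p) :=
  exteriorPower.map 2 (infinitesimalAction p) R

/-- The value at `p` of the bivector field `Π_{u,u'} = κ(R_{u,u'})`, computed from a basis `x` of
`u` and a basis `ξ` of `u'` (meant to be dual to each other). -/
def splittingBivector {u u' : LieSubalgebra 𝕜 (GroupLieAlgebra 𝓘(𝕜, E) D)} {n : ℕ}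
    (x : Module.Basis (Fin n) 𝕜 u) (ξ : Module.Basis (Fin n) 𝕜 u') (p : M) :
    ⋀[𝕜]^2 (TangentSpace 𝓘(𝕜, F) p) :=
  inducedBivector (rMatrix (fun i => (x i : GroupLieAlgebra 𝓘(𝕜, E) D))
    (fun i => (ξ i : GroupLieAlgebra 𝓘(𝕜, E) D))) p

end Homogeneous

end

end DrinfeldPoisson

/-!
The proof separates linear algebra at the point `p = dQ` from the geometry of orbits.

*Linear algebra.* Write `κ = κ_p : 𝔡 → T_p (D / Q)`. It is surjective with kernel `a = Ad_d q`
(`ker_orbitDeriv_quotient`), and `a` is a coisotropic subalgebra because the form is `Ad`-invariant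
(`IsQuadratic.apply_Ad_Ad`, which uses that `D` is connected). Covectors at `p` correspond to elements
of `a^⊥`, and on these the bivector is `Π(α, β) = ⟨pr_u α, β⟩`, where `pr_u` is the projection along
`u'`: the two halves of `R` contribute equally since `⟨α, β⟩ = 0` on `a^⊥ ⊆ a`
(`bivectorEval_map_rMatrix`). So contraction with `Π` is `κ ∘ pr_u` on `a^⊥`. Hence `Π` comes from
`u / (u ∩ a)`, and decomposing elements of `(u ∩ a)^⊥ = u + a^⊥` shows that the Drinfeld subalgebra
is `l = a^⊥ + (u ∩ a)` (`drinfeldSubalgebra_eq_sup`). This is Lagrangian by the modular law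
(`orthogonal_sup_inf_eq_self`), and a subalgebra because `a^⊥` is an ideal of `a`
(`lie_mem_orthogonal_sup_inf`). Counting dimensions, the rank of `Π` is `dim κ(u) - dim (u' ∩ l)`
(`bivectorRank_map_rMatrix`).

*Orbits.* It remains to see that `dim (U p) = dim κ(u)` and, since `κ(u) + κ(u')` is the whole tangent
space, `dim (U p ∩ U' p) = dim κ(u) + dim κ(u') - dim (D / Q)`. The dimension of a subset is defined
through the smooth curves contained in it.

* Curves in a given direction of `κ(u)` come from one-parameter subgroups
  (`exists_isOneParameterSubgroup`), obtained by solving the equation of a right-invariant vector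
  field in real or complex time (`exists_hasDerivAt_eq`). Curves in `U p ∩ U' p` come from the
  implicit function theorem (`SmoothAction.exists_curve_mem_orbit_inter`).
* Conversely a smooth curve in `U p` is tangent to `κ(u)`
  (`SmoothAction.tderiv_mem_of_eventually_mem_orbit`). Near `p` there is a slice coordinate `η`, whose
  level sets are tangent to `κ(u)` along the orbit. The orbit is the union of countably many smooth
  families, the words in a parametrization of a neighbourhood of `1` in `U`, along each of which `η`
  is locally constant; so `η` takes countably many values on the orbit near `p`
  (`SmoothAction.countable_slice_image`), hence is constant along continuous curves in it.

Both use that `Ad_g u = u` for `g ∈ U` (`adDeriv_mem_of_mem_connectedSubgroup`), which makes products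
of maps tangent to `u` tangent to `u` again and `dim κ_z(u)` constant along the orbit. It rests on
`d/dg Ad_g w = [·, w]` at `g = 1` (`tderiv_adDeriv_one`), as does the `Ad`-invariance of the form.

Tangent spaces are identified with the model space through the preferred charts, and the derivative
of a map `f` between manifolds is used in the form `tderiv f x : E →L[𝕜] F`.
-/

/-! ### Bivectors and Lagrangian splittings -/

namespace DrinfeldPoisson

section BivectorAlgebra

variable {𝕜 : Type*} [Field 𝕜] {V W : Type*} [AddCommGroup V] [Module 𝕜 V]
  [AddCommGroup W] [Module 𝕜 W]

lemma bivectorSharp_apply (P : ⋀[𝕜]^2 V) (α β : Module.Dual 𝕜 V) :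
    bivectorSharp P α β = bivectorEval P α β := rfl

lemma bivectorEval_swap (P : ⋀[𝕜]^2 V) (α β : Module.Dual 𝕜 V) :
    bivectorEval P α β = -bivectorEval P β α := by
  have h := (exteriorPower.ιMulti 𝕜 2 (M := Module.Dual 𝕜 V)).map_swap ![β, α]
    (i := 0) (j := 1) (by decide)
  have h2 : (![β, α] ∘ (Equiv.swap (0 : Fin 2) 1)) = ![α, β] := by
    ext i; fin_cases i <;> simp
  rw [h2] at h
  simp only [bivectorEval]
  rw [h, map_neg, LinearMap.neg_apply]

lemma bivectorEval_map (f : V →ₗ[𝕜] W) (P : ⋀[𝕜]^2 V) (α β : Module.Dual 𝕜 W) :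
    bivectorEval (exteriorPower.map 2 f P) α β = bivectorEval P (α ∘ₗ f) (β ∘ₗ f) := by
  have key : (exteriorPower.pairingDual 𝕜 W 2 (exteriorPower.ιMulti 𝕜 2 ![α, β])) ∘ₗ
      exteriorPower.map 2 f =
      exteriorPower.pairingDual 𝕜 V 2 (exteriorPower.ιMulti 𝕜 2 ![α ∘ₗ f, β ∘ₗ f]) := by
    apply exteriorPower.linearMap_ext
    ext v
    simp [Matrix.det_fin_two]
  exact LinearMap.congr_fun key P

/-- A bivector on a finite-dimensional space is determined by its values on covectors. -/
lemma bivector_ext [FiniteDimensional 𝕜 V] {P P' : ⋀[𝕜]^2 V}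
    (h : ∀ α β, bivectorEval P α β = bivectorEval P' α β) : P = P' := by
  let b := Module.finBasis 𝕜 V
  apply (b.exteriorPower 2).ext_elem
  intro s
  rw [exteriorPower.basis_repr_apply, exteriorPower.basis_repr_apply]
  have := h (b.coord (Set.powersetCard.ofFinEmbEquiv.symm s 0))
    (b.coord (Set.powersetCard.ofFinEmbEquiv.symm s 1))
  have h2 : (b.coord ∘ (Set.powersetCard.ofFinEmbEquiv.symm s)) =
      ![(b.coord (Set.powersetCard.ofFinEmbEquiv.symm s 0)),
        (b.coord (Set.powersetCard.ofFinEmbEquiv.symm s 1))] := by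
    ext i; fin_cases i <;> rfl
  simpa only [bivectorEval, exteriorPower.ιMultiDual, exteriorPower.ιMulti_family, h2] using this

end BivectorAlgebra

section DrinfeldAlgebra

variable {𝕜 : Type*} [Field 𝕜] {V : Type*} [AddCommGroup V] [Module 𝕜 V]
  [FiniteDimensional 𝕜 V] {T : Type*} [AddCommGroup T] [Module 𝕜 T]
  {B : LinearMap.BilinForm 𝕜 V} {u u' a : Submodule 𝕜 V}

omit [FiniteDimensional 𝕜 V] in
lemma exists_splitting_projection (h : IsCompl u u') :
    ∃ p : V →ₗ[𝕜] V, (∀ z, p z ∈ u) ∧ (∀ z, z - p z ∈ u') ∧ (∀ z ∈ u, p z = z) ∧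
      (∀ z ∈ u', p z = 0) := by
  refine ⟨u.subtype ∘ₗ u.projectionOnto u' h, fun z => ?_, fun z => ?_, fun z hz => ?_,
    fun z hz => ?_⟩
  · simp
  · have : z - (u.projectionOnto u' h z : V) ∈ LinearMap.ker (u.projectionOnto u' h) := by
      rw [LinearMap.mem_ker, map_sub, Submodule.projectionOnto_apply_left, sub_self]
    rwa [Submodule.ker_projectionOnto] at this
  · exact congrArg Subtype.val (Submodule.projectionOnto_apply_left h ⟨z, hz⟩)
  · rw [← Submodule.ker_projectionOnto h, LinearMap.mem_ker] at hz
    simp [hz]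

omit [FiniteDimensional 𝕜 V] in
lemma isotropic_of_orthogonal_eq (h : B.orthogonal u = u) {y z : V} (hy : y ∈ u) (hz : z ∈ u) :
    B y z = 0 := by
  rw [← h] at hz
  exact hz y hy

omit [FiniteDimensional 𝕜 V] in
lemma orthogonal_sup (U W : Submodule 𝕜 V) :
    B.orthogonal (U ⊔ W) = B.orthogonal U ⊓ B.orthogonal W := by
  apply le_antisymm
  · exact le_inf (LinearMap.BilinForm.orthogonal_le le_sup_left)
      (LinearMap.BilinForm.orthogonal_le le_sup_right)
  · rintro z ⟨h1, h2⟩ y hy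
    obtain ⟨y1, hy1, y2, hy2, rfl⟩ := Submodule.mem_sup.1 hy
    have e1 : B y1 z = 0 := h1 y1 hy1
    have e2 : B y2 z = 0 := h2 y2 hy2
    change B (y1 + y2) z = 0
    simp [e1, e2]

lemma orthogonal_inf (hB : B.Nondegenerate) (hs : B.IsSymm) (U W : Submodule 𝕜 V) :
    B.orthogonal (U ⊓ W) = B.orthogonal U ⊔ B.orthogonal W := by
  have hr := hs.isRefl
  rw [← LinearMap.BilinForm.orthogonal_orthogonal hB hr (B.orthogonal U ⊔ B.orthogonal W),
    orthogonal_sup, LinearMap.BilinForm.orthogonal_orthogonal hB hr,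
    LinearMap.BilinForm.orthogonal_orthogonal hB hr]

/-- The sum of `a^⊥` and `u ∩ a` is Lagrangian when `a` is coisotropic and `u` Lagrangian. -/
lemma orthogonal_sup_inf_eq_self (hB : B.Nondegenerate) (hs : B.IsSymm)
    (hu : B.orthogonal u = u) (ha : B.orthogonal a ≤ a) :
    B.orthogonal (B.orthogonal a ⊔ (u ⊓ a)) = B.orthogonal a ⊔ (u ⊓ a) := by
  rw [orthogonal_sup, LinearMap.BilinForm.orthogonal_orthogonal hB hs.isRefl,
    orthogonal_inf hB hs, hu, sup_comm u, inf_comm a, sup_inf_assoc_of_le u ha]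

omit [FiniteDimensional 𝕜 V] in
/-- Let `a^⊥ ⊆ a` and let the covectors `f`, `g` of `T = 𝔡 / a` be represented by
`α, β ∈ a^⊥`. Then `κ(R)(f, g) = ⟨pr_u α, β⟩`. -/
lemma bivectorEval_map_rMatrix [CharZero 𝕜] (hs : B.IsSymm)
    (hu : B.orthogonal u = u) (hu' : B.orthogonal u' = u')
    (ha : B.orthogonal a ≤ a) (κ : V →ₗ[𝕜] T)
    {n : ℕ} (x : Module.Basis (Fin n) 𝕜 u) (ξ : Module.Basis (Fin n) 𝕜 u')
    (hdual : ∀ i j, B (x i : V) (ξ j : V) = if i = j then 1 else 0)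
    {p : V →ₗ[𝕜] V} (hp : ∀ z, p z ∈ u) (hp' : ∀ z, z - p z ∈ u')
    {f g : Module.Dual 𝕜 T} {α β : V} (hα : α ∈ B.orthogonal a) (hβ : β ∈ B.orthogonal a)
    (hf : ∀ z, f (κ z) = B α z) (hg : ∀ z, g (κ z) = B β z) :
    bivectorEval (exteriorPower.map 2 κ (rMatrix (𝕜 := 𝕜) (fun i => (x i : V))
      (fun i => (ξ i : V)))) f g = B (p α) β := by
  -- `pr_u α = ∑ ⟨α, ξ_i⟩ x_i`
  have expand : ∀ γ, p γ = ∑ i, B γ (ξ i) • (x i : V) := by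
    intro γ
    have h1 := congrArg (Submodule.subtype u) (x.sum_repr ⟨p γ, hp γ⟩)
    simp only [map_sum, map_smul, Submodule.subtype_apply] at h1
    rw [← h1]
    refine Finset.sum_congr rfl fun i _ => ?_
    congr 1
    have h2 : B γ (ξ i) = B (p γ) (ξ i) := by
      have := isotropic_of_orthogonal_eq hu' (hp' γ) (ξ i).2
      rw [map_sub, LinearMap.sub_apply, sub_eq_zero] at this
      exact this
    rw [h2]
    conv_rhs => rw [← h1]
    simp [hdual]
  have sumL : ∀ γ δ, ∑ i, B γ (ξ i) * B δ (x i) = B δ (p γ) := by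
    intro γ δ
    rw [expand γ]
    simp
  have hsymm : ∀ y z, B y z = B z y := fun y z => hs.eq y z
  have h0 : B α β = 0 := hβ α (ha hα)
  have h1 : B (p α) β = B (p α) (β - p β) := by
    rw [map_sub, isotropic_of_orthogonal_eq hu (hp α) (hp β), sub_zero]
  have h2 : B (p β) α = B (α - p α) (p β) := by
    rw [map_sub, LinearMap.sub_apply, isotropic_of_orthogonal_eq hu (hp α) (hp β), sub_zero, hsymm]
  have h3 : B (p α) β + B (p β) α = 0 := by
    have h4 := isotropic_of_orthogonal_eq hu' (hp' α) (hp' β)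
    rw [h1, h2]
    have : B α β = B (p α + (α - p α)) (p β + (β - p β)) := by simp
    rw [h0, map_add B, LinearMap.add_apply, map_add, map_add,
      isotropic_of_orthogonal_eq hu (hp α) (hp β), h4] at this
    linear_combination -this
  have main : bivectorEval (exteriorPower.map 2 κ (rMatrix (𝕜 := 𝕜) (fun i => (x i : V))
      (fun i => (ξ i : V)))) f g =
      (1 / 2 : 𝕜) * (B β (p α) - B α (p β)) := by
    rw [bivectorEval_map]
    simp only [rMatrix, bivectorEval, map_smul, map_sum, smul_eq_mul]
    congr 1
    rw [← sumL, ← sumL, ← Finset.sum_sub_distrib]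
    refine Finset.sum_congr rfl fun i _ => ?_
    have := bivectorEval_wedge (ξ i : V) (x i : V) (f ∘ₗ κ) (g ∘ₗ κ)
    rw [bivectorEval] at this
    rw [this]
    simp only [LinearMap.comp_apply, hf, hg]
    ring
  rw [main, hsymm β, hsymm α]
  linear_combination -(1 / 2 : 𝕜) * h3

/-- Every covector of `T = 𝔡 / a` is represented by an element of `a^⊥`. -/
lemma exists_orthogonal_representative (hB : B.Nondegenerate) (hs : B.IsSymm) (κ : V →ₗ[𝕜] T)
    (hker : LinearMap.ker κ = a) (f : Module.Dual 𝕜 T) :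
    ∃ α ∈ B.orthogonal a, ∀ z, f (κ z) = B α z := by
  refine ⟨(B.toDual hB).symm (f ∘ₗ κ), fun y hy => ?_, fun z => ?_⟩
  · change B y _ = 0
    rw [← hker, LinearMap.mem_ker] at hy
    rw [← hs.eq, LinearMap.BilinForm.apply_toDual_symm_apply]
    simp [hy]
  · rw [LinearMap.BilinForm.apply_toDual_symm_apply]
    rfl

omit [FiniteDimensional 𝕜 V] in
/-- Every element of `a^⊥` defines a covector of `T = 𝔡 / a`. -/
lemma exists_covector_of_mem_orthogonal (hs : B.IsSymm) (κ : V →ₗ[𝕜] T)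
    (hκ : Function.Surjective κ) (hker : LinearMap.ker κ = a) {α : V}
    (hα : α ∈ B.orthogonal a) :
    ∃ f : Module.Dual 𝕜 T, ∀ z, f (κ z) = B α z := by
  obtain ⟨s, hsec⟩ := κ.exists_rightInverse_of_surjective (LinearMap.range_eq_top.2 hκ)
  refine ⟨B α ∘ₗ s, fun z => ?_⟩
  have h1 : s (κ z) - z ∈ a := by
    rw [← hker, LinearMap.mem_ker, map_sub]
    have := LinearMap.congr_fun hsec (κ z)
    simp only [LinearMap.comp_apply, LinearMap.id_apply] at this
    rw [this, sub_self]
  have h2 : B (s (κ z) - z) α = 0 := hα _ h1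
  have h3 := hs.eq (s (κ z) - z) α
  rw [LinearMap.comp_apply, ← sub_eq_zero, ← map_sub]
  rw [h2] at h3
  exact h3.symm

/-- A bivector on `T` whose contractions with covectors all lie in the range of an injective map
`j` is the image of a bivector under `j`. -/
lemma exists_map_eq_of_contraction_mem_range {W : Type*} [AddCommGroup W] [Module 𝕜 W]
    [FiniteDimensional 𝕜 T] {j : W →ₗ[𝕜] T} {pr : T →ₗ[𝕜] W} (hpr : pr ∘ₗ j = LinearMap.id)
    (P₀ : ⋀[𝕜]^2 T)
    (h : ∀ f : Module.Dual 𝕜 T, ∃ w : W, ∀ g : Module.Dual 𝕜 T, bivectorEval P₀ f g = g (j w)) :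
    exteriorPower.map 2 j (exteriorPower.map 2 pr P₀) = P₀ := by
  have hpr' : ∀ w, pr (j w) = w := fun w => LinearMap.congr_fun hpr w
  have key : ∀ f g : Module.Dual 𝕜 T, bivectorEval P₀ f (g ∘ₗ j ∘ₗ pr) = bivectorEval P₀ f g := by
    intro f g
    obtain ⟨w, hw⟩ := h f
    rw [hw, hw]
    simp [hpr']
  apply bivector_ext
  intro f g
  rw [bivectorEval_map, bivectorEval_map]
  change bivectorEval P₀ (f ∘ₗ j ∘ₗ pr) (g ∘ₗ j ∘ₗ pr) = _
  rw [key, bivectorEval_swap, key, bivectorEval_swap P₀ f]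

end DrinfeldAlgebra

end DrinfeldPoisson

/-! ### The Drinfeld subalgebra and the rank of the bivector -/

namespace DrinfeldPoisson

section DrinfeldAlgebra

variable {𝕜 : Type*} [Field 𝕜] {V : Type*} [AddCommGroup V] [Module 𝕜 V]
  [FiniteDimensional 𝕜 V] {T : Type*} [AddCommGroup T] [Module 𝕜 T]
  {B : LinearMap.BilinForm 𝕜 V} {u u' a : Submodule 𝕜 V}

/-- The Drinfeld subalgebra is `a^⊥ + (u ∩ a)`. -/
theorem drinfeldSubalgebra_eq_sup [CharZero 𝕜] (hB : B.Nondegenerate) (hs : B.IsSymm)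
    (hc : IsCompl u u') (hu : B.orthogonal u = u) (hu' : B.orthogonal u' = u')
    (ha : B.orthogonal a ≤ a) (κ : V →ₗ[𝕜] T) (hκ : Function.Surjective κ)
    (hker : LinearMap.ker κ = a)
    {n : ℕ} (x : Module.Basis (Fin n) 𝕜 u) (ξ : Module.Basis (Fin n) 𝕜 u')
    (hdual : ∀ i j, B (x i : V) (ξ j : V) = if i = j then 1 else 0) :
    drinfeldSubalgebra B κ u u' a (exteriorPower.map 2 κ (rMatrix (𝕜 := 𝕜)
      (fun i => (x i : V)) (fun i => (ξ i : V)))) =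
      ((B.orthogonal a ⊔ (u ⊓ a) : Submodule 𝕜 V) : Set V) := by
  obtain ⟨p, hp, hp', hpu, hpu'⟩ := exists_splitting_projection hc
  have hsymm : ∀ y z, B y z = B z y := fun y z => hs.eq y z
  have : FiniteDimensional 𝕜 T := Module.Finite.of_surjective κ hκ
  set P₀ := exteriorPower.map 2 κ (rMatrix (𝕜 := 𝕜) (fun i => (x i : V)) (fun i => (ξ i : V)))
    with hP₀
  set N := a.submoduleOf u with hN
  have hkerN : LinearMap.ker (κ ∘ₗ u.subtype) = N := by
    ext y
    rw [LinearMap.mem_ker, hN, Submodule.submoduleOf, Submodule.mem_comap, ← hker,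
      LinearMap.mem_ker]
    rfl
  -- the embedding `j : u / (u ∩ a) → T` and a projection `pr` onto its image
  let j : (u ⧸ N) →ₗ[𝕜] T := N.liftQ (κ ∘ₗ u.subtype) hkerN.ge
  have hj : ∀ y : u, j (N.mkQ y) = κ y := fun y => rfl
  have hjinj : LinearMap.ker j = ⊥ := Submodule.ker_liftQ_eq_bot _ _ _ hkerN.le
  have hjm : j ∘ₗ N.mkQ = κ ∘ₗ u.subtype := N.liftQ_mkQ _ _
  obtain ⟨pr, hpr⟩ := j.exists_leftInverse_of_injective hjinj
  have heval : ∀ {f g : Module.Dual 𝕜 T} {α β : V}, α ∈ B.orthogonal a → β ∈ B.orthogonal a →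
      (∀ z, f (κ z) = B α z) → (∀ z, g (κ z) = B β z) → bivectorEval P₀ f g = B (p α) β :=
    fun hα hβ hf hg => bivectorEval_map_rMatrix hs hu hu' ha κ x ξ hdual hp hp' hα hβ hf hg
  have hP₀range : exteriorPower.map 2 j (exteriorPower.map 2 pr P₀) = P₀ := by
    apply exists_map_eq_of_contraction_mem_range hpr
    intro f
    obtain ⟨α, hα, hf⟩ := exists_orthogonal_representative hB hs κ hker f
    refine ⟨N.mkQ ⟨p α, hp α⟩, fun g => ?_⟩
    obtain ⟨β, hβ, hg⟩ := exists_orthogonal_representative hB hs κ hker g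
    rw [heval hα hβ hf hg, hj, hg, hsymm]
  have hrep : RepresentsBivector κ u a P₀ (exteriorPower.map 2 pr P₀) := by
    obtain ⟨P', hP'⟩ := exteriorPower.map_surjective (n := 2) (R := 𝕜) N.mkQ_surjective
      (exteriorPower.map 2 pr P₀)
    refine ⟨P', hP', ?_⟩
    rw [← hP₀range, ← hP', ← hjm, ← LinearMap.comp_apply, exteriorPower.map_comp]
  have hrep' : ∀ P, RepresentsBivector κ u a P₀ P → exteriorPower.map 2 j P = P₀ := by
    rintro P ⟨P', rfl, h2⟩
    rw [← h2, ← hjm, ← LinearMap.comp_apply, exteriorPower.map_comp]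
  have horth : B.orthogonal (u ⊓ a) = u ⊔ B.orthogonal a := by rw [orthogonal_inf hB hs, hu]
  -- if `η ≡ α` and `θ ≡ β` modulo `u`, with `α, β ∈ a^⊥`, then `P(η, θ) = ⟨pr_u α, θ⟩`
  have hquot : ∀ {P} (_ : RepresentsBivector κ u a P₀ P) {η θ : B.orthogonal (u ⊓ a)} {α β : V},
      (θ : V) ∈ u' →
      α ∈ B.orthogonal a → β ∈ B.orthogonal a → (η : V) - α ∈ u → (θ : V) - β ∈ u →
      bivectorEval P (quotientFunctional B u a η) (quotientFunctional B u a θ) =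
        B (p α) (θ : V) := by
    intro P hP η θ α β hθ hα hβ h1 h2
    obtain ⟨f, hf⟩ := exists_covector_of_mem_orthogonal hs κ hκ hker hα
    obtain ⟨g, hg⟩ := exists_covector_of_mem_orthogonal hs κ hκ hker hβ
    have e : ∀ {f : Module.Dual 𝕜 T} {η : B.orthogonal (u ⊓ a)} {α : V},
        (∀ z, f (κ z) = B α z) → (η : V) - α ∈ u → quotientFunctional B u a η = f ∘ₗ j := by
      intro f η α hf h1
      apply Submodule.linearMap_qext
      ext y
      change B (y : V) (η : V) = f (κ y)
      rw [hf, hsymm, ← sub_eq_zero, ← LinearMap.sub_apply, ← map_sub]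
      exact isotropic_of_orthogonal_eq hu h1 y.2
    rw [e hf h1, e hg h2, ← bivectorEval_map, hrep' P hP, heval hα hβ hf hg, ← sub_eq_zero,
      ← map_sub, hsymm, ← neg_sub, map_neg, LinearMap.neg_apply,
      isotropic_of_orthogonal_eq hu h2 (hp α), neg_zero]
  have hdec : ∀ η ∈ B.orthogonal (u ⊓ a), ∃ α ∈ B.orthogonal a, η - α ∈ u := by
    intro η hη
    rw [horth] at hη
    obtain ⟨y, hy, α, hα, rfl⟩ := Submodule.mem_sup.1 hη
    exact ⟨α, hα, by simpa using hy⟩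
  -- `α = η + pr_u α` is the decomposition of `α ∈ η + u`
  have hpα : ∀ {η α : V}, η ∈ u' → η - α ∈ u → p α = α - η := by
    intro η α h1 h2
    have := hpu _ h2
    rw [map_sub, hpu' _ h1, zero_sub] at this
    rw [← neg_sub η α, ← this, neg_neg]
  ext z
  constructor
  · rintro ⟨P, hP, y, η, hη, rfl, h⟩
    obtain ⟨α, hα, h1⟩ := hdec η η.2
    have hmem : (y : V) - p α ∈ u ⊓ a := by
      rw [← LinearMap.BilinForm.orthogonal_orthogonal hB hs.isRefl (u ⊓ a)]
      have hyu : (y : V) - p α ∈ u := u.sub_mem y.2 (hp α)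
      -- pair with `θ = pr_u θ + pr_{u'} θ`, both components being orthogonal to `u ∩ a`
      intro θ hθ
      change B θ _ = 0
      have hpθ : p θ ∈ B.orthogonal (u ⊓ a) := by
        rw [horth]; exact Submodule.mem_sup_left (hp θ)
      let θ' : B.orthogonal (u ⊓ a) := ⟨θ - p θ, Submodule.sub_mem _ hθ hpθ⟩
      obtain ⟨β, hβ, h2⟩ := hdec θ' θ'.2
      have h3 := h θ' (hp' θ)
      rw [hquot hP (hp' θ) hα hβ h1 h2] at h3
      change B (y : V) (θ - p θ) = B (p α) (θ - p θ) at h3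
      rw [hsymm]
      have h4 : B ((y : V) - p α) (p θ) = 0 := isotropic_of_orthogonal_eq hu hyu (hp θ)
      have h5 : B ((y : V) - p α) (θ - p θ) = 0 := by
        rw [map_sub B, LinearMap.sub_apply, h3, sub_self]
      rw [map_sub, h4, sub_zero] at h5
      exact h5
    refine Submodule.mem_sup.2 ⟨α, hα, (y : V) - p α, hmem, ?_⟩
    rw [hpα hη h1]
    abel
  · intro hz
    obtain ⟨α, hα, y, hy, rfl⟩ := Submodule.mem_sup.1 hz
    have hη : α - p α ∈ B.orthogonal (u ⊓ a) := by
      rw [horth]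
      exact Submodule.sub_mem _ (Submodule.mem_sup_right hα) (Submodule.mem_sup_left (hp α))
    refine ⟨_, hrep, ⟨p α + y, u.add_mem (hp α) hy.1⟩, ⟨α - p α, hη⟩, hp' α, ?_, ?_⟩
    · change _ = p α + y + (α - p α)
      abel
    · intro θ hθ
      obtain ⟨β, hβ, h2⟩ := hdec θ θ.2
      rw [hquot hrep hθ hα hβ (by simpa using hp α) h2]
      change B (p α + y) (θ : V) = _
      have : B y (θ : V) = 0 := θ.2 y hy
      rw [map_add, LinearMap.add_apply, this, add_zero]

omit [FiniteDimensional 𝕜 V] in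
lemma finrank_comap_subtype (U W : Submodule 𝕜 V) :
    Module.finrank 𝕜 (W.comap U.subtype) = Module.finrank 𝕜 (U ⊓ W : Submodule 𝕜 V) := by
  rw [← Submodule.finrank_map_subtype_eq, Submodule.map_comap_subtype]

/-- The rank of `κ(R)` is `dim κ(u) - dim (u' ∩ l)`, where `l = a^⊥ + (u ∩ a)`. -/
theorem bivectorRank_map_rMatrix [CharZero 𝕜] (hB : B.Nondegenerate) (hs : B.IsSymm)
    (hc : IsCompl u u') (hu : B.orthogonal u = u) (hu' : B.orthogonal u' = u')
    (ha : B.orthogonal a ≤ a) (κ : V →ₗ[𝕜] T) (hκ : Function.Surjective κ)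
    (hker : LinearMap.ker κ = a)
    {n : ℕ} (x : Module.Basis (Fin n) 𝕜 u) (ξ : Module.Basis (Fin n) 𝕜 u')
    (hdual : ∀ i j, B (x i : V) (ξ j : V) = if i = j then 1 else 0) :
    bivectorRank (exteriorPower.map 2 κ (rMatrix (𝕜 := 𝕜)
      (fun i => (x i : V)) (fun i => (ξ i : V)))) +
      Module.finrank 𝕜 (u' ⊓ (B.orthogonal a ⊔ (u ⊓ a)) : Submodule 𝕜 V) =
      Module.finrank 𝕜 (u.map κ) := by
  obtain ⟨p, hp, hp', hpu, hpu'⟩ := exists_splitting_projection hc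
  have : FiniteDimensional 𝕜 T := Module.Finite.of_surjective κ hκ
  have hsymm : ∀ y z, B y z = B z y := fun y z => hs.eq y z
  set P₀ := exteriorPower.map 2 κ (rMatrix (𝕜 := 𝕜) (fun i => (x i : V)) (fun i => (ξ i : V)))
    with hP₀
  have heval : ∀ {f g : Module.Dual 𝕜 T} {α β : V}, α ∈ B.orthogonal a → β ∈ B.orthogonal a →
      (∀ z, f (κ z) = B α z) → (∀ z, g (κ z) = B β z) → bivectorEval P₀ f g = B (p α) β :=
    fun hα hβ hf hg => bivectorEval_map_rMatrix hs hu hu' ha κ x ξ hdual hp hp' hα hβ hf hg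
  set C := B.orthogonal a with hC
  -- the range of `P^♯` is the image of `a^⊥` under `κ ∘ pr_u`
  have hrange : LinearMap.range (bivectorSharp P₀) =
      (C.map (κ ∘ₗ p)).map (Module.Dual.eval 𝕜 T) := by
    have hsharp : ∀ {f : Module.Dual 𝕜 T} {α : V}, α ∈ C → (∀ z, f (κ z) = B α z) →
        bivectorSharp P₀ f = Module.Dual.eval 𝕜 T (κ (p α)) := by
      intro f α hα hf
      ext g
      obtain ⟨β, hβ, hg⟩ := exists_orthogonal_representative hB hs κ hker g
      rw [bivectorSharp_apply, heval hα hβ hf hg, Module.Dual.eval_apply, hg, hsymm]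
    ext φ
    constructor
    · rintro ⟨f, rfl⟩
      obtain ⟨α, hα, hf⟩ := exists_orthogonal_representative hB hs κ hker f
      exact ⟨κ (p α), ⟨α, hα, rfl⟩, (hsharp hα hf).symm⟩
    · rintro ⟨_, ⟨α, hα, rfl⟩, rfl⟩
      obtain ⟨f, hf⟩ := exists_covector_of_mem_orthogonal hs κ hκ hker hα
      exact ⟨f, hsharp hα hf⟩
  have hrank : bivectorRank P₀ = Module.finrank 𝕜 (C.map (κ ∘ₗ p)) := by
    rw [bivectorRank, hrange]
    exact (Submodule.equivMapOfInjective _ (Module.eval_apply_injective 𝕜) _).finrank_eq.symm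
  -- `K` is the kernel of `κ ∘ pr_u` on `a^⊥`; the map `1 - pr_u` sends it onto `u' ∩ l`,
  -- with kernel `u ∩ a^⊥`
  set K := C ⊓ a.comap p with hK
  have e1 : Module.finrank 𝕜 (C.map (κ ∘ₗ p)) + Module.finrank 𝕜 K = Module.finrank 𝕜 C := by
    have := ((κ ∘ₗ p).domRestrict C).finrank_range_add_finrank_ker
    rw [LinearMap.range_domRestrict, LinearMap.ker_domRestrict, LinearMap.ker_comp, hker] at this
    rw [← this, hK, finrank_comap_subtype]
  have e2 : Module.finrank 𝕜 (u' ⊓ (C ⊔ (u ⊓ a)) : Submodule 𝕜 V) +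
      Module.finrank 𝕜 (u ⊓ C : Submodule 𝕜 V) = Module.finrank 𝕜 K := by
    have hmap : K.map (LinearMap.id - p) = u' ⊓ (C ⊔ (u ⊓ a)) := by
      ext ζ
      constructor
      · rintro ⟨α, ⟨hα, h1⟩, rfl⟩
        refine ⟨hp' α, ?_⟩
        exact Submodule.sub_mem _ (Submodule.mem_sup_left hα) (Submodule.mem_sup_right ⟨hp α, h1⟩)
      · rintro ⟨h1, h2⟩
        obtain ⟨α, hα, y, hy, rfl⟩ := Submodule.mem_sup.1 h2
        have h3 : p α = -y := by
          have := hpu' _ h1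
          rw [map_add, hpu _ hy.1] at this
          exact eq_neg_of_add_eq_zero_left this
        refine ⟨α, ⟨hα, ?_⟩, ?_⟩
        · change p α ∈ a
          rw [h3]; exact a.neg_mem hy.2
        · simp [h3]
    have hkerK : K ⊓ LinearMap.ker (LinearMap.id - p) = u ⊓ C := by
      ext ζ
      constructor
      · rintro ⟨⟨h1, -⟩, h2⟩
        have h3 : ζ - p ζ = 0 := h2
        refine ⟨?_, h1⟩
        rw [sub_eq_zero.1 h3]; exact hp ζ
      · rintro ⟨h1, h2⟩
        have h3 := hpu _ h1
        refine ⟨⟨h2, ?_⟩, ?_⟩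
        · change p ζ ∈ a
          rw [h3]; exact ha h2
        · simp [h3]
    have := ((LinearMap.id - p).domRestrict K).finrank_range_add_finrank_ker
    rwa [LinearMap.range_domRestrict, LinearMap.ker_domRestrict, finrank_comap_subtype, hmap,
      hkerK] at this
  have e3 : Module.finrank 𝕜 (u.map κ) + Module.finrank 𝕜 (u ⊓ a : Submodule 𝕜 V) =
      Module.finrank 𝕜 u := by
    have := (κ.domRestrict u).finrank_range_add_finrank_ker
    rw [LinearMap.range_domRestrict, LinearMap.ker_domRestrict, hker,
      finrank_comap_subtype] at this
    exact this
  have e4 := LinearMap.BilinForm.finrank_orthogonal hB (u ⊓ a)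
  have e5 := LinearMap.BilinForm.finrank_orthogonal hB u
  have e6 := Submodule.finrank_sup_add_finrank_inf_eq u C
  rw [orthogonal_inf hB hs, hu, ← hC] at e4
  rw [hu] at e5
  have e7 := Submodule.finrank_le u
  have e8 := Submodule.finrank_le (u ⊓ a)
  omega

end DrinfeldAlgebra

section Subalgebra

variable {𝕜 : Type*} [Field 𝕜] {𝔡 : Type*} [LieRing 𝔡] [LieAlgebra 𝕜 𝔡]
  {B : LinearMap.BilinForm 𝕜 𝔡}

/-- For a coisotropic subalgebra `a`, the orthogonal `a^⊥` is an ideal of `a`, so that its sum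
with a subalgebra of `a` is again a subalgebra. -/
lemma lie_mem_orthogonal_sup_inf (hB : IsQuadratic B) {u a : Submodule 𝕜 𝔡}
    (hu : ∀ y ∈ u, ∀ z ∈ u, ⁅y, z⁆ ∈ u) (haa : ∀ y ∈ a, ∀ z ∈ a, ⁅y, z⁆ ∈ a)
    (ha : B.orthogonal a ≤ a) {y z : 𝔡} (hy : y ∈ B.orthogonal a ⊔ (u ⊓ a))
    (hz : z ∈ B.orthogonal a ⊔ (u ⊓ a)) : ⁅y, z⁆ ∈ B.orthogonal a ⊔ (u ⊓ a) := by
  have ideal : ∀ v ∈ a, ∀ w ∈ B.orthogonal a, ⁅v, w⁆ ∈ B.orthogonal a := by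
    intro v hv w hw t ht
    change B t ⁅v, w⁆ = 0
    rw [← hB.invariant]
    exact hw _ (haa t ht v hv)
  obtain ⟨y1, hy1, y2, hy2, rfl⟩ := Submodule.mem_sup.1 hy
  obtain ⟨z1, hz1, z2, hz2, rfl⟩ := Submodule.mem_sup.1 hz
  rw [add_lie, lie_add, lie_add]
  refine Submodule.add_mem _ (Submodule.add_mem _ ?_ ?_) (Submodule.add_mem _ ?_ ?_)
  · exact Submodule.mem_sup_left (ideal _ (ha hy1) _ hz1)
  · rw [← lie_skew]
    exact Submodule.mem_sup_left (Submodule.neg_mem _ (ideal _ hz2.2 _ hy1))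
  · exact Submodule.mem_sup_left (ideal _ hy2.2 _ hz1)
  · exact Submodule.mem_sup_right ⟨hu _ hy2.1 _ hz2.1, haa _ hy2.2 _ hz2.2⟩

end Subalgebra

end DrinfeldPoisson

/-! ### Differential equations in real or complex time -/

namespace DrinfeldPoisson

section ODE

open Metric Set

variable {𝕜 : Type*} [RCLike 𝕜] {E : Type*} [NormedAddCommGroup E] [NormedSpace 𝕜 E]

lemma gronwallBound_zero_eq_mul (K ε x : ℝ) :
    gronwallBound 0 K ε x = ε * gronwallBound 0 K 1 x := by
  by_cases hK : K = 0
  · subst hK; simp [gronwallBound_K0]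
  · simp only [gronwallBound_of_K_ne_0 hK]; ring

/-- Uniform first and second order estimates near a point for a smooth map. -/
lemma exists_closedBall_bounds [NormedSpace ℝ E] {f : E → E} {O : Set E} (hO : IsOpen O) {y₀ : E}
    (hy : y₀ ∈ O) (hf : ContDiffOn 𝕜 ∞ f O) :
    ∃ R > 0, ∃ M K C : NNReal, closedBall y₀ R ⊆ O ∧ (∀ y ∈ closedBall y₀ R, ‖f y‖ ≤ M) ∧
      LipschitzOnWith K f (closedBall y₀ R) ∧ (∀ y ∈ closedBall y₀ R, ‖fderiv 𝕜 f y‖ ≤ M) ∧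
      ∀ y ∈ closedBall y₀ R, ∀ y' ∈ closedBall y₀ R,
        ‖f y' - f y - fderiv 𝕜 f y (y' - y)‖ ≤ C * ‖y' - y‖ ^ 2 := by
  have hf0 : ContDiffAt 𝕜 ∞ f y₀ := hf.contDiffAt (hO.mem_nhds hy)
  have hf1 : ContDiffAt 𝕜 1 (fderiv 𝕜 f) y₀ :=
    hf0.fderiv_right (m := 1) (by norm_cast)
  obtain ⟨K, s, hs, hK⟩ := (hf0.of_le (m := 1) (by simp)).exists_lipschitzOnWith
  obtain ⟨C, s', hs', hC⟩ := hf1.exists_lipschitzOnWith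
  have hMf : ∀ᶠ y in 𝓝 y₀, ‖f y‖ < ‖f y₀‖ + 1 :=
    hf0.continuousAt.norm.eventually_lt_const (lt_add_one _)
  have hMf' : ∀ᶠ y in 𝓝 y₀, ‖fderiv 𝕜 f y‖ < ‖fderiv 𝕜 f y₀‖ + 1 :=
    hf1.continuousAt.norm.eventually_lt_const (lt_add_one _)
  obtain ⟨R, hR, hRs⟩ := Metric.nhds_basis_closedBall.mem_iff.1
    (Filter.inter_mem (Filter.inter_mem (Filter.inter_mem hs hs') (Filter.inter_mem hMf hMf'))
      (hO.mem_nhds hy))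
  refine ⟨R, hR, ‖f y₀‖₊ + 1 + (‖fderiv 𝕜 f y₀‖₊ + 1), K, C, fun y h => (hRs h).2, ?_, ?_, ?_, ?_⟩
  · intro y h
    have h1 : ‖f y‖ < ‖f y₀‖ + 1 := (hRs h).1.2.1
    push_cast
    have := norm_nonneg (fderiv 𝕜 f y₀)
    linarith
  · exact hK.mono fun y h => (hRs h).1.1.1
  · intro y h
    have h1 : ‖fderiv 𝕜 f y‖ < ‖fderiv 𝕜 f y₀‖ + 1 := (hRs h).1.2.2
    push_cast
    have := norm_nonneg (f y₀)
    linarith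
  · intro y h y' h'
    have hd : ∀ w ∈ closedBall y₀ R, DifferentiableAt 𝕜 f w := fun w hw =>
      (hf.contDiffAt (hO.mem_nhds (hRs hw).2)).differentiableAt (by simp)
    have key := (((convex_closedBall y₀ R).inter (convex_closedBall y ‖y' - y‖)
      )).norm_image_sub_le_of_norm_fderiv_le' (𝕜 := 𝕜) (f := f) (φ := fderiv 𝕜 f y)
      (C := C * ‖y' - y‖) (x := y) (y := y')
      (fun w hw => hd w hw.1) (fun w hw => ?_) ⟨h, by simp⟩ ⟨h', by simp [dist_eq_norm]⟩
    · rw [pow_two, ← mul_assoc]; exact key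
    · have h1 := hC.dist_le_mul w (hRs hw.1).1.1.2 y (hRs h).1.1.2
      rw [dist_eq_norm] at h1
      refine h1.trans ?_
      gcongr
      exact hw.2

/-- Local solvability of the autonomous equation `z' = f(z)` in `𝕜`-time, `𝕜 = ℝ` or `ℂ`. For
`μ ∈ 𝕜`, let `y_μ` solve the real-time equation `y' = μ f(y)`; then `z(μ) = y_μ(1)` is the
solution, because `y_μ(s) + h s f(y_μ(s))` solves the equation of `y_{μ + h}` up to an error
`O(h²)`. -/
theorem exists_hasDerivAt_eq [CompleteSpace E] {f : E → E} {O : Set E} (hO : IsOpen O) {y₀ : E}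
    (hy : y₀ ∈ O) (hf : ContDiffOn 𝕜 ∞ f O) :
    ∃ r > 0, ∃ z : 𝕜 → E, z 0 = y₀ ∧ (∀ t ∈ ball (0 : 𝕜) r, z t ∈ O ∧ HasDerivAt z (f (z t)) t) ∧
      ContDiffOn 𝕜 ∞ z (ball 0 r) := by
  let _ : NormedSpace ℝ E := NormedSpace.restrictScalars ℝ 𝕜 E
  have : IsScalarTower ℝ 𝕜 E := IsScalarTower.restrictScalars ℝ 𝕜 E
  obtain ⟨R, hR, M, K, C, hRO, hM, hK, hM', hC⟩ := exists_closedBall_bounds hO hy hf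
  -- `r` is so small that the solutions `y_μ` exist on `[0, 1]` in the ball of radius `R / 2`
  set r : ℝ := R / 2 / (M + 1) with hr
  have hr0 : 0 < r := by positivity
  have hrM : r * M ≤ R / 2 := by
    rw [hr, div_mul_eq_mul_div, div_le_iff₀ (by positivity)]
    nlinarith [M.2]
  have hbR : closedBall y₀ (R / 2) ⊆ closedBall y₀ R := closedBall_subset_closedBall (by linarith)
  obtain ⟨a, ha⟩ : ∃ a : NNReal, (a : ℝ) = R / 2 :=
    ⟨(R / 2).toNNReal, Real.coe_toNNReal _ (by linarith)⟩
  have ex : ∀ μ ∈ ball (0 : 𝕜) r, ∃ y : ℝ → E, y 0 = y₀ ∧ ∀ s ∈ Icc (0 : ℝ) 1,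
      y s ∈ closedBall y₀ (R / 2) ∧ HasDerivWithinAt y (μ • f (y s)) (Icc 0 1) s := by
    intro μ hμ
    rw [mem_ball_zero_iff] at hμ
    have hPL : IsPicardLindelof (fun _ y => μ • f y) (⟨0, by simp⟩ : Icc (0 : ℝ) 1) y₀
        a 0 (‖μ‖₊ * M) (‖μ‖₊ * K) := by
      apply IsPicardLindelof.of_time_independent
      · intro w hw
        rw [norm_smul]
        push_cast
        gcongr
        exact hM w (hbR (ha ▸ hw))
      · exact (lipschitzWith_smul μ).comp_lipschitzOnWith (hK.mono (ha ▸ hbR))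
      · simp only [sub_zero, sub_self, NNReal.coe_mul, coe_nnnorm, NNReal.coe_zero]
        rw [max_eq_left zero_le_one, mul_one, ha]
        refine le_trans ?_ hrM
        gcongr
    obtain ⟨α, hα⟩ := ODE.FunSpace.exists_isFixedPt_next hPL (mem_closedBall_self le_rfl)
    refine ⟨α.compProj, by
      rw [ODE.FunSpace.compProj_val (t := (⟨0, by simp⟩ : Icc (0 : ℝ) 1)), ← hα,
        ODE.FunSpace.next_apply₀], fun t ht => ⟨?_, ?_⟩⟩
    · rw [← ha]
      exact α.compProj_mem_closedBall hPL.mul_max_le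
    · have := ODE.hasDerivWithinAt_picard_Icc (⟨0, by simp⟩ : Icc (0 : ℝ) 1).2
        hPL.continuousOn_uncurry
        α.continuous_compProj.continuousOn (fun _ ht' ↦ α.compProj_mem_closedBall hPL.mul_max_le)
        y₀ ht
      refine this.congr_of_mem ?_ ht
      intro t' ht'
      rw [← ODE.FunSpace.next_apply hPL (mem_closedBall_self le_rfl) α (t := ⟨t', ht'⟩), hα,
        ODE.FunSpace.compProj_of_mem ht']
  choose! y hy0 hyI using ex
  let z : 𝕜 → E := fun μ => y μ 1
  have hz : ∀ μ ∈ ball (0 : 𝕜) r, z μ ∈ closedBall y₀ (R / 2) := fun μ hμ =>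
    (hyI μ hμ 1 (by simp)).1
  have hder : ∀ μ ∈ ball (0 : 𝕜) r, HasDerivAt z (f (z μ)) μ := by
    intro μ hμ
    have hcont : ∀ ν ∈ ball (0 : 𝕜) r, ContinuousOn (y ν) (Icc 0 1) := fun ν hν s hs =>
      (hyI ν hν s hs).2.continuousWithinAt
    have hright : ∀ ν ∈ ball (0 : 𝕜) r, ∀ s ∈ Ico (0 : ℝ) 1,
        HasDerivWithinAt (y ν) (ν • f (y ν s)) (Ici s) s := fun ν hν s hs =>
      (hyI ν hν s ⟨hs.1, hs.2.le⟩).2.mono_of_mem_nhdsWithin (Icc_mem_nhdsGE_of_mem hs)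
    -- `c |h|²` bounds the error of `s ↦ y_μ(s) + h s f(y_μ(s))` as a solution
    set c : ℝ := M * M + r * (C * M ^ 2) with hc
    have est : ∀ h : 𝕜, μ + h ∈ ball (0 : 𝕜) r → ‖h‖ * M ≤ R / 2 →
        ‖z (μ + h) - z μ - h • f (z μ)‖ ≤
          (c * gronwallBound 0 (‖r‖₊ * K : NNReal) 1 1) * ‖h‖ ^ 2 := by
      intro h hh hhM
      have hmem : ∀ s ∈ Icc (0 : ℝ) 1, y μ s + h • (s : ℝ) • f (y μ s) ∈ closedBall y₀ R := by
        intro s hs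
        have h1 := (hyI μ hμ s hs).1
        rw [mem_closedBall, dist_eq_norm] at h1 ⊢
        have h2 : ‖h • s • f (y μ s)‖ ≤ R / 2 := by
          rw [norm_smul, norm_smul, Real.norm_of_nonneg hs.1]
          refine le_trans ?_ hhM
          gcongr
          calc s * ‖f (y μ s)‖ ≤ 1 * M := by
                gcongr
                · exact hs.2
                · exact hM _ (hbR (hyI μ hμ s hs).1)
            _ = M := one_mul _
        calc ‖y μ s + h • s • f (y μ s) - y₀‖ = ‖(y μ s - y₀) + h • s • f (y μ s)‖ := by
              congr 1; abel
          _ ≤ ‖y μ s - y₀‖ + ‖h • s • f (y μ s)‖ := norm_add_le _ _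
          _ ≤ R := by linarith
      have hfy : ∀ s ∈ Ico (0 : ℝ) 1, HasDerivWithinAt (fun s => f (y μ s))
          (fderiv 𝕜 f (y μ s) (μ • f (y μ s))) (Ici s) s := by
        intro s hs
        have hd : HasFDerivAt f (fderiv 𝕜 f (y μ s)) (y μ s) :=
          ((hf.contDiffAt (hO.mem_nhds (hRO (hbR (hyI μ hμ s ⟨hs.1, hs.2.le⟩).1)))).differentiableAt
            (by simp)).hasFDerivAt
        exact (hd.restrictScalars ℝ).comp_hasDerivWithinAt s (hright μ hμ s hs)
      have hfc : ContinuousOn (fun s => f (y μ s)) (Icc 0 1) :=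
        (hf.continuousOn.mono hRO).comp (hcont μ hμ) fun s hs => hbR (hyI μ hμ s hs).1
      have G := dist_le_of_approx_trajectories_ODE_of_mem (v := fun _ w => (μ + h) • f w)
        (K := ‖r‖₊ * K) (s := fun _ => closedBall y₀ R) (a := 0) (b := 1) (f := y (μ + h))
        (g := fun s => y μ s + h • (s : ℝ) • f (y μ s))
        (f' := fun s => (μ + h) • f (y (μ + h) s))
        (g' := fun s => μ • f (y μ s) + h • ((s : ℝ) • fderiv 𝕜 f (y μ s) (μ • f (y μ s)) +
          (1 : ℝ) • f (y μ s)))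
        (εf := 0) (εg := c * ‖h‖ ^ 2) (δ := 0)
        (fun t _ => by
          refine ((lipschitzWith_smul (μ + h)).comp_lipschitzOnWith hK).weaken ?_
          gcongr
          rw [mem_ball_zero_iff] at hh
          rw [← NNReal.coe_le_coe, coe_nnnorm, coe_nnnorm, Real.norm_of_nonneg hr0.le]
          exact hh.le)
        (hcont _ hh) (hright _ hh) (fun t _ => by simp)
        (fun t ht => hbR (hyI _ hh t ⟨ht.1, ht.2.le⟩).1)
        ((hcont _ hμ).add ((continuousOn_id.smul hfc).const_smul h))
        (fun t ht => (hright _ hμ t ht).add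
          (((hasDerivWithinAt_id t _).smul (hfy t ht)).const_smul h))
        (fun t ht => ?_) (fun t ht => hmem t ⟨ht.1, ht.2.le⟩)
        (by simp [hy0 _ hμ, hy0 _ hh]) 1 (by simp)
      · simp only [dist_eq_norm, one_smul, zero_add, sub_zero] at G
        rw [gronwallBound_zero_eq_mul, mul_right_comm] at G
        rwa [sub_sub]
      · have hyt := hbR (hyI μ hμ t ⟨ht.1, ht.2.le⟩).1
        have hC' := hC _ hyt _ (hmem t ⟨ht.1, ht.2.le⟩)
        set Y := y μ t
        set A := fderiv 𝕜 f Y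
        set ρ := f (Y + h • t • f Y) - f Y - A (Y + h • t • f Y - Y)
        have hA : A (Y + h • t • f Y - Y) = h • t • A (f Y) := by
          rw [add_sub_cancel_left, map_smul, ← algebraMap_smul 𝕜 t (f Y), map_smul,
            algebraMap_smul]
        have e1 : f (Y + h • t • f Y) = f Y + h • t • A (f Y) + ρ := by
          rw [← hA]; simp only [ρ]; abel
        have e2 : μ • f Y + h • (t • A (μ • f Y) + (1 : ℝ) • f Y) - (μ + h) • f (Y + h • t • f Y) =
            -((h * h) • t • A (f Y)) - (μ + h) • ρ := by
          rw [e1, map_smul, one_smul]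
          simp only [← algebraMap_smul 𝕜 t]
          module
        rw [dist_eq_norm, e2]
        have hAf : ‖A (f Y)‖ ≤ M * M := (A.le_opNorm _).trans (by
          gcongr
          · exact hM' _ hyt
          · exact hM _ hyt)
        have hρ : ‖ρ‖ ≤ C * (‖h‖ * M) ^ 2 := by
          refine hC'.trans ?_
          gcongr
          rw [add_sub_cancel_left, norm_smul, norm_smul, Real.norm_of_nonneg ht.1]
          gcongr
          calc t * ‖f Y‖ ≤ 1 * M := by
                gcongr
                · exact ht.2.le
                · exact hM _ hyt
            _ = M := one_mul _
        have n1 : ‖(h * h) • t • A (f Y)‖ ≤ ‖h‖ ^ 2 * (M * M) := by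
          have : t * ‖A (f Y)‖ ≤ 1 * (M * M) :=
            mul_le_mul ht.2.le hAf (norm_nonneg _) zero_le_one
          rw [norm_smul, norm_smul, Real.norm_of_nonneg ht.1, norm_mul, ← pow_two]
          rw [one_mul] at this
          exact mul_le_mul_of_nonneg_left this (by positivity)
        have n2 : ‖(μ + h) • ρ‖ ≤ r * (C * (‖h‖ * M) ^ 2) := by
          rw [norm_smul]
          gcongr
          rw [mem_ball_zero_iff] at hh
          exact hh.le
        calc ‖-((h * h) • t • A (f Y)) - (μ + h) • ρ‖
            ≤ ‖(h * h) • t • A (f Y)‖ + ‖(μ + h) • ρ‖ := by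
              refine (norm_sub_le _ _).trans ?_
              rw [norm_neg]
          _ ≤ ‖h‖ ^ 2 * (M * M) + r * (C * (‖h‖ * M) ^ 2) := add_le_add n1 n2
          _ = c * ‖h‖ ^ 2 := by rw [hc]; ring
    rw [hasDerivAt_iff_isLittleO_nhds_zero]
    refine (Asymptotics.IsBigO.of_bound (c * gronwallBound 0 (‖r‖₊ * K : NNReal) 1 1)
      ?_).trans_isLittleO (Asymptotics.isLittleO_pow_id (𝕜 := 𝕜) one_lt_two)
    have ev1 : ∀ᶠ h in 𝓝 (0 : 𝕜), μ + h ∈ ball (0 : 𝕜) r := by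
      have : ContinuousAt (fun h : 𝕜 => μ + h) 0 := by fun_prop
      exact this.eventually_mem (isOpen_ball.mem_nhds (by simpa using hμ))
    have ev2 : ∀ᶠ h in 𝓝 (0 : 𝕜), ‖h‖ * M < R / 2 := by
      have : ContinuousAt (fun h : 𝕜 => ‖h‖ * (M : ℝ)) 0 := by fun_prop
      exact this.eventually_lt_const (by simpa using hR)
    filter_upwards [ev1, ev2] with h h1 h2
    rw [norm_pow]
    exact est h h1 h2.le
  refine ⟨r, hr0, z, ?_, fun t ht => ⟨hRO (hbR (hz t ht)), hder t ht⟩, ?_⟩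
  · -- at `μ = 0` the solution `y_μ` is constant
    have h0 : (0 : 𝕜) ∈ ball (0 : 𝕜) r := mem_ball_self hr0
    have := constant_of_has_deriv_right_zero (f := y 0) (a := 0) (b := 1)
      (fun s hs => (hyI 0 h0 s hs).2.continuousWithinAt) (fun s hs => by
        have := (hyI 0 h0 s ⟨hs.1, hs.2.le⟩).2.mono_of_mem_nhdsWithin (Icc_mem_nhdsGE_of_mem hs)
        simpa using this) 1 (by simp)
    rw [← hy0 0 h0]; exact this
  · have hn : ∀ n : ℕ, ContDiffOn 𝕜 n z (ball 0 r) := by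
      intro n
      induction n with
      | zero =>
        exact contDiffOn_zero.2 fun t ht => (hder t ht).continuousAt.continuousWithinAt
      | succ n ih =>
        have : ((n + 1 : ℕ) : WithTop ℕ∞) = (n : WithTop ℕ∞) + 1 := by norm_cast
        rw [this, contDiffOn_succ_iff_deriv_of_isOpen isOpen_ball]
        refine ⟨fun t ht => (hder t ht).differentiableAt.differentiableWithinAt, by simp, ?_⟩
        have hcomp : ContDiffOn 𝕜 n (fun t => f (z t)) (ball 0 r) :=
          (hf.of_le (by exact_mod_cast le_top)).comp ih fun t ht => hRO (hbR (hz t ht))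
        exact hcomp.congr fun t ht => (hder t ht).deriv
    exact contDiffOn_infty.2 hn

end ODE

end DrinfeldPoisson

/-! ### Derivatives of maps between manifolds -/

namespace DrinfeldPoisson

section Calculus

variable {𝕜 : Type*} [RCLike 𝕜] {E : Type*} [NormedAddCommGroup E] [NormedSpace 𝕜 E]
  {F : Type*} [NormedAddCommGroup F] [NormedSpace 𝕜 F]
  {G : Type*} [NormedAddCommGroup G] [NormedSpace 𝕜 G]
  {M : Type*} [TopologicalSpace M] [ChartedSpace E M]
  {N : Type*} [TopologicalSpace N] [ChartedSpace F N]
  {P : Type*} [TopologicalSpace P] [ChartedSpace G P]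

variable (𝕜 E F) in
/-- The derivative of a map between manifolds, as a map between the model spaces: tangent spaces
are identified with the model space through the preferred charts. -/
noncomputable def tderiv (f : M → N) (x : M) : E →L[𝕜] F := mfderiv 𝓘(𝕜, E) 𝓘(𝕜, F) f x

lemma tderiv_comp {g : N → P} {f : M → N} {x : M}
    (hg : MDifferentiableAt 𝓘(𝕜, F) 𝓘(𝕜, G) g (f x)) (hf : MDifferentiableAt 𝓘(𝕜, E) 𝓘(𝕜, F) f x) :
    tderiv 𝕜 E G (fun y => g (f y)) x = (tderiv 𝕜 F G g (f x)).comp (tderiv 𝕜 E F f x) :=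
  mfderiv_comp x hg hf

lemma tderiv_comp_apply {g : N → P} {f : M → N} {x : M}
    (hg : MDifferentiableAt 𝓘(𝕜, F) 𝓘(𝕜, G) g (f x)) (hf : MDifferentiableAt 𝓘(𝕜, E) 𝓘(𝕜, F) f x)
    (v : E) :
    tderiv 𝕜 E G (fun y => g (f y)) x v = tderiv 𝕜 F G g (f x) (tderiv 𝕜 E F f x v) := by
  rw [tderiv_comp hg hf]; rfl

lemma tderiv_id (x : M) : tderiv 𝕜 E E (fun y : M => y) x = ContinuousLinearMap.id 𝕜 E :=
  mfderiv_id

lemma tderiv_const (c : N) (x : M) : tderiv 𝕜 E F (fun _ : M => c) x = 0 :=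
  mfderiv_const

lemma tderiv_congr {f g : M → N} {x : M} (h : f =ᶠ[𝓝 x] g) :
    tderiv 𝕜 E F f x = tderiv 𝕜 E F g x :=
  h.mfderiv_eq

lemma tderiv_eq_fderiv (f : E → F) (x : E) : tderiv 𝕜 E F f x = fderiv 𝕜 f x :=
  mfderiv_eq_fderiv

lemma tderiv_extChartAt_self [IsManifold 𝓘(𝕜, E) 1 M] (x : M) :
    tderiv 𝕜 E E (extChartAt 𝓘(𝕜, E) x) x = ContinuousLinearMap.id 𝕜 E := by
  ext v
  have h : tderiv 𝕜 E E (extChartAt 𝓘(𝕜, E) x) x = tangentCoordChange 𝓘(𝕜, E) x x x :=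
    mfderiv_chartAt_eq_tangentCoordChange (I := 𝓘(𝕜, E)) (mem_chart_source E x)
  rw [h]
  exact tangentCoordChange_self (I := 𝓘(𝕜, E)) (mem_extChartAt_source x)

/-- A map with vanishing derivative near a point is constant near that point. -/
lemma eventually_eq_of_tderiv_eq_zero [IsManifold 𝓘(𝕜, E) 1 M] [IsManifold 𝓘(𝕜, F) 1 N]
    {f : M → N} {x : M}
    (h : ∀ᶠ y in 𝓝 x, MDifferentiableAt 𝓘(𝕜, E) 𝓘(𝕜, F) f y ∧ tderiv 𝕜 E F f y = 0) :
    ∀ᶠ y in 𝓝 x, f y = f x := by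
  set φ := extChartAt 𝓘(𝕜, E) x with hφ
  set ψ := extChartAt 𝓘(𝕜, F) (f x) with hψ
  have hfc : ContinuousAt f x := h.self_of_nhds.1.continuousAt
  have h1 : ∀ᶠ y in 𝓝 x, (MDifferentiableAt 𝓘(𝕜, E) 𝓘(𝕜, F) f y ∧ tderiv 𝕜 E F f y = 0) ∧
      f y ∈ ψ.source :=
    h.and (hfc.eventually_mem (extChartAt_source_mem_nhds _))
  have h2 : ∀ᶠ e in 𝓝 (φ x), e ∈ φ.target ∧
      (MDifferentiableAt 𝓘(𝕜, E) 𝓘(𝕜, F) f (φ.symm e) ∧ tderiv 𝕜 E F f (φ.symm e) = 0) ∧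
      f (φ.symm e) ∈ ψ.source := by
    refine Filter.Eventually.and (extChartAt_target_mem_nhds (I := 𝓘(𝕜, E)) x) ?_
    have : Filter.Tendsto φ.symm (𝓝 (φ x)) (𝓝 x) := by
      have := continuousAt_extChartAt_symm (I := 𝓘(𝕜, E)) x
      rwa [ContinuousAt, extChartAt_to_inv] at this
    exact this.eventually h1
  obtain ⟨r, hr, hball⟩ := Metric.eventually_nhds_iff_ball.1 h2
  have hder : ∀ e ∈ Metric.ball (φ x) r,
      HasFDerivAt (fun e => ψ (f (φ.symm e))) (0 : E →L[𝕜] F) e := by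
    intro e he
    obtain ⟨ht, ⟨hd, hz⟩, hs⟩ := hball e he
    have hφs : MDifferentiableAt 𝓘(𝕜, E) 𝓘(𝕜, E) φ.symm e :=
      ((contMDiffOn_extChartAt_symm (n := 1) x).contMDiffAt
        ((isOpen_extChartAt_target x).mem_nhds ht)).mdifferentiableAt one_ne_zero
    have hψd : MDifferentiableAt 𝓘(𝕜, F) 𝓘(𝕜, F) ψ (f (φ.symm e)) :=
      mdifferentiableAt_extChartAt (by rwa [← extChartAt_source 𝓘(𝕜, F)])
    have hcomp : MDifferentiableAt 𝓘(𝕜, E) 𝓘(𝕜, F) (fun e => f (φ.symm e)) e := hd.comp e hφs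
    have hcomp2 : MDifferentiableAt 𝓘(𝕜, E) 𝓘(𝕜, F) (fun e => ψ (f (φ.symm e))) e :=
      hψd.comp e hcomp
    have h0 : tderiv 𝕜 E F (fun e => ψ (f (φ.symm e))) e = 0 := by
      rw [tderiv_comp (g := ψ) (f := fun e => f (φ.symm e)) hψd hcomp,
        tderiv_comp (g := f) (f := φ.symm) hd hφs, hz]
      simp
    rw [tderiv_eq_fderiv] at h0
    rw [← h0]
    exact (mdifferentiableAt_iff_differentiableAt.1 hcomp2).hasFDerivAt
  have hconst : ∀ e ∈ Metric.ball (φ x) r, ψ (f (φ.symm e)) = ψ (f x) := by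
    intro e he
    let _ : NormedSpace ℝ E := NormedSpace.restrictScalars ℝ 𝕜 E
    have := (convex_ball (φ x) r).is_const_of_fderivWithin_eq_zero (𝕜 := 𝕜)
      (f := fun e => ψ (f (φ.symm e)))
      (fun e he => (hder e he).differentiableAt.differentiableWithinAt)
      (fun e he => (hder e he).hasFDerivWithinAt.fderivWithin
        (Metric.isOpen_ball.uniqueDiffWithinAt he)) he (Metric.mem_ball_self hr)
    simpa only [hφ, extChartAt_to_inv] using this
  have hφc : ContinuousAt φ x := continuousAt_extChartAt x
  filter_upwards [h1, extChartAt_source_mem_nhds (I := 𝓘(𝕜, E)) x,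
    hφc.eventually_mem (Metric.ball_mem_nhds _ hr)] with y hy hys hyb
  have := hconst _ hyb
  rw [φ.left_inv hys] at this
  exact ψ.injOn hy.2 (mem_extChartAt_source _) this

/-- A map with vanishing derivative on a connected manifold is constant. -/
lemma eq_of_tderiv_eq_zero [IsManifold 𝓘(𝕜, E) 1 M] [IsManifold 𝓘(𝕜, F) 1 N] [PreconnectedSpace M]
    {f : M → N} (h : ∀ y, MDifferentiableAt 𝓘(𝕜, E) 𝓘(𝕜, F) f y ∧ tderiv 𝕜 E F f y = 0)
    (x y : M) : f x = f y :=
  ((IsLocallyConstant.iff_eventually_eq f).2 fun _ =>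
    eventually_eq_of_tderiv_eq_zero
      (Filter.Eventually.of_forall h)).apply_eq_of_preconnectedSpace x y

/-- Uncurried derivative of a map of two variables along two maps into the factors. -/
lemma tderiv_comp₂_apply {E' : Type*} [NormedAddCommGroup E'] [NormedSpace 𝕜 E']
    {L : Type*} [TopologicalSpace L] [ChartedSpace E' L]
    {m : M × N → P} {f : L → M} {g : L → N} {t : L}
    (hm : MDifferentiableAt (𝓘(𝕜, E).prod 𝓘(𝕜, F)) 𝓘(𝕜, G) m (f t, g t))
    (hf : MDifferentiableAt 𝓘(𝕜, E') 𝓘(𝕜, E) f t) (hg : MDifferentiableAt 𝓘(𝕜, E') 𝓘(𝕜, F) g t)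
    (v : E') :
    tderiv 𝕜 E' G (fun s => m (f s, g s)) t v =
      tderiv 𝕜 E G (fun y => m (y, g t)) (f t) (tderiv 𝕜 E' E f t v) +
      tderiv 𝕜 F G (fun z => m (f t, z)) (g t) (tderiv 𝕜 E' F g t v) := by
  have h1 := mfderiv_comp t (g := m) (f := fun s => (f s, g s)) hm (hf.prodMk hg)
  have h2 := hf.mfderiv_prod hg
  have h3 := mfderiv_prod_eq_add_apply (f := m) (p := (f t, g t))
    (v := mfderiv 𝓘(𝕜, E') (𝓘(𝕜, E).prod 𝓘(𝕜, F)) (fun s => (f s, g s)) t v) hm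
  have h4 : tderiv 𝕜 E' G (fun s => m (f s, g s)) t v =
      mfderiv (𝓘(𝕜, E).prod 𝓘(𝕜, F)) 𝓘(𝕜, G) m (f t, g t)
        (mfderiv 𝓘(𝕜, E') (𝓘(𝕜, E).prod 𝓘(𝕜, F)) (fun s => (f s, g s)) t v) :=
    congrArg (fun A => A v) h1
  rw [h4, h3, h2]
  rfl

end Calculus

section Charts

variable {𝕜 : Type*} [RCLike 𝕜] {E : Type*} [NormedAddCommGroup E] [NormedSpace 𝕜 E]
  {M : Type*} [TopologicalSpace M] [ChartedSpace E M] [IsManifold 𝓘(𝕜, E) ∞ M]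

lemma contMDiffAt_extChartAt_of_mem {x y : M} (hy : y ∈ (extChartAt 𝓘(𝕜, E) x).source) :
    ContMDiffAt 𝓘(𝕜, E) 𝓘(𝕜, E) ∞ (extChartAt 𝓘(𝕜, E) x) y :=
  contMDiffAt_extChartAt' (by rwa [extChartAt_source] at hy)

lemma contMDiffAt_extChartAt_symm {x : M} {a : E} (ha : a ∈ (extChartAt 𝓘(𝕜, E) x).target) :
    ContMDiffAt 𝓘(𝕜, E) 𝓘(𝕜, E) ∞ (extChartAt 𝓘(𝕜, E) x).symm a :=
  (contMDiffOn_extChartAt_symm (n := ∞) x).contMDiffAt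
    ((isOpen_extChartAt_target (I := 𝓘(𝕜, E)) x).mem_nhds ha)

lemma tderiv_extChartAt_symm_self (x : M) :
    tderiv 𝕜 E E (extChartAt 𝓘(𝕜, E) x).symm (extChartAt 𝓘(𝕜, E) x x) =
      ContinuousLinearMap.id 𝕜 E := by
  have : IsManifold 𝓘(𝕜, E) 1 M := IsManifold.of_le (n := ∞) (by simp)
  have hm := mem_extChartAt_target (I := 𝓘(𝕜, E)) x
  have h := tderiv_comp (𝕜 := 𝕜) (E := E) (F := E) (G := E) (g := extChartAt 𝓘(𝕜, E) x)
    (f := (extChartAt 𝓘(𝕜, E) x).symm) (x := extChartAt 𝓘(𝕜, E) x x)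
    (by rw [extChartAt_to_inv]; exact (contMDiffAt_extChartAt (n := ∞)).mdifferentiableAt (by simp))
    ((contMDiffAt_extChartAt_symm hm).mdifferentiableAt (by simp))
  rw [extChartAt_to_inv, tderiv_extChartAt_self, ContinuousLinearMap.id_comp] at h
  rw [← h, ← tderiv_id (𝕜 := 𝕜) (extChartAt 𝓘(𝕜, E) x x)]
  apply tderiv_congr
  filter_upwards [extChartAt_target_mem_nhds (I := 𝓘(𝕜, E)) x] with y hy
  exact (extChartAt 𝓘(𝕜, E) x).right_inv hy

end Charts

end DrinfeldPoisson

/-! ### Smooth actions and the adjoint action -/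

namespace DrinfeldPoisson

section Action

variable {𝕜 : Type*} [RCLike 𝕜] {E : Type*} [NormedAddCommGroup E] [NormedSpace 𝕜 E]
  {F : Type*} [NormedAddCommGroup F] [NormedSpace 𝕜 F]
  {G : Type*} [NormedAddCommGroup G] [NormedSpace 𝕜 G]
  {D : Type*} [TopologicalSpace D] [ChartedSpace E D] [Group D]
  {M : Type*} [TopologicalSpace M] [ChartedSpace F M] [MulAction D M]
  {L : Type*} [TopologicalSpace L] [ChartedSpace G L]

variable (𝕜 E F D M) in
/-- The action map `D × M → M` is smooth. -/
def SmoothAction : Prop :=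
  ContMDiff (𝓘(𝕜, E).prod 𝓘(𝕜, F)) 𝓘(𝕜, F) ∞ (fun x : D × M => x.1 • x.2)

lemma smoothAction_self [LieGroup 𝓘(𝕜, E) ∞ D] : SmoothAction 𝕜 E E D D :=
  contMDiff_mul 𝓘(𝕜, E) ∞

variable (𝕜 E F D) in
/-- The infinitesimal action `X ↦ κ(X)(p)`, as a map between model spaces. For the action of `D`
on itself by left multiplication, this is the value at `p` of the right-invariant vector field
of `X`. -/
noncomputable def orbitDeriv (p : M) : E →L[𝕜] F := tderiv 𝕜 E F (fun g : D => g • p) 1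

variable (𝕜 E) in
/-- The adjoint action, as a map of the model space. -/
noncomputable def adDeriv (d : D) : E →L[𝕜] E := tderiv 𝕜 E E (fun g : D => d * g * d⁻¹) 1

lemma SmoothAction.contMDiffAt (h : SmoothAction 𝕜 E F D M) {f : L → D} {p : L → M} {t : L}
    {n : WithTop ℕ∞} (hn : n ≤ ∞)
    (hf : ContMDiffAt 𝓘(𝕜, G) 𝓘(𝕜, E) n f t) (hp : ContMDiffAt 𝓘(𝕜, G) 𝓘(𝕜, F) n p t) :
    ContMDiffAt 𝓘(𝕜, G) 𝓘(𝕜, F) n (fun s => f s • p s) t :=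
  ContMDiffAt.comp (g := fun x : D × M => x.1 • x.2) (f := fun s => (f s, p s)) t
    (h.of_le hn _) (hf.prodMk hp)

lemma SmoothAction.mdifferentiableAt (h : SmoothAction 𝕜 E F D M) {f : L → D} {p : L → M} {t : L}
    (hf : MDifferentiableAt 𝓘(𝕜, G) 𝓘(𝕜, E) f t) (hp : MDifferentiableAt 𝓘(𝕜, G) 𝓘(𝕜, F) p t) :
    MDifferentiableAt 𝓘(𝕜, G) 𝓘(𝕜, F) (fun s => f s • p s) t :=
  MDifferentiableAt.comp (g := fun x : D × M => x.1 • x.2) (f := fun s => (f s, p s)) t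
    ((h _).mdifferentiableAt (by simp)) (hf.prodMk hp)

lemma SmoothAction.tderiv_smul (h : SmoothAction 𝕜 E F D M) {f : L → D} {p : L → M} {t : L}
    (hf : MDifferentiableAt 𝓘(𝕜, G) 𝓘(𝕜, E) f t) (hp : MDifferentiableAt 𝓘(𝕜, G) 𝓘(𝕜, F) p t)
    (v : G) :
    tderiv 𝕜 G F (fun s => f s • p s) t v =
      tderiv 𝕜 E F (fun g : D => g • p t) (f t) (tderiv 𝕜 G E f t v) +
      tderiv 𝕜 F F (fun z : M => f t • z) (p t) (tderiv 𝕜 G F p t v) :=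
  tderiv_comp₂_apply (m := fun x : D × M => x.1 • x.2) ((h _).mdifferentiableAt (by simp)) hf hp v

lemma SmoothAction.contMDiffAt_orbit (h : SmoothAction 𝕜 E F D M) (z : M) (g : D) :
    ContMDiffAt 𝓘(𝕜, E) 𝓘(𝕜, F) ∞ (fun g : D => g • z) g :=
  h.contMDiffAt (f := fun g : D => g) (p := fun _ => z) le_rfl contMDiffAt_id contMDiffAt_const

lemma SmoothAction.contMDiffAt_translation (h : SmoothAction 𝕜 E F D M) (g : D) (z : M) :
    ContMDiffAt 𝓘(𝕜, F) 𝓘(𝕜, F) ∞ (fun z : M => g • z) z :=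
  h.contMDiffAt (f := fun _ => g) (p := fun z : M => z) le_rfl contMDiffAt_const contMDiffAt_id

lemma SmoothAction.mdiff_orbit (h : SmoothAction 𝕜 E F D M) (z : M) (g : D) :
    MDifferentiableAt 𝓘(𝕜, E) 𝓘(𝕜, F) (fun g : D => g • z) g :=
  (h.contMDiffAt_orbit z g).mdifferentiableAt (by simp)

lemma SmoothAction.mdiff_translation (h : SmoothAction 𝕜 E F D M) (g : D) (z : M) :
    MDifferentiableAt 𝓘(𝕜, F) 𝓘(𝕜, F) (fun z : M => g • z) z :=
  (h.contMDiffAt_translation g z).mdifferentiableAt (by simp)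

variable [LieGroup 𝓘(𝕜, E) ∞ D]

lemma mdiff_mul {f g : L → D} {t : L}
    (hf : MDifferentiableAt 𝓘(𝕜, G) 𝓘(𝕜, E) f t) (hg : MDifferentiableAt 𝓘(𝕜, G) 𝓘(𝕜, E) g t) :
    MDifferentiableAt 𝓘(𝕜, G) 𝓘(𝕜, E) (fun s => f s * g s) t :=
  (smoothAction_self (𝕜 := 𝕜) (E := E) (D := D)).mdifferentiableAt hf hg

lemma mdiff_conj (d g : D) :
    MDifferentiableAt 𝓘(𝕜, E) 𝓘(𝕜, E) (fun g : D => d * g * d⁻¹) g :=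
  mdiff_mul (mdiff_mul mdifferentiableAt_const mdifferentiableAt_id) mdifferentiableAt_const

/-- `κ(X)(g z)` is the image of the right-invariant vector field of `X` at `g` under the orbit
map of `z`. -/
lemma SmoothAction.tderiv_orbit_orbitDeriv (h : SmoothAction 𝕜 E F D M) (g : D) (z : M) (X : E) :
    tderiv 𝕜 E F (fun g : D => g • z) g (orbitDeriv 𝕜 E E D g X) =
      orbitDeriv 𝕜 E F D (g • z) X := by
  have hs := smoothAction_self (𝕜 := 𝕜) (E := E) (D := D)
  have h1 : MDifferentiableAt 𝓘(𝕜, E) 𝓘(𝕜, F) (fun g : D => g • z) ((1 : D) • g) :=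
    h.mdiff_orbit z _
  have := tderiv_comp_apply (𝕜 := 𝕜) (E := E) (F := E) (G := F) (g := fun g : D => g • z)
    (f := fun k : D => k • g) (x := 1) h1 (hs.mdiff_orbit g 1) X
  rw [one_smul] at this
  rw [orbitDeriv, ← this, orbitDeriv]
  simp only [smul_eq_mul, mul_smul]

/-- Translations intertwine the infinitesimal action with the adjoint action. -/
lemma SmoothAction.tderiv_translation_orbitDeriv (h : SmoothAction 𝕜 E F D M) (g : D) (z : M)
    (X : E) :
    tderiv 𝕜 F F (fun z : M => g • z) z (orbitDeriv 𝕜 E F D z X) =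
      orbitDeriv 𝕜 E F D (g • z) (adDeriv 𝕜 E g X) := by
  have h1 : MDifferentiableAt 𝓘(𝕜, F) 𝓘(𝕜, F) (fun z : M => g • z) ((1 : D) • z) :=
    h.mdiff_translation g _
  have e1 := tderiv_comp_apply (𝕜 := 𝕜) (E := E) (F := F) (G := F) (g := fun z : M => g • z)
    (f := fun k : D => k • z) (x := 1) h1 (h.mdiff_orbit z 1) X
  have h2 : MDifferentiableAt 𝓘(𝕜, E) 𝓘(𝕜, F) (fun k : D => k • (g • z)) (g * (1 : D) * g⁻¹) :=
    h.mdiff_orbit (g • z) _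
  have e2 := tderiv_comp_apply (𝕜 := 𝕜) (E := E) (F := E) (G := F) (g := fun k : D => k • (g • z))
    (f := fun k : D => g * k * g⁻¹) (x := 1) h2 (mdiff_conj g 1) X
  rw [one_smul] at e1
  have e3 : g * 1 * g⁻¹ = 1 := by group
  rw [e3] at e2
  rw [orbitDeriv, ← e1, orbitDeriv, adDeriv, ← e2]
  congr 2
  funext k
  simp only [smul_smul]
  congr 1
  group

omit [LieGroup 𝓘(𝕜, E) ∞ D] in
lemma SmoothAction.tderiv_translation_inv (h : SmoothAction 𝕜 E F D M) (g : D) (z : M) (v : F) :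
    tderiv 𝕜 F F (fun z : M => g⁻¹ • z) (g • z) (tderiv 𝕜 F F (fun z : M => g • z) z v) = v := by
  rw [← tderiv_comp_apply (g := fun z : M => g⁻¹ • z) (f := fun z : M => g • z)
    (h.mdiff_translation _ _) (h.mdiff_translation _ _)]
  simp only [inv_smul_smul, tderiv_id]
  rfl

omit [LieGroup 𝓘(𝕜, E) ∞ D] in
lemma SmoothAction.tderiv_translation_injective (h : SmoothAction 𝕜 E F D M) (g : D) (z : M) :
    Function.Injective (tderiv 𝕜 F F (fun z : M => g • z) z) :=
  Function.LeftInverse.injective (h.tderiv_translation_inv g z)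

/-- The product rule in terms of logarithmic derivatives. -/
lemma SmoothAction.tderiv_smul_orbitDeriv (h : SmoothAction 𝕜 E F D M) {f : L → D} {p : L → M}
    {t : L} (hf : MDifferentiableAt 𝓘(𝕜, G) 𝓘(𝕜, E) f t)
    (hp : MDifferentiableAt 𝓘(𝕜, G) 𝓘(𝕜, F) p t) {v : G} {X Y : E}
    (hX : tderiv 𝕜 G E f t v = orbitDeriv 𝕜 E E D (f t) X)
    (hY : tderiv 𝕜 G F p t v = orbitDeriv 𝕜 E F D (p t) Y) :
    tderiv 𝕜 G F (fun s => f s • p s) t v =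
      orbitDeriv 𝕜 E F D (f t • p t) (X + adDeriv 𝕜 E (f t) Y) := by
  rw [h.tderiv_smul hf hp, hX, hY, h.tderiv_orbit_orbitDeriv, h.tderiv_translation_orbitDeriv,
    map_add]

omit [LieGroup 𝓘(𝕜, E) ∞ D] in
lemma adDeriv_one : adDeriv 𝕜 E (1 : D) = ContinuousLinearMap.id 𝕜 E := by
  have : (fun g : D => 1 * g * 1⁻¹) = fun g => g := by funext g; group
  rw [adDeriv, this, tderiv_id]

lemma adDeriv_mul (g k : D) (X : E) :
    adDeriv 𝕜 E (g * k) X = adDeriv 𝕜 E g (adDeriv 𝕜 E k X) := by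
  have e3 : k * 1 * k⁻¹ = 1 := by group
  have := tderiv_comp_apply (𝕜 := 𝕜) (E := E) (F := E) (G := E) (g := fun a : D => g * a * g⁻¹)
    (f := fun a : D => k * a * k⁻¹) (x := 1) (mdiff_conj g _) (mdiff_conj k 1) X
  rw [e3] at this
  rw [adDeriv, adDeriv, adDeriv, ← this]
  congr 2
  funext a
  group

lemma adDeriv_inv_apply (g : D) (X : E) : adDeriv 𝕜 E g⁻¹ (adDeriv 𝕜 E g X) = X := by
  rw [← adDeriv_mul, inv_mul_cancel, adDeriv_one]; rfl

lemma adDeriv_apply_inv (g : D) (X : E) : adDeriv 𝕜 E g (adDeriv 𝕜 E g⁻¹ X) = X := by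
  rw [← adDeriv_mul, mul_inv_cancel, adDeriv_one]; rfl

lemma adDeriv_injective (g : D) : Function.Injective (adDeriv 𝕜 E g) :=
  Function.LeftInverse.injective (adDeriv_inv_apply g)

omit [LieGroup 𝓘(𝕜, E) ∞ D] in
lemma orbitDeriv_one : orbitDeriv 𝕜 E E D (1 : D) = ContinuousLinearMap.id 𝕜 E := by
  have : (fun g : D => g • (1 : D)) = fun g => g := by funext g; simp
  rw [orbitDeriv, this, tderiv_id]

/-- Left-invariant vector fields in terms of right-invariant ones. -/
lemma tderiv_mul_left_eq (g : D) (X : E) :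
    tderiv 𝕜 E E (fun k : D => g * k) 1 X = orbitDeriv 𝕜 E E D g (adDeriv 𝕜 E g X) := by
  have := (smoothAction_self (𝕜 := 𝕜) (E := E) (D := D)).tderiv_translation_orbitDeriv g 1 X
  rw [orbitDeriv_one] at this
  simpa using this

end Action

end DrinfeldPoisson

/-! ### The derivative of the adjoint action -/

namespace DrinfeldPoisson

section AdjointDerivative

variable {𝕜 : Type*} [RCLike 𝕜] {E : Type*} [NormedAddCommGroup E] [NormedSpace 𝕜 E]
  {D : Type*} [TopologicalSpace D] [ChartedSpace E D] [Group D]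

variable (𝕜 E D) in
/-- The multiplication of `D` in the preferred chart at `1`. -/
noncomputable def chartMul (x : E × E) : E :=
  extChartAt 𝓘(𝕜, E) (1 : D) ((extChartAt 𝓘(𝕜, E) (1 : D)).symm x.1 *
    (extChartAt 𝓘(𝕜, E) (1 : D)).symm x.2)

variable [LieGroup 𝓘(𝕜, E) ∞ D]

lemma contDiffAt_chartMul {a b : E} (ha : a ∈ (extChartAt 𝓘(𝕜, E) (1 : D)).target)
    (hb : b ∈ (extChartAt 𝓘(𝕜, E) (1 : D)).target)
    (hab : (extChartAt 𝓘(𝕜, E) (1 : D)).symm a * (extChartAt 𝓘(𝕜, E) (1 : D)).symm b ∈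
      (extChartAt 𝓘(𝕜, E) (1 : D)).source) :
    ContDiffAt 𝕜 ∞ (chartMul 𝕜 E D) (a, b) := by
  rw [← contMDiffAt_iff_contDiffAt]
  have h1 : ContMDiffAt 𝓘(𝕜, E × E) 𝓘(𝕜, E) ∞ (Prod.fst : E × E → E) (a, b) :=
    contDiff_fst.contMDiff.contMDiffAt
  have h2 : ContMDiffAt 𝓘(𝕜, E × E) 𝓘(𝕜, E) ∞ (Prod.snd : E × E → E) (a, b) :=
    contDiff_snd.contMDiff.contMDiffAt
  have h3 := ContMDiffAt.comp (g := (extChartAt 𝓘(𝕜, E) (1 : D)).symm) (a, b)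
    (contMDiffAt_extChartAt_symm (𝕜 := 𝕜) (M := D) ha) h1
  have h4 := ContMDiffAt.comp (g := (extChartAt 𝓘(𝕜, E) (1 : D)).symm) (a, b)
    (contMDiffAt_extChartAt_symm (𝕜 := 𝕜) (M := D) hb) h2
  exact ContMDiffAt.comp (g := extChartAt 𝓘(𝕜, E) (1 : D)) (a, b)
    (contMDiffAt_extChartAt_of_mem hab) (h3.mul h4)

/-- The left-invariant vector field of `w`, read in the chart at `1`. -/
lemma fderiv_chartMul_right {a : E} (ha : a ∈ (extChartAt 𝓘(𝕜, E) (1 : D)).target) (w : E) :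
    fderiv 𝕜 (chartMul 𝕜 E D) (a, extChartAt 𝓘(𝕜, E) (1 : D) 1) (0, w) =
      tderiv 𝕜 E E (extChartAt 𝓘(𝕜, E) (1 : D)) ((extChartAt 𝓘(𝕜, E) (1 : D)).symm a)
        (tderiv 𝕜 E E (fun k : D => (extChartAt 𝓘(𝕜, E) (1 : D)).symm a * k) 1 w) := by
  set φ := extChartAt 𝓘(𝕜, E) (1 : D) with hφ
  have hm : φ 1 ∈ φ.target := mem_extChartAt_target (I := 𝓘(𝕜, E)) (1 : D)
  have h1 : φ.symm (φ 1) = 1 := extChartAt_to_inv (I := 𝓘(𝕜, E)) (1 : D)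
  have hd : DifferentiableAt 𝕜 (chartMul 𝕜 E D) (a, φ 1) :=
    (contDiffAt_chartMul ha hm (by rw [← hφ, h1, mul_one]; exact φ.map_target ha)).differentiableAt
      (by simp)
  have e1 : fderiv 𝕜 (fun b => chartMul 𝕜 E D (a, b)) (φ 1) w =
      fderiv 𝕜 (chartMul 𝕜 E D) (a, φ 1) (0, w) := by
    have := (hd.hasFDerivAt.comp (φ 1) (hasFDerivAt_prodMk_right a (φ 1))).fderiv
    exact congrArg (fun A => A w) this
  have d1 : MDifferentiableAt 𝓘(𝕜, E) 𝓘(𝕜, E) φ.symm (φ 1) :=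
    (contMDiffAt_extChartAt_symm hm).mdifferentiableAt (by simp)
  have d2 : MDifferentiableAt 𝓘(𝕜, E) 𝓘(𝕜, E) (fun k : D => φ.symm a * k) (φ.symm (φ 1)) :=
    mdiff_mul mdifferentiableAt_const mdifferentiableAt_id
  have d3 : MDifferentiableAt 𝓘(𝕜, E) 𝓘(𝕜, E) φ (φ.symm a * φ.symm (φ 1)) := by
    rw [h1, mul_one]
    exact (contMDiffAt_extChartAt_of_mem (φ.map_target ha)).mdifferentiableAt (by simp)
  rw [← e1, ← tderiv_eq_fderiv]
  have e2 := tderiv_comp_apply (𝕜 := 𝕜) (E := E) (F := E) (G := E) (g := φ)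
    (f := fun b => φ.symm a * φ.symm b) (x := φ 1) d3 (d2.comp (φ 1) d1) w
  have e3 := tderiv_comp_apply (𝕜 := 𝕜) (E := E) (F := E) (G := E) (g := fun k => φ.symm a * k)
    (f := φ.symm) (x := φ 1) d2 d1 w
  rw [e3, tderiv_extChartAt_symm_self, h1, mul_one] at e2
  exact e2

/-- The right-invariant vector field of `w`, read in the chart at `1`. -/
lemma fderiv_chartMul_left {a : E} (ha : a ∈ (extChartAt 𝓘(𝕜, E) (1 : D)).target) (w : E) :
    fderiv 𝕜 (chartMul 𝕜 E D) (extChartAt 𝓘(𝕜, E) (1 : D) 1, a) (w, 0) =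
      tderiv 𝕜 E E (extChartAt 𝓘(𝕜, E) (1 : D)) ((extChartAt 𝓘(𝕜, E) (1 : D)).symm a)
        (orbitDeriv 𝕜 E E D ((extChartAt 𝓘(𝕜, E) (1 : D)).symm a) w) := by
  set φ := extChartAt 𝓘(𝕜, E) (1 : D) with hφ
  have hm : φ 1 ∈ φ.target := mem_extChartAt_target (I := 𝓘(𝕜, E)) (1 : D)
  have h1 : φ.symm (φ 1) = 1 := extChartAt_to_inv (I := 𝓘(𝕜, E)) (1 : D)
  have hd : DifferentiableAt 𝕜 (chartMul 𝕜 E D) (φ 1, a) :=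
    (contDiffAt_chartMul hm ha (by rw [← hφ, h1, one_mul]; exact φ.map_target ha)).differentiableAt
      (by simp)
  have e1 : fderiv 𝕜 (fun b => chartMul 𝕜 E D (b, a)) (φ 1) w =
      fderiv 𝕜 (chartMul 𝕜 E D) (φ 1, a) (w, 0) := by
    have hl : HasFDerivAt (fun e : E => (e, a)) (ContinuousLinearMap.inl 𝕜 E E) (φ 1) :=
      hasFDerivAt_prodMk_left (φ 1) a
    have := (hd.hasFDerivAt.comp (φ 1) hl).fderiv
    exact congrArg (fun A => A w) this
  have d1 : MDifferentiableAt 𝓘(𝕜, E) 𝓘(𝕜, E) φ.symm (φ 1) :=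
    (contMDiffAt_extChartAt_symm hm).mdifferentiableAt (by simp)
  have d2 : MDifferentiableAt 𝓘(𝕜, E) 𝓘(𝕜, E) (fun k : D => k * φ.symm a) (φ.symm (φ 1)) :=
    mdiff_mul mdifferentiableAt_id mdifferentiableAt_const
  have d3 : MDifferentiableAt 𝓘(𝕜, E) 𝓘(𝕜, E) φ (φ.symm (φ 1) * φ.symm a) := by
    rw [h1, one_mul]
    exact (contMDiffAt_extChartAt_of_mem (φ.map_target ha)).mdifferentiableAt (by simp)
  rw [← e1, ← tderiv_eq_fderiv]
  have e2 := tderiv_comp_apply (𝕜 := 𝕜) (E := E) (F := E) (G := E) (g := φ)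
    (f := fun b => φ.symm b * φ.symm a) (x := φ 1) d3 (d2.comp (φ 1) d1) w
  have e3 := tderiv_comp_apply (𝕜 := 𝕜) (E := E) (F := E) (G := E) (g := fun k => k * φ.symm a)
    (f := φ.symm) (x := φ 1) d2 d1 w
  rw [e3, tderiv_extChartAt_symm_self, h1, one_mul] at e2
  exact e2

variable (𝕜 D) in
/-- The Lie bracket of the Lie algebra of `D`, as an operation on the model space. -/
noncomputable def modelBracket [CompleteSpace E] (v w : E) : E :=
  Bracket.bracket (L := GroupLieAlgebra 𝓘(𝕜, E) D) (M := GroupLieAlgebra 𝓘(𝕜, E) D) v w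

/-- The Lie bracket of `D`, computed in the chart at `1`. -/
lemma modelBracket_eq_fderiv_chartMul [CompleteSpace E] (v w : E) :
    modelBracket 𝕜 D v w =
      fderiv 𝕜 (fun a => fderiv 𝕜 (chartMul 𝕜 E D) (a, extChartAt 𝓘(𝕜, E) (1 : D) 1) (0, w))
        (extChartAt 𝓘(𝕜, E) (1 : D) 1) v -
      fderiv 𝕜 (fun a => fderiv 𝕜 (chartMul 𝕜 E D) (a, extChartAt 𝓘(𝕜, E) (1 : D) 1) (0, v))
        (extChartAt 𝓘(𝕜, E) (1 : D) 1) w := by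
  have : IsManifold 𝓘(𝕜, E) 1 D := IsManifold.of_le (n := ∞) (by simp)
  -- the left-invariant vector field of `w`, pulled back to the chart
  let V : E → E → E := fun w =>
    VectorField.mpullbackWithin 𝓘(𝕜, E) 𝓘(𝕜, E) (extChartAt 𝓘(𝕜, E) (1 : D)).symm
      (mulInvariantVectorField (w : GroupLieAlgebra 𝓘(𝕜, E) D)) (Set.range 𝓘(𝕜, E))
  have hev : ∀ w : E, V w =ᶠ[𝓝 (extChartAt 𝓘(𝕜, E) (1 : D) 1)]
      fun a => fderiv 𝕜 (chartMul 𝕜 E D) (a, extChartAt 𝓘(𝕜, E) (1 : D) 1) (0, w) := by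
    intro w
    filter_upwards [extChartAt_target_mem_nhds (I := 𝓘(𝕜, E)) (1 : D)] with a ha
    rw [fderiv_chartMul_right ha]
    have h1 := mfderivWithin_extChartAt_symm_comp_mfderiv_extChartAt (I := 𝓘(𝕜, E)) ha
    have h2 := mfderiv_extChartAt_comp_mfderivWithin_extChartAt_symm (I := 𝓘(𝕜, E)) ha
    have h3 := ContinuousLinearMap.inverse_eq h1 h2
    exact congrArg (fun A => A (mulInvariantVectorField (w : GroupLieAlgebra 𝓘(𝕜, E) D)
      ((extChartAt 𝓘(𝕜, E) (1 : D)).symm a))) h3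
  have hat : ∀ w : E, fderiv 𝕜 (chartMul 𝕜 E D)
      (extChartAt 𝓘(𝕜, E) (1 : D) 1, extChartAt 𝓘(𝕜, E) (1 : D) 1) (0, w) = w := by
    intro w
    rw [fderiv_chartMul_right (mem_extChartAt_target (I := 𝓘(𝕜, E)) (1 : D)), extChartAt_to_inv,
      tderiv_extChartAt_self]
    simp only [one_mul, tderiv_id]
    rfl
  have hdef : modelBracket 𝕜 D v w = (tderiv 𝕜 E E (extChartAt 𝓘(𝕜, E) (1 : D)) 1).inverse
      (VectorField.lieBracketWithin 𝕜 (V v) (V w)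
        ((extChartAt 𝓘(𝕜, E) (1 : D)).symm ⁻¹' Set.univ ∩ Set.range 𝓘(𝕜, E))
        (extChartAt 𝓘(𝕜, E) (1 : D) 1)) := rfl
  have hset : (extChartAt 𝓘(𝕜, E) (1 : D)).symm ⁻¹' Set.univ ∩ Set.range 𝓘(𝕜, E) = Set.univ := by
    simp
  rw [hdef, hset, VectorField.lieBracketWithin_univ, tderiv_extChartAt_self,
    ContinuousLinearMap.inverse_id,
    Filter.EventuallyEq.lieBracket_vectorField_eq (hev v) (hev w)]
  unfold VectorField.lieBracket
  beta_reduce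
  rw [hat v, hat w]
  rfl

/-- The derivative of `g ↦ Ad_g w` at `1` is `v ↦ [v, w]`: differentiate the relation
`dL_a w = dR_a (Ad_a w)` in the chart at `1`, and use the symmetry of second derivatives. -/
theorem tderiv_adDeriv_one [CompleteSpace E] (w : E) :
    MDifferentiableAt 𝓘(𝕜, E) 𝓘(𝕜, E) (fun g : D => adDeriv 𝕜 E g w) 1 ∧
      ∀ v, tderiv 𝕜 E E (fun g : D => adDeriv 𝕜 E g w) 1 v = modelBracket 𝕜 D v w := by
  have : IsManifold 𝓘(𝕜, E) 1 D := IsManifold.of_le (n := ∞) (by simp)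
  set φ := extChartAt 𝓘(𝕜, E) (1 : D) with hφ
  set m := chartMul 𝕜 E D with hm
  set e := φ 1 with he
  have het : e ∈ φ.target := mem_extChartAt_target (I := 𝓘(𝕜, E)) (1 : D)
  have h1 : φ.symm e = 1 := extChartAt_to_inv (I := 𝓘(𝕜, E)) (1 : D)
  have hms : ContDiffAt 𝕜 ∞ m (e, e) :=
    contDiffAt_chartMul het het (by rw [← hφ, h1, mul_one]; exact mem_extChartAt_source (1 : D))
  have hm' : ContDiffAt 𝕜 1 (fderiv 𝕜 m) (e, e) := hms.fderiv_right (m := 1) (by norm_cast)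
  have hmd : HasFDerivAt (fderiv 𝕜 m) (fderiv 𝕜 (fderiv 𝕜 m) (e, e)) (e, e) :=
    (hm'.differentiableAt one_ne_zero).hasFDerivAt
  have hsymm : IsSymmSndFDerivAt 𝕜 m (e, e) :=
    hms.isSymmSndFDerivAt (by
      rw [minSmoothness_of_isRCLikeNormedField]; exact ENat.LEInfty.out)
  -- `N a` is the right-invariant, `V w a` the left-invariant translation of vectors to `a`
  let N : E → E →L[𝕜] E := fun a => (fderiv 𝕜 m (e, a)).comp (ContinuousLinearMap.inl 𝕜 E E)
  let V : E → E → E := fun w a => fderiv 𝕜 m (a, e) (0, w)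
  let A : E → E := fun a => adDeriv 𝕜 E (φ.symm a) w
  have hr : HasFDerivAt (fun a : E => (e, a)) (ContinuousLinearMap.inr 𝕜 E E) e :=
    hasFDerivAt_prodMk_right e e
  have hl : HasFDerivAt (fun a : E => (a, e)) (ContinuousLinearMap.inl 𝕜 E E) e :=
    hasFDerivAt_prodMk_left e e
  have hN1 : N e = 1 := by
    ext v
    change fderiv 𝕜 m (e, e) (v, 0) = v
    rw [fderiv_chartMul_left het, ← hφ, h1, tderiv_extChartAt_self, orbitDeriv_one]
    rfl
  have hV1 : ∀ w, V w e = w := by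
    intro w
    change fderiv 𝕜 m (e, e) (0, w) = w
    rw [fderiv_chartMul_right het, ← hφ, h1, tderiv_extChartAt_self, tderiv_mul_left_eq,
      orbitDeriv_one, adDeriv_one]
    rfl
  have hNd : HasFDerivAt N (((ContinuousLinearMap.compL 𝕜 E (E × E) E).flip
      (ContinuousLinearMap.inl 𝕜 E E)).comp ((fderiv 𝕜 (fderiv 𝕜 m) (e, e)).comp
      (ContinuousLinearMap.inr 𝕜 E E))) e :=
    ((ContinuousLinearMap.compL 𝕜 E (E × E) E).flip
      (ContinuousLinearMap.inl 𝕜 E E)).hasFDerivAt.comp e (hmd.comp e hr)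
  have hVd : ∀ w, HasFDerivAt (V w) ((ContinuousLinearMap.apply 𝕜 E ((0, w) : E × E)).comp
      ((fderiv 𝕜 (fderiv 𝕜 m) (e, e)).comp (ContinuousLinearMap.inl 𝕜 E E))) e := by
    intro w
    exact (ContinuousLinearMap.apply 𝕜 E ((0, w) : E × E)).hasFDerivAt.comp e
      (HasFDerivAt.comp (f := fun a : E => (a, e)) e hmd hl)
  have hrel : ∀ a ∈ φ.target, N a (A a) = V w a := by
    intro a ha
    change fderiv 𝕜 m (e, a) (A a, 0) = fderiv 𝕜 m (a, e) (0, w)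
    rw [fderiv_chartMul_left ha, fderiv_chartMul_right ha, tderiv_mul_left_eq]
  have htarget : ∀ᶠ a in 𝓝 e, a ∈ φ.target := extChartAt_target_mem_nhds (I := 𝓘(𝕜, E)) (1 : D)
  have hAinv : A =ᶠ[𝓝 e] fun a => Ring.inverse (N a) (V w a) := by
    have hunit : ∀ᶠ a in 𝓝 e, IsUnit (N a) :=
      hNd.continuousAt.eventually_mem (by
        rw [hN1]; exact Units.isOpen.mem_nhds isUnit_one)
    filter_upwards [htarget, hunit] with a ha hu
    rw [← hrel a ha]
    change A a = (Ring.inverse (N a) * N a) (A a)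
    rw [Ring.inverse_mul_cancel _ hu]
    rfl
  have hinv : DifferentiableAt 𝕜 (fun a => Ring.inverse (N a)) e := by
    have : DifferentiableAt 𝕜 (Ring.inverse : (E →L[𝕜] E) → _) (N e) := by
      rw [hN1]
      exact (contDiffAt_ringInverse 𝕜 (n := 1) (1 : (E →L[𝕜] E)ˣ)).differentiableAt one_ne_zero
    exact this.comp e hNd.differentiableAt
  have hAd : DifferentiableAt 𝕜 A e :=
    (hinv.clm_apply (hVd w).differentiableAt).congr_of_eventuallyEq hAinv
  have hAe : A e = w := by
    change adDeriv 𝕜 E (φ.symm e) w = w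
    rw [h1, adDeriv_one]; rfl
  have hA' : ∀ v, fderiv 𝕜 A e v = modelBracket 𝕜 D v w := by
    intro v
    have hprod := hNd.clm_apply hAd.hasFDerivAt
    have heq : (fun a => N a (A a)) =ᶠ[𝓝 e] V w := by
      filter_upwards [htarget] with a ha using hrel a ha
    have huniq := (hprod.congr_of_eventuallyEq heq.symm).unique (hVd w)
    have hv : N e (fderiv 𝕜 A e v) + fderiv 𝕜 (fderiv 𝕜 m) (e, e) (0, v) (A e, 0) =
        fderiv 𝕜 (fderiv 𝕜 m) (e, e) (v, 0) (0, w) := congrArg (fun T : E →L[𝕜] E => T v) huniq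
    rw [hN1, hAe] at hv
    have hv' : fderiv 𝕜 A e v + fderiv 𝕜 (fderiv 𝕜 m) (e, e) (0, v) (w, 0) =
        fderiv 𝕜 (fderiv 𝕜 m) (e, e) (v, 0) (0, w) := hv
    rw [modelBracket_eq_fderiv_chartMul]
    change _ = fderiv 𝕜 (V w) e v - fderiv 𝕜 (V v) e w
    rw [(hVd w).fderiv, (hVd v).fderiv]
    change _ = fderiv 𝕜 (fderiv 𝕜 m) (e, e) (v, 0) (0, w) -
      fderiv 𝕜 (fderiv 𝕜 m) (e, e) (w, 0) (0, v)
    rw [hsymm.eq (w, 0) (0, v), ← hv', add_sub_cancel_right]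
  -- back to the group
  have hloc : (fun g : D => adDeriv 𝕜 E g w) =ᶠ[𝓝 1] fun g => A (φ g) := by
    filter_upwards [extChartAt_source_mem_nhds (I := 𝓘(𝕜, E)) (1 : D)] with g hg
    change _ = adDeriv 𝕜 E (φ.symm (φ g)) w
    rw [φ.left_inv hg]
  have dφ : MDifferentiableAt 𝓘(𝕜, E) 𝓘(𝕜, E) φ 1 :=
    (contMDiffAt_extChartAt_of_mem (mem_extChartAt_source (1 : D))).mdifferentiableAt (by simp)
  have dA : MDifferentiableAt 𝓘(𝕜, E) 𝓘(𝕜, E) A (φ 1) := hAd.mdifferentiableAt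
  refine ⟨(dA.comp 1 dφ).congr_of_eventuallyEq hloc, fun v => ?_⟩
  rw [tderiv_congr hloc, tderiv_comp_apply dA dφ, tderiv_extChartAt_self, tderiv_eq_fderiv]
  exact hA' v

end AdjointDerivative

end DrinfeldPoisson

/-! ### Invariance under the adjoint action -/

namespace DrinfeldPoisson

section AdjointConsequences

variable {𝕜 : Type*} [RCLike 𝕜] {E : Type*} [NormedAddCommGroup E] [NormedSpace 𝕜 E]
  {G : Type*} [NormedAddCommGroup G] [NormedSpace 𝕜 G]
  {D : Type*} [TopologicalSpace D] [ChartedSpace E D] [Group D] [LieGroup 𝓘(𝕜, E) ∞ D]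
  {L : Type*} [TopologicalSpace L] [ChartedSpace G L]

lemma mdiff_adDeriv_apply [CompleteSpace E] (w : E) (g : D) :
    MDifferentiableAt 𝓘(𝕜, E) 𝓘(𝕜, E) (fun k : D => adDeriv 𝕜 E k w) g := by
  have h : (fun k : D => adDeriv 𝕜 E k w) = fun k => adDeriv 𝕜 E (k * g⁻¹) (adDeriv 𝕜 E g w) := by
    funext k
    rw [← adDeriv_mul, inv_mul_cancel_right]
  rw [h]
  have h1 : MDifferentiableAt 𝓘(𝕜, E) 𝓘(𝕜, E) (fun k : D => adDeriv 𝕜 E k (adDeriv 𝕜 E g w))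
      (g * g⁻¹) := by
    rw [mul_inv_cancel]; exact (tderiv_adDeriv_one _).1
  exact h1.comp g (mdiff_mul mdifferentiableAt_id mdifferentiableAt_const)

/-- The derivative of `g ↦ Ad_g w` along right-invariant vector fields. -/
lemma tderiv_adDeriv_apply [CompleteSpace E] (w X : E) (g : D) :
    tderiv 𝕜 E E (fun k : D => adDeriv 𝕜 E k w) g (orbitDeriv 𝕜 E E D g X) =
      modelBracket 𝕜 D X (adDeriv 𝕜 E g w) := by
  rw [← (tderiv_adDeriv_one (𝕜 := 𝕜) (D := D) (adDeriv 𝕜 E g w)).2 X]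
  have h1 : MDifferentiableAt 𝓘(𝕜, E) 𝓘(𝕜, E) (fun k : D => adDeriv 𝕜 E k w) ((1 : D) • g) :=
    mdiff_adDeriv_apply _ _
  have := tderiv_comp_apply (𝕜 := 𝕜) (E := E) (F := E) (G := E)
    (g := fun k : D => adDeriv 𝕜 E k w) (f := fun k : D => k • g) (x := 1) h1
    (smoothAction_self.mdiff_orbit g 1) X
  rw [one_smul] at this
  rw [orbitDeriv, ← this]
  simp only [smul_eq_mul, adDeriv_mul]

lemma tderiv_adDeriv_comp [CompleteSpace E] (w X : E) {f : L → D} {t : L} {v : G}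
    (hf : MDifferentiableAt 𝓘(𝕜, G) 𝓘(𝕜, E) f t)
    (hX : tderiv 𝕜 G E f t v = orbitDeriv 𝕜 E E D (f t) X) :
    tderiv 𝕜 G E (fun s => adDeriv 𝕜 E (f s) w) t v =
      modelBracket 𝕜 D X (adDeriv 𝕜 E (f t) w) := by
  rw [tderiv_comp_apply (g := fun k : D => adDeriv 𝕜 E k w) (mdiff_adDeriv_apply _ _) hf, hX,
    tderiv_adDeriv_apply]

/-- `Ad_d` preserves the Lie bracket: differentiate `Ad_d (Ad_g w) = Ad_{d g d⁻¹} (Ad_d w)`. -/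
lemma adDeriv_modelBracket [CompleteSpace E] (d : D) (v w : E) :
    adDeriv 𝕜 E d (modelBracket 𝕜 D v w) =
      modelBracket 𝕜 D (adDeriv 𝕜 E d v) (adDeriv 𝕜 E d w) := by
  have hA : MDifferentiableAt 𝓘(𝕜, E) 𝓘(𝕜, E) (adDeriv 𝕜 E d) (adDeriv 𝕜 E (1 : D) w) :=
    (adDeriv 𝕜 E d).differentiableAt.mdifferentiableAt
  have e1 := tderiv_comp_apply (𝕜 := 𝕜) (E := E) (F := E) (G := E) (g := adDeriv 𝕜 E d)
    (f := fun k : D => adDeriv 𝕜 E k w) (x := 1) hA (mdiff_adDeriv_apply _ _) v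
  rw [tderiv_eq_fderiv, ContinuousLinearMap.fderiv, (tderiv_adDeriv_one w).2 v] at e1
  rw [← e1]
  have e2 := tderiv_adDeriv_comp (𝕜 := 𝕜) (adDeriv 𝕜 E d w) (adDeriv 𝕜 E d v)
    (f := fun k : D => d * k * d⁻¹) (t := 1) (v := v) (mdiff_conj d 1) (by
      have : d * 1 * d⁻¹ = 1 := by group
      rw [this, orbitDeriv_one]; rfl)
  have e3 : d * 1 * d⁻¹ = 1 := by group
  rw [e3, adDeriv_one] at e2
  refine Eq.trans ?_ e2
  congr 2
  funext k
  rw [← adDeriv_mul, ← adDeriv_mul]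
  congr 1
  group

/-- An invariant bilinear form is preserved by the adjoint action of a connected group. -/
lemma bilin_adDeriv_eq [CompleteSpace E] [ConnectedSpace D] (b : E →L[𝕜] E →L[𝕜] 𝕜)
    (hb : ∀ X v w, b (modelBracket 𝕜 D X v) w + b v (modelBracket 𝕜 D X w) = 0)
    (d : D) (v w : E) : b (adDeriv 𝕜 E d v) (adDeriv 𝕜 E d w) = b v w := by
  have : IsManifold 𝓘(𝕜, E) 1 D := IsManifold.of_le (n := ∞) (by simp)
  have hm : ∀ p : E × E, MDifferentiableAt (𝓘(𝕜, E).prod 𝓘(𝕜, E)) 𝓘(𝕜, 𝕜)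
      (fun p : E × E => b p.1 p.2) p := by
    intro p
    have : DifferentiableAt 𝕜 (fun p : E × E => b p.1 p.2) p := by fun_prop
    have h := this.mdifferentiableAt
    rwa [modelWithCornersSelf_prod, ← chartedSpaceSelf_prod] at h
  have key := eq_of_tderiv_eq_zero (𝕜 := 𝕜) (E := E) (F := 𝕜)
    (f := fun g : D => b (adDeriv 𝕜 E g v) (adDeriv 𝕜 E g w)) (fun g => ⟨?_, ?_⟩) d 1
  · simpa [adDeriv_one] using key
  · exact MDifferentiableAt.comp (g := fun p : E × E => b p.1 p.2)
      (f := fun g : D => (adDeriv 𝕜 E g v, adDeriv 𝕜 E g w)) g (hm _)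
      ((mdiff_adDeriv_apply v g).prodMk (mdiff_adDeriv_apply w g))
  · -- it suffices to differentiate along right-invariant vector fields, which span
    have hsurj : Function.Surjective (orbitDeriv 𝕜 E E D g) := by
      intro Y
      refine ⟨tderiv 𝕜 E E (fun k : D => k * g⁻¹) g Y, ?_⟩
      have h1 : MDifferentiableAt 𝓘(𝕜, E) 𝓘(𝕜, E) (fun k : D => k • g) (g * g⁻¹) :=
        smoothAction_self.mdiff_orbit g _
      have := tderiv_comp_apply (𝕜 := 𝕜) (E := E) (F := E) (G := E) (g := fun k : D => k • g)
        (f := fun k : D => k * g⁻¹) (x := g) h1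
        (mdiff_mul mdifferentiableAt_id mdifferentiableAt_const) Y
      rw [mul_inv_cancel] at this
      refine this.symm.trans ?_
      simp only [smul_eq_mul, inv_mul_cancel_right, tderiv_id]
      rfl
    ext Y
    obtain ⟨X, rfl⟩ := hsurj Y
    have := tderiv_comp₂_apply (𝕜 := 𝕜) (E := E) (F := E) (G := 𝕜) (m := fun p : E × E => b p.1 p.2)
      (f := fun k : D => adDeriv 𝕜 E k v) (g := fun k : D => adDeriv 𝕜 E k w) (t := g)
      (hm _) (mdiff_adDeriv_apply v g) (mdiff_adDeriv_apply w g) (orbitDeriv 𝕜 E E D g X)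
    refine this.trans ?_
    rw [tderiv_adDeriv_apply, tderiv_adDeriv_apply, tderiv_eq_fderiv, tderiv_eq_fderiv]
    have f1 : fderiv 𝕜 (fun y => b y (adDeriv 𝕜 E g w)) (adDeriv 𝕜 E g v) =
        b.flip (adDeriv 𝕜 E g w) := (b.flip (adDeriv 𝕜 E g w)).fderiv
    have f2 : fderiv 𝕜 (fun y => b (adDeriv 𝕜 E g v) y) (adDeriv 𝕜 E g w) =
        b (adDeriv 𝕜 E g v) := (b (adDeriv 𝕜 E g v)).fderiv
    rw [f1, f2]
    exact hb X _ _

variable {γ : 𝕜 → D} {X : E}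

omit [LieGroup 𝓘(𝕜, E) ∞ D] in
lemma IsOneParameterSubgroup.map_zero (h : IsOneParameterSubgroup (E := E) γ X) : γ 0 = 1 := by
  have := h.map_add 0 0
  rwa [add_zero, eq_comm, mul_eq_left] at this

omit [LieGroup 𝓘(𝕜, E) ∞ D] in
lemma IsOneParameterSubgroup.map_neg (h : IsOneParameterSubgroup (E := E) γ X) (t : 𝕜) :
    γ (-t) = (γ t)⁻¹ := by
  rw [eq_inv_iff_mul_eq_one, ← h.map_add, neg_add_cancel, h.map_zero]

omit [LieGroup 𝓘(𝕜, E) ∞ D] in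
lemma IsOneParameterSubgroup.map_nsmul (h : IsOneParameterSubgroup (E := E) γ X) (n : ℕ) (t : 𝕜) :
    γ (n * t) = γ t ^ n := by
  induction n with
  | zero => simp [h.map_zero]
  | succ n ih => rw [Nat.cast_succ, add_mul, one_mul, h.map_add, ih, pow_succ]

omit [LieGroup 𝓘(𝕜, E) ∞ D] in
lemma IsOneParameterSubgroup.mdiff (h : IsOneParameterSubgroup (E := E) γ X) (t : 𝕜) :
    MDifferentiableAt 𝓘(𝕜, 𝕜) 𝓘(𝕜, E) γ t :=
  (h.contMDiff t).mdifferentiableAt (by simp)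

/-- The curve `t ↦ γ(t)` is an integral curve of the right-invariant vector field of `X`. -/
lemma IsOneParameterSubgroup.tderiv_eq (h : IsOneParameterSubgroup (E := E) γ X) (t : 𝕜) :
    tderiv 𝕜 𝕜 E γ t 1 = orbitDeriv 𝕜 E E D (γ t) X := by
  have h0 : tderiv 𝕜 𝕜 E γ 0 1 = X := h.velocity
  have hd : MDifferentiableAt 𝓘(𝕜, 𝕜) 𝓘(𝕜, 𝕜) (fun s : 𝕜 => s + t) 0 :=
    (differentiableAt_id.add_const t).mdifferentiableAt
  have e1 := tderiv_comp_apply (𝕜 := 𝕜) (E := 𝕜) (F := 𝕜) (G := E) (g := γ)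
    (f := fun s : 𝕜 => s + t) (x := 0) (h.mdiff _) hd 1
  have hd2 : MDifferentiableAt 𝓘(𝕜, E) 𝓘(𝕜, E) (fun k : D => k • γ t) (γ 0) :=
    smoothAction_self.mdiff_orbit (γ t) _
  have e2 := tderiv_comp_apply (𝕜 := 𝕜) (E := 𝕜) (F := E) (G := E) (g := fun k : D => k • γ t)
    (f := γ) (x := 0) hd2 (h.mdiff 0) 1
  have e3 : tderiv 𝕜 𝕜 𝕜 (fun s : 𝕜 => s + t) 0 1 = 1 := by
    rw [tderiv_eq_fderiv]; simp
  rw [h0, h.map_zero] at e2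
  rw [e3, zero_add] at e1
  rw [orbitDeriv, ← e2, ← e1]
  simp only [h.map_add, smul_eq_mul]

lemma eq_zero_of_hasDerivAt_linear {W : Type*} [NormedAddCommGroup W] [NormedSpace ℝ W]
    (A : W →L[ℝ] W) {w : ℝ → W} (hw : ∀ t, HasDerivAt w (A (w t)) t) (h0 : w 0 = 0) (t : ℝ) :
    w t = 0 := by
  have := ODE_solution_unique_univ (v := fun _ => A) (s := fun _ => Set.univ) (K := ‖A‖₊)
    (f := w) (g := fun _ => 0) (t₀ := 0) (fun t => A.lipschitz.lipschitzOnWith)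
    (fun t => ⟨hw t, Set.mem_univ _⟩)
    (fun t => ⟨by simpa using hasDerivAt_const t (0 : W), Set.mem_univ _⟩) h0
  exact congrFun this t

variable [FiniteDimensional 𝕜 E] [CompleteSpace E]

/-- A subspace stable under `ad_X` is stable under `Ad_{exp X}`: in a complement of `u`, the
component of `Ad_{exp tX} y` solves a linear differential equation with zero initial value. -/
lemma adDeriv_mem_of_isOneParameterSubgroup (h : IsOneParameterSubgroup (E := E) γ X)
    {u : Submodule 𝕜 E} (hu : ∀ y ∈ u, modelBracket 𝕜 D X y ∈ u) {y : E} (hy : y ∈ u) :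
    adDeriv 𝕜 E (γ 1) y ∈ u := by
  let _ : NormedSpace ℝ E := NormedSpace.restrictScalars ℝ 𝕜 E
  have : IsScalarTower ℝ 𝕜 E := IsScalarTower.restrictScalars ℝ 𝕜 E
  obtain ⟨u₂, hu₂⟩ := u.exists_isCompl
  let p : E →ₗ[𝕜] E := u₂.subtype ∘ₗ u₂.projectionOnto u hu₂.symm
  have hp0 : ∀ z ∈ u, p z = 0 := by
    intro z hz
    rw [← Submodule.ker_projectionOnto hu₂.symm, LinearMap.mem_ker] at hz
    simp [p, hz]
  have hp1 : ∀ z, z - p z ∈ u := by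
    intro z
    rw [← Submodule.ker_projectionOnto hu₂.symm, LinearMap.mem_ker, map_sub]
    simp only [p, LinearMap.comp_apply, Submodule.subtype_apply,
      Submodule.projectionOnto_apply_left, sub_self]
  let ad : E →ₗ[𝕜] E := LieAlgebra.ad 𝕜 (GroupLieAlgebra 𝓘(𝕜, E) D) X
  have had : ∀ z, ad z = modelBracket 𝕜 D X z := fun z => rfl
  let A : E →L[ℝ] E := (LinearMap.toContinuousLinearMap (p ∘ₗ ad)).restrictScalars ℝ
  let pc : E →L[𝕜] E := LinearMap.toContinuousLinearMap p
  let w : ℝ → E := fun t => pc (adDeriv 𝕜 E (γ (t : 𝕜)) y)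
  have hw : ∀ t, HasDerivAt w (A (w t)) t := by
    intro t
    have hmd : MDifferentiableAt 𝓘(𝕜, 𝕜) 𝓘(𝕜, E) (fun s => adDeriv 𝕜 E (γ s) y) (t : 𝕜) :=
      (mdiff_adDeriv_apply y (γ (t : 𝕜))).comp (t : 𝕜) (h.mdiff (t : 𝕜))
    have hd : HasDerivAt (fun s => adDeriv 𝕜 E (γ s) y)
        (modelBracket 𝕜 D X (adDeriv 𝕜 E (γ (t : 𝕜)) y)) (t : 𝕜) := by
      rw [← tderiv_adDeriv_comp y X (h.mdiff (t : 𝕜)) (h.tderiv_eq (t : 𝕜)), tderiv_eq_fderiv]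
      exact (mdifferentiableAt_iff_differentiableAt.1 hmd).hasFDerivAt.hasDerivAt
    have hof : HasDerivAt (fun s : ℝ => (s : 𝕜)) 1 t := by
      simpa using (RCLike.ofRealCLM (K := 𝕜)).hasDerivAt (x := t)
    have h2 := (pc.hasFDerivAt.comp_hasDerivAt (t : 𝕜) hd).scomp t hof
    rw [one_smul] at h2
    have h3 : HasDerivAt w (pc (modelBracket 𝕜 D X (adDeriv 𝕜 E (γ (t : 𝕜)) y))) t := h2
    refine h3.congr_deriv (Eq.symm ?_)
    change p (ad (p (adDeriv 𝕜 E (γ (t : 𝕜)) y))) = p (ad (adDeriv 𝕜 E (γ (t : 𝕜)) y))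
    rw [eq_comm, ← sub_eq_zero, ← map_sub, ← map_sub]
    exact hp0 _ (hu _ (hp1 _))
  have h0 : w 0 = 0 := by
    change p (adDeriv 𝕜 E (γ ((0 : ℝ) : 𝕜)) y) = 0
    rw [RCLike.ofReal_zero, h.map_zero, adDeriv_one]
    exact hp0 _ hy
  have h1 : p (adDeriv 𝕜 E (γ ((1 : ℝ) : 𝕜)) y) = 0 := eq_zero_of_hasDerivAt_linear A hw h0 1
  have h2 := hp1 (adDeriv 𝕜 E (γ ((1 : ℝ) : 𝕜)) y)
  rwa [h1, sub_zero, RCLike.ofReal_one] at h2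

/-- The connected subgroup of a subalgebra normalizes the subalgebra. -/
lemma adDeriv_mem_of_mem_connectedSubgroup {u : Submodule 𝕜 E}
    (hu : ∀ v ∈ u, ∀ w ∈ u, modelBracket 𝕜 D v w ∈ u) {g : D}
    (hg : g ∈ connectedSubgroup (D := D) (E := E) u) {y : E} (hy : y ∈ u) :
    adDeriv 𝕜 E g y ∈ u := by
  have key : u.map (adDeriv 𝕜 E g).toLinearMap = u := by
    induction hg using Subgroup.closure_induction with
    | mem g hg =>
      obtain ⟨X, hX, γ, hγ, rfl⟩ := hg
      apply Submodule.eq_of_le_of_finrank_eq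
      · rintro _ ⟨z, hz, rfl⟩
        exact adDeriv_mem_of_isOneParameterSubgroup hγ (hu X hX) hz
      · exact (Submodule.equivMapOfInjective _ (adDeriv_injective (γ 1)) u).finrank_eq.symm
    | one => rw [adDeriv_one]; exact Submodule.map_id u
    | mul a b _ _ ha hb =>
      have : (adDeriv 𝕜 E (a * b)).toLinearMap =
          (adDeriv 𝕜 E a).toLinearMap ∘ₗ (adDeriv 𝕜 E b).toLinearMap := by
        ext z; exact adDeriv_mul a b z
      rw [this, Submodule.map_comp, hb, ha]
    | inv a _ ha =>
      conv_lhs => rw [← ha]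
      rw [← Submodule.map_comp]
      have : (adDeriv 𝕜 E a⁻¹).toLinearMap ∘ₗ (adDeriv 𝕜 E a).toLinearMap = LinearMap.id := by
        ext z; exact adDeriv_inv_apply a z
      rw [this, Submodule.map_id]
  rw [← key]
  exact ⟨y, hy, rfl⟩

end AdjointConsequences

end DrinfeldPoisson

/-! ### Existence of one-parameter subgroups -/

namespace DrinfeldPoisson

section OneParameterSubgroups

variable {𝕜 : Type*} [RCLike 𝕜] {E : Type*} [NormedAddCommGroup E] [NormedSpace 𝕜 E]
  {F : Type*} [NormedAddCommGroup F] [NormedSpace 𝕜 F]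
  {M : Type*} [TopologicalSpace M] [ChartedSpace E M]
  {N : Type*} [TopologicalSpace N] [ChartedSpace F N]

/-- A map with vanishing derivative on a connected open set is constant there. -/
lemma eqOn_of_tderiv_eq_zero [IsManifold 𝓘(𝕜, E) 1 M] [IsManifold 𝓘(𝕜, F) 1 N] {f : M → N}
    {s : Set M} (ho : IsOpen s) (hs : IsPreconnected s)
    (h : ∀ y ∈ s, MDifferentiableAt 𝓘(𝕜, E) 𝓘(𝕜, F) f y ∧ tderiv 𝕜 E F f y = 0)
    {x y : M} (hx : x ∈ s) (hy : y ∈ s) : f x = f y := by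
  have : PreconnectedSpace s := isPreconnected_iff_preconnectedSpace.1 hs
  have hl : IsLocallyConstant (fun z : s => f z) := by
    refine (IsLocallyConstant.iff_eventually_eq _).2 fun z => ?_
    have h1 : ∀ᶠ w in 𝓝 (z : M), f w = f z :=
      eventually_eq_of_tderiv_eq_zero (Filter.eventually_of_mem (ho.mem_nhds z.2) h)
    exact continuous_subtype_val.continuousAt.eventually h1
  exact hl.apply_eq_of_preconnectedSpace ⟨x, hx⟩ ⟨y, hy⟩

variable {D : Type*} [TopologicalSpace D] [ChartedSpace E D] [Group D] [LieGroup 𝓘(𝕜, E) ∞ D]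

/-- Local integral curves of right-invariant vector fields. -/
lemma exists_local_integralCurve [CompleteSpace E] (X : E) :
    ∃ r > 0, ∃ γ : 𝕜 → D, γ 0 = 1 ∧ ∀ t ∈ Metric.ball (0 : 𝕜) r,
      ContMDiffAt 𝓘(𝕜, 𝕜) 𝓘(𝕜, E) ∞ γ t ∧
      tderiv 𝕜 𝕜 E γ t 1 = orbitDeriv 𝕜 E E D (γ t) X := by
  set φ := extChartAt 𝓘(𝕜, E) (1 : D) with hφ
  have het : φ 1 ∈ φ.target := mem_extChartAt_target (I := 𝓘(𝕜, E)) (1 : D)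
  have h1 : φ.symm (φ 1) = 1 := extChartAt_to_inv (I := 𝓘(𝕜, E)) (1 : D)
  have hV : ContDiffOn 𝕜 ∞ (fun a => fderiv 𝕜 (chartMul 𝕜 E D) (φ 1, a) (X, 0)) φ.target := by
    intro a ha
    have hd : ContDiffAt 𝕜 ∞ (chartMul 𝕜 E D) (φ 1, a) :=
      contDiffAt_chartMul het ha (by rw [← hφ, h1, one_mul]; exact φ.map_target ha)
    have hd' : ContDiffAt 𝕜 ∞ (fderiv 𝕜 (chartMul 𝕜 E D)) (φ 1, a) :=
      hd.fderiv_right (m := ∞) (by norm_cast)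
    have hp : ContDiffAt 𝕜 ∞ (fun a : E => (φ 1, a)) a := contDiffAt_const.prodMk contDiffAt_id
    exact ((ContDiffAt.comp (g := fderiv 𝕜 (chartMul 𝕜 E D)) a hd' hp).clm_apply
      contDiffAt_const).contDiffWithinAt
  obtain ⟨r, hr, z, hz0, hz, hzs⟩ :=
    exists_hasDerivAt_eq (isOpen_extChartAt_target (I := 𝓘(𝕜, E)) (1 : D)) het hV
  refine ⟨r, hr, fun t => φ.symm (z t), by simp only [hz0, h1], fun t ht => ?_⟩
  obtain ⟨hzt, hzd⟩ := hz t ht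
  have hc : ContMDiffAt 𝓘(𝕜, 𝕜) 𝓘(𝕜, E) ∞ z t :=
    (hzs.contDiffAt (Metric.isOpen_ball.mem_nhds ht)).contMDiffAt
  have hs := contMDiffAt_extChartAt_symm (𝕜 := 𝕜) (M := D) hzt
  refine ⟨hs.comp t hc, ?_⟩
  have hsd := hs.mdifferentiableAt (by simp)
  rw [tderiv_comp_apply (g := φ.symm) (f := z) hsd (hc.mdifferentiableAt (by simp)),
    tderiv_eq_fderiv, fderiv_eq_smul_deriv, one_smul, hzd.deriv, fderiv_chartMul_left hzt]
  have hsrc : φ.symm (z t) ∈ φ.source := φ.map_target hzt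
  have hr : φ (φ.symm (z t)) = z t := φ.right_inv hzt
  have e := tderiv_comp_apply (𝕜 := 𝕜) (E := E) (F := E) (G := E) (g := φ.symm) (f := φ)
    (x := φ.symm (z t)) (by rw [hr]; exact hsd)
    ((contMDiffAt_extChartAt_of_mem hsrc).mdifferentiableAt (by simp))
    (orbitDeriv 𝕜 E E D (φ.symm (z t)) X)
  rw [hr] at e
  refine e.symm.trans ?_
  rw [tderiv_congr (g := fun y => y), tderiv_id]
  · rfl
  · filter_upwards [(chartAt E (1 : D)).open_source.mem_nhds
      (by rwa [hφ, extChartAt_source] at hsrc)] with y hy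
    exact φ.left_inv (by rwa [hφ, extChartAt_source])

/-- Integral curves of right-invariant vector fields are local homomorphisms: the curve
`γ(t)⁻¹ γ(t + s)` has zero derivative. -/
lemma map_add_of_local_integralCurve {r : ℝ} {γ : 𝕜 → D} {X : E} (h0 : γ 0 = 1)
    (h : ∀ t ∈ Metric.ball (0 : 𝕜) (2 * r), ContMDiffAt 𝓘(𝕜, 𝕜) 𝓘(𝕜, E) ∞ γ t ∧
      tderiv 𝕜 𝕜 E γ t 1 = orbitDeriv 𝕜 E E D (γ t) X)
    {s t : 𝕜} (hs : ‖s‖ < r) (ht : ‖t‖ < r) : γ (t + s) = γ t * γ s := by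
  have : IsManifold 𝓘(𝕜, E) 1 D := IsManifold.of_le (n := ∞) (by simp)
  have hact := smoothAction_self (𝕜 := 𝕜) (E := E) (D := D)
  have hr : 0 < r := (norm_nonneg s).trans_lt hs
  have hconst := eqOn_of_tderiv_eq_zero (𝕜 := 𝕜) (E := 𝕜) (F := E)
    (f := fun t => (γ t)⁻¹ * γ (t + s)) (s := Metric.ball (0 : 𝕜) r) Metric.isOpen_ball
    (by
      let _ : NormedSpace ℝ 𝕜 := NormedSpace.restrictScalars ℝ 𝕜 𝕜
      exact (convex_ball (0 : 𝕜) r).isPreconnected) (x := t) (y := 0) ?_ (by simpa using ht)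
    (by simpa using hr)
  · simp only [h0, zero_add, inv_one, one_mul] at hconst
    rw [← hconst, mul_inv_cancel_left]
  · intro t ht
    rw [mem_ball_zero_iff] at ht
    obtain ⟨c1, d1⟩ := h t (by rw [mem_ball_zero_iff]; linarith)
    obtain ⟨c2, d2⟩ := h (t + s) (by
      rw [mem_ball_zero_iff]; linarith [norm_add_le t s])
    have m1 : MDifferentiableAt 𝓘(𝕜, 𝕜) 𝓘(𝕜, E) γ t := c1.mdifferentiableAt (by simp)
    have hsh : MDifferentiableAt 𝓘(𝕜, 𝕜) 𝓘(𝕜, 𝕜) (fun t : 𝕜 => t + s) t :=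
      (differentiableAt_id.add_const s).mdifferentiableAt
    have m2 : MDifferentiableAt 𝓘(𝕜, 𝕜) 𝓘(𝕜, E) (fun t => γ (t + s)) t :=
      MDifferentiableAt.comp (g := γ) t (c2.mdifferentiableAt (by simp)) hsh
    have mi : MDifferentiableAt 𝓘(𝕜, 𝕜) 𝓘(𝕜, E) (fun t => (γ t)⁻¹) t :=
      (c1.inv).mdifferentiableAt (by simp)
    have mc := mdiff_mul (𝕜 := 𝕜) mi m2
    refine ⟨mc, ?_⟩
    have e1 := hact.tderiv_smul (𝕜 := 𝕜) (G := 𝕜) m1 mc 1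
    have e2 : tderiv 𝕜 𝕜 E (fun t => γ (t + s)) t 1 = orbitDeriv 𝕜 E E D (γ (t + s)) X := by
      rw [tderiv_comp_apply (g := γ) (f := fun t => t + s) (c2.mdifferentiableAt (by simp)) hsh,
        tderiv_eq_fderiv]
      simpa using d2
    have e3 : (fun t => γ t • ((γ t)⁻¹ * γ (t + s))) = fun t => γ (t + s) := by
      funext t; simp
    rw [e3, e2, d1, hact.tderiv_orbit_orbitDeriv] at e1
    rw [smul_eq_mul, mul_inv_cancel_left, left_eq_add] at e1
    have e4 := hact.tderiv_translation_injective (𝕜 := 𝕜) (γ t) _ (e1.trans (map_zero _).symm)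
    ext
    exact e4

omit [ChartedSpace E D] [TopologicalSpace D] [LieGroup 𝓘(𝕜, E) ∞ D] in
/-- For a local homomorphism `γ`, the element `γ(t / n)^n` does not depend on the large integer
`n`. -/
lemma map_div_pow_eq_of_local_hom {r : ℝ} {γ : 𝕜 → D} (h0 : γ 0 = 1)
    (h : ∀ s t : 𝕜, ‖s‖ < r → ‖t‖ < r → γ (t + s) = γ t * γ s) {m n : ℕ} {t : 𝕜}
    (hm : ‖t‖ < m * r) (hn : ‖t‖ < n * r) :
    γ (t / m) ^ m = γ (t / n) ^ n := by
  have key : ∀ (k : ℕ) (s : 𝕜), ‖s‖ * k < r → γ (k * s) = γ s ^ k := by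
    intro k s
    induction k with
    | zero => intro _; simp [h0]
    | succ k ih =>
      intro hk
      have h1 : ‖s‖ * k < r := lt_of_le_of_lt (by gcongr; simp) hk
      have h2 : ‖s‖ < r := lt_of_le_of_lt (le_mul_of_one_le_right (norm_nonneg s) (by simp)) hk
      rw [Nat.cast_succ, add_mul, one_mul,
        h _ _ h2 (by rw [norm_mul, mul_comm]; simpa using h1), ih h1, pow_succ]
  have main : ∀ (m n : ℕ) (t : 𝕜), ‖t‖ < m * r → ‖t‖ < n * r →
      γ (t / m) ^ m = γ (t / (m * n)) ^ (m * n) := by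
    intro m n t hm hn
    have hm0 : (m : 𝕜) ≠ 0 := by
      rintro hm0
      rw [Nat.cast_eq_zero] at hm0
      simp only [hm0, Nat.cast_zero, zero_mul] at hm
      exact absurd hm (norm_nonneg t).not_gt
    have hn0 : (n : 𝕜) ≠ 0 := by
      rintro hn0
      rw [Nat.cast_eq_zero] at hn0
      simp only [hn0, Nat.cast_zero, zero_mul] at hn
      exact absurd hn (norm_nonneg t).not_gt
    have hm1 : 0 < (m : ℝ) := by
      have : m ≠ 0 := by exact_mod_cast hm0
      positivity
    have hn1 : 0 < (n : ℝ) := by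
      have : n ≠ 0 := by exact_mod_cast hn0
      positivity
    have e : t / m = n * (t / (m * n)) := by field_simp
    rw [e, key n, ← pow_mul, mul_comm m n]
    rw [norm_div, norm_mul, RCLike.norm_natCast, RCLike.norm_natCast, div_mul_eq_mul_div,
      div_lt_iff₀ (by positivity)]
    calc ‖t‖ * n < (m * r) * n := by gcongr
      _ = r * (m * n) := by ring
  rw [main m n t hm hn, main n m t hn hm, mul_comm n m, mul_comm (n : 𝕜) m]

/-- Every element of the Lie algebra generates a one-parameter subgroup. -/
theorem exists_isOneParameterSubgroup [CompleteSpace E] (X : E) :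
    ∃ γ : 𝕜 → D, IsOneParameterSubgroup (E := E) γ X := by
  obtain ⟨R, hR, γ, h0, h⟩ := exists_local_integralCurve (𝕜 := 𝕜) (D := D) X
  obtain ⟨r, rfl⟩ : ∃ r, R = 2 * r := ⟨R / 2, by ring⟩
  have hr : 0 < r := by linarith
  have hadd : ∀ s t : 𝕜, ‖s‖ < r → ‖t‖ < r → γ (t + s) = γ t * γ s :=
    fun s t hs ht => map_add_of_local_integralCurve h0 h hs ht
  have hex : ∀ c : ℝ, ∃ n : ℕ, c < n * r := fun c => by
    obtain ⟨n, hn⟩ := exists_nat_gt (c / r)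
    exact ⟨n, (div_lt_iff₀ hr).1 hn⟩
  choose N hN using hex
  -- `Γ` extends `γ` from the ball to all of `𝕜`
  let Γ : 𝕜 → D := fun t => γ (t / N ‖t‖) ^ N ‖t‖
  have hΓ : ∀ (n : ℕ) (t : 𝕜), ‖t‖ < n * r → Γ t = γ (t / n) ^ n := fun n t ht =>
    map_div_pow_eq_of_local_hom h0 hadd (hN _) ht
  have hpos : ∀ (n : ℕ) (t : 𝕜), ‖t‖ < n * r → 0 < (n : ℝ) := by
    intro n t ht
    by_contra hn
    have : (n : ℝ) = 0 := le_antisymm (not_lt.1 hn) n.cast_nonneg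
    rw [this, zero_mul] at ht
    exact absurd ht (norm_nonneg t).not_gt
  have hdiv : ∀ (n : ℕ) (t : 𝕜), ‖t‖ < n * r → ‖t / n‖ < r := by
    intro n t ht
    rw [norm_div, RCLike.norm_natCast, div_lt_iff₀ (hpos n t ht), mul_comm]
    exact ht
  have hloc : Γ =ᶠ[𝓝 0] γ := by
    filter_upwards [Metric.ball_mem_nhds (0 : 𝕜) hr] with t ht
    rw [mem_ball_zero_iff] at ht
    rw [hΓ 1 t (by simpa using ht)]
    simp
  refine ⟨Γ, ⟨?_, ?_, ?_⟩⟩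
  · intro t₀
    have hev : Γ =ᶠ[𝓝 t₀] fun t => γ (t / N ‖t₀‖) ^ N ‖t₀‖ := by
      have : ∀ᶠ t in 𝓝 t₀, ‖t‖ < N ‖t₀‖ * r :=
        continuous_norm.continuousAt.eventually_lt continuousAt_const (hN _)
      filter_upwards [this] with t ht using hΓ _ t ht
    refine ContMDiffAt.congr_of_eventuallyEq ?_ hev
    have hg := (h (t₀ / N ‖t₀‖) (by
      rw [mem_ball_zero_iff]; linarith [hdiv _ _ (hN ‖t₀‖)])).1
    have hd : ContMDiffAt 𝓘(𝕜, 𝕜) 𝓘(𝕜, 𝕜) ∞ (fun t : 𝕜 => t / N ‖t₀‖) t₀ :=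
      (contDiffAt_id.div_const _).contMDiffAt
    have hc : ContMDiffAt 𝓘(𝕜, 𝕜) 𝓘(𝕜, E) ∞ (fun t => γ (t / N ‖t₀‖)) t₀ :=
      ContMDiffAt.comp (g := γ) t₀ hg hd
    exact ContMDiffAt.comp (g := fun g : D => g ^ N ‖t₀‖) t₀
      ((contMDiff_pow (I := 𝓘(𝕜, E)) (n := ∞) (N ‖t₀‖)) _) hc
  · intro s t
    set n := max (N ‖s‖) (max (N ‖t‖) (N ‖s + t‖)) with hn
    have hs : ‖s‖ < n * r := (hN _).trans_le (by gcongr; exact le_max_left _ _)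
    have ht : ‖t‖ < n * r := (hN _).trans_le (by
      gcongr; exact (le_max_left _ _).trans (le_max_right _ _))
    have hst : ‖s + t‖ < n * r := (hN _).trans_le (by
      gcongr; exact (le_max_right _ _).trans (le_max_right _ _))
    have hcomm : Commute (γ (s / n)) (γ (t / n)) := by
      rw [commute_iff_eq, ← hadd _ _ (hdiv n t ht) (hdiv n s hs),
        ← hadd _ _ (hdiv n s hs) (hdiv n t ht), add_comm]
    rw [hΓ n _ hst, hΓ n _ hs, hΓ n _ ht, add_div, hadd _ _ (hdiv n t ht) (hdiv n s hs),
      hcomm.mul_pow]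
  · have e1 : tderiv 𝕜 𝕜 E Γ 0 1 = tderiv 𝕜 𝕜 E γ 0 1 := by rw [tderiv_congr hloc]
    refine e1.trans ?_
    rw [(h 0 (by simpa using hR)).2, h0, orbitDeriv_one]
    rfl

end OneParameterSubgroups

end DrinfeldPoisson

/-! ### Parametrizations of connected subgroups -/

namespace DrinfeldPoisson

section TangentMaps

variable {𝕜 : Type*} [RCLike 𝕜] {E : Type*} [NormedAddCommGroup E] [NormedSpace 𝕜 E]
  {D : Type*} [TopologicalSpace D] [ChartedSpace E D] [Group D]
  {P : Type*} [NormedAddCommGroup P] [NormedSpace 𝕜 P]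
  {P' : Type*} [NormedAddCommGroup P'] [NormedSpace 𝕜 P']

/-- A smooth map from a vector space into the connected subgroup with Lie algebra `u` which is
tangent to the right translates of `u`. -/
structure IsTangentMap (u : Submodule 𝕜 E) (f : P → D) : Prop where
  contMDiff : ContMDiff 𝓘(𝕜, P) 𝓘(𝕜, E) ∞ f
  mem : ∀ s, f s ∈ connectedSubgroup (D := D) (E := E) u
  tangent : ∀ s a, ∃ X ∈ u, tderiv 𝕜 P E f s a = orbitDeriv 𝕜 E E D (f s) X

variable {u : Submodule 𝕜 E}

lemma IsTangentMap.mdiff {f : P → D} (hf : IsTangentMap u f) (s : P) :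
    MDifferentiableAt 𝓘(𝕜, P) 𝓘(𝕜, E) f s := (hf.contMDiff s).mdifferentiableAt (by simp)

lemma IsTangentMap.comp_clm {f : P → D} (hf : IsTangentMap u f) (A : P' →L[𝕜] P) :
    IsTangentMap u (fun s => f (A s)) where
  contMDiff := hf.contMDiff.comp A.contDiff.contMDiff
  mem s := hf.mem _
  tangent s a := by
    rw [tderiv_comp_apply (g := f) (f := A) (hf.mdiff _) A.differentiableAt.mdifferentiableAt]
    exact hf.tangent _ _

lemma isTangentMap_one : IsTangentMap u (fun _ : P => (1 : D)) where
  contMDiff := contMDiff_const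
  mem _ := one_mem _
  tangent s a := ⟨0, u.zero_mem, by rw [tderiv_const]; simp⟩

variable [LieGroup 𝓘(𝕜, E) ∞ D]

lemma IsOneParameterSubgroup.comp_mul {γ : 𝕜 → D} {X : E}
    (h : IsOneParameterSubgroup (E := E) γ X) (c : 𝕜) :
    IsOneParameterSubgroup (E := E) (fun t => γ (t * c)) (c • X) where
  contMDiff := h.contMDiff.comp (contDiff_id.mul contDiff_const).contMDiff
  map_add s t := by rw [add_mul, h.map_add]
  velocity := by
    have hd : DifferentiableAt 𝕜 (fun t : 𝕜 => t * c) 0 := differentiableAt_id.mul_const c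
    have e := tderiv_comp_apply (𝕜 := 𝕜) (E := 𝕜) (F := 𝕜) (G := E) (g := γ)
      (f := fun t : 𝕜 => t * c) (x := 0) (h.mdiff _) hd.mdifferentiableAt 1
    refine Eq.trans e ?_
    have e2 : fderiv 𝕜 (fun t : 𝕜 => t * c) 0 1 = c • (1 : 𝕜) := by simp
    rw [tderiv_eq_fderiv, e2, map_smul, h.tderiv_eq, zero_mul, h.map_zero, orbitDeriv_one]
    rfl

lemma IsOneParameterSubgroup.mem_connectedSubgroup {γ : 𝕜 → D} {X : E}
    (h : IsOneParameterSubgroup (E := E) γ X) (hX : X ∈ u) (t : 𝕜) :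
    γ t ∈ connectedSubgroup (D := D) (E := E) u :=
  Subgroup.subset_closure ⟨t • X, u.smul_mem t hX, _, h.comp_mul t, by simp⟩

lemma IsOneParameterSubgroup.isTangentMap {γ : 𝕜 → D} {X : E}
    (h : IsOneParameterSubgroup (E := E) γ X) (hX : X ∈ u) : IsTangentMap u γ where
  contMDiff := h.contMDiff
  mem := h.mem_connectedSubgroup hX
  tangent s a := ⟨a • X, u.smul_mem a hX, by
    rw [map_smul, ← h.tderiv_eq, ← map_smul, smul_eq_mul, mul_one]⟩

lemma tderiv_mul_of_eq_one {f g : P → D} {s : P} (hf : MDifferentiableAt 𝓘(𝕜, P) 𝓘(𝕜, E) f s)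
    (hg : MDifferentiableAt 𝓘(𝕜, P) 𝓘(𝕜, E) g s) (hf1 : f s = 1) (hg1 : g s = 1) (a : P) :
    tderiv 𝕜 P E (fun s => f s * g s) s a = tderiv 𝕜 P E f s a + tderiv 𝕜 P E g s a := by
  have h := (smoothAction_self (𝕜 := 𝕜) (E := E) (D := D)).tderiv_smul_orbitDeriv hf hg
    (v := a) (X := tderiv 𝕜 P E f s a) (Y := tderiv 𝕜 P E g s a)
    (by rw [hf1, orbitDeriv_one]; rfl) (by rw [hg1, orbitDeriv_one]; rfl)
  rw [hf1, hg1, smul_eq_mul, one_mul, orbitDeriv_one, adDeriv_one] at h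
  exact h

variable [FiniteDimensional 𝕜 E] [CompleteSpace E]

lemma IsTangentMap.mul (hu : ∀ v ∈ u, ∀ w ∈ u, modelBracket 𝕜 D v w ∈ u) {f g : P → D}
    (hf : IsTangentMap u f) (hg : IsTangentMap u g) : IsTangentMap u (fun s => f s * g s) where
  contMDiff := hf.contMDiff.mul hg.contMDiff
  mem s := mul_mem (hf.mem s) (hg.mem s)
  tangent s a := by
    obtain ⟨X, hX, hX'⟩ := hf.tangent s a
    obtain ⟨Y, hY, hY'⟩ := hg.tangent s a
    exact ⟨_, u.add_mem hX (adDeriv_mem_of_mem_connectedSubgroup hu (hf.mem s) hY),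
      (smoothAction_self (𝕜 := 𝕜) (E := E) (D := D)).tderiv_smul_orbitDeriv (hf.mdiff s)
        (hg.mdiff s) hX' hY'⟩

lemma IsTangentMap.list_prod (hu : ∀ v ∈ u, ∀ w ∈ u, modelBracket 𝕜 D v w ∈ u) {k : ℕ}
    {f : Fin k → P → D} (hf : ∀ i, IsTangentMap u (f i)) :
    IsTangentMap u (fun s => (List.ofFn fun i => f i s).prod) := by
  induction k with
  | zero => simpa using isTangentMap_one
  | succ k ih =>
    simp only [List.ofFn_succ, List.prod_cons]
    exact (hf 0).mul hu (ih fun i => hf i.succ)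

lemma tderiv_list_prod (hu : ∀ v ∈ u, ∀ w ∈ u, modelBracket 𝕜 D v w ∈ u) {k : ℕ}
    {f : Fin k → P → D} (hf : ∀ i, IsTangentMap u (f i)) {s : P} (h1 : ∀ i, f i s = 1) (a : P) :
    (List.ofFn fun i => f i s).prod = 1 ∧
      tderiv 𝕜 P E (fun s => (List.ofFn fun i => f i s).prod) s a =
        ∑ i, tderiv 𝕜 P E (f i) s a := by
  induction k with
  | zero => simp [tderiv_const]
  | succ k ih =>
    obtain ⟨e1, e2⟩ := ih (fun i => hf i.succ) (fun i => h1 i.succ)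
    simp only [List.ofFn_succ, List.prod_cons, Fin.sum_univ_succ]
    refine ⟨by rw [h1, e1, one_mul], ?_⟩
    rw [tderiv_mul_of_eq_one ((hf 0).mdiff s)
      ((IsTangentMap.list_prod hu fun i => hf i.succ).mdiff s) (h1 0) e1, e2]

/-- Coordinates of the second kind: products of one-parameter subgroups parametrize the
connected subgroup of `u` near `1`. -/
lemma exists_isTangentMap (hu : ∀ v ∈ u, ∀ w ∈ u, modelBracket 𝕜 D v w ∈ u) :
    ∃ f : u → D, IsTangentMap u f ∧ f 0 = 1 ∧ ∀ a : u, tderiv 𝕜 u E f 0 a = a := by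
  have hex : ∀ X : E, ∃ γ : 𝕜 → D, IsOneParameterSubgroup (E := E) γ X :=
    exists_isOneParameterSubgroup
  choose γ hγ using hex
  let b := Module.finBasis 𝕜 u
  let A : Fin (Module.finrank 𝕜 u) → u →L[𝕜] 𝕜 := fun i =>
    LinearMap.toContinuousLinearMap (b.coord i)
  let f : Fin (Module.finrank 𝕜 u) → u → D := fun i s => γ (b i) (A i s)
  have hf : ∀ i, IsTangentMap u (f i) := fun i =>
    ((hγ (b i)).isTangentMap (b i).2).comp_clm (A i)
  have h1 : ∀ i, f i 0 = 1 := fun i => by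
    simp only [f, map_zero, (hγ _).map_zero]
  refine ⟨_, IsTangentMap.list_prod hu hf, (tderiv_list_prod hu hf h1 0).1, fun a => ?_⟩
  rw [(tderiv_list_prod hu hf h1 a).2]
  have : ∀ i, tderiv 𝕜 u E (f i) 0 a = b.repr a i • (b i : E) := by
    intro i
    rw [tderiv_comp_apply (g := γ (b i)) (f := A i) ((hγ _).mdiff _)
      (A i).differentiableAt.mdifferentiableAt, tderiv_eq_fderiv, ContinuousLinearMap.fderiv,
      map_zero]
    have e : A i a = b.repr a i • (1 : 𝕜) := by simp [A]
    rw [e, map_smul, (hγ _).tderiv_eq, (hγ _).map_zero, orbitDeriv_one]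
    rfl
  simp only [this]
  have := congrArg Subtype.val (b.sum_repr a)
  rwa [Submodule.coe_sum] at this

omit [FiniteDimensional 𝕜 E] [CompleteSpace E] in
/-- Orbit maps along tangent maps are tangent to the orbits. -/
lemma SmoothAction.tderiv_tangentMap_smul {F : Type*} [NormedAddCommGroup F] [NormedSpace 𝕜 F]
    {M : Type*} [TopologicalSpace M] [ChartedSpace F M] [MulAction D M]
    (h : SmoothAction 𝕜 E F D M) {f : P → D} (hf : IsTangentMap u f) (z : M) (s a : P) :
    MDifferentiableAt 𝓘(𝕜, P) 𝓘(𝕜, F) (fun s => f s • z) s ∧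
    ∃ X ∈ u, tderiv 𝕜 P F (fun s => f s • z) s a = orbitDeriv 𝕜 E F D (f s • z) X := by
  obtain ⟨X, hX, hX'⟩ := hf.tangent s a
  refine ⟨h.mdifferentiableAt (hf.mdiff s) mdifferentiableAt_const, X, hX, ?_⟩
  rw [tderiv_comp_apply (g := fun g : D => g • z) (f := f) (h.mdiff_orbit z _) (hf.mdiff s), hX',
    h.tderiv_orbit_orbitDeriv]

end TangentMaps

end DrinfeldPoisson

/-! ### Slices -/

namespace DrinfeldPoisson

section Slices

variable {𝕜 : Type*} [RCLike 𝕜] {E : Type*} [NormedAddCommGroup E] [NormedSpace 𝕜 E]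
  {F : Type*} [NormedAddCommGroup F] [NormedSpace 𝕜 F]
  {M : Type*} [TopologicalSpace M] [ChartedSpace F M]

variable {D : Type*} [TopologicalSpace D] [ChartedSpace E D] [Group D] [LieGroup 𝓘(𝕜, E) ∞ D]
  [MulAction D M]

/-- The linear part of the slice parametrization: if `v` is a complement of the kernel of `K` and
`W` a complement of its range, then `v × W → F`, `(a, w) ↦ K a + w`, is an isomorphism. -/
lemma bijective_add_of_isCompl {U : Type*} [AddCommGroup U] [Module 𝕜 U] (K : U →ₗ[𝕜] F)
    {v : Submodule 𝕜 U} {W : Submodule 𝕜 F} (hv : IsCompl (LinearMap.ker K) v)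
    (hW : IsCompl (LinearMap.range K) W) :
    Function.Bijective (fun p : v × W => K p.1 + p.2) := by
  constructor
  · rintro ⟨a, w⟩ ⟨a', w'⟩ h
    have h' : K a + w = K a' + w' := h
    have e : K (a - a') = w' - w := by
      rw [map_sub, sub_eq_sub_iff_add_eq_add, h', add_comm]
    have h1 : K (a - a') ∈ LinearMap.range K ⊓ W :=
      ⟨⟨_, rfl⟩, by rw [e]; exact W.sub_mem w'.2 w.2⟩
    rw [hW.inf_eq_bot, Submodule.mem_bot] at h1
    have h2 : (a : U) - a' ∈ LinearMap.ker K ⊓ v := ⟨h1, v.sub_mem a.2 a'.2⟩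
    rw [hv.inf_eq_bot, Submodule.mem_bot, sub_eq_zero] at h2
    rw [e, sub_eq_zero] at h1
    ext
    · exact h2
    · exact h1.symm
  · intro y
    have hy : y ∈ LinearMap.range K ⊔ W := by rw [hW.sup_eq_top]; trivial
    obtain ⟨_, ⟨X, rfl⟩, w, hw, rfl⟩ := Submodule.mem_sup.1 hy
    have hX : X ∈ LinearMap.ker K ⊔ v := by rw [hv.sup_eq_top]; trivial
    obtain ⟨k, hk, a, ha, rfl⟩ := Submodule.mem_sup.1 hX
    refine ⟨(⟨a, ha⟩, ⟨w, hw⟩), ?_⟩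
    simp [LinearMap.mem_ker.1 hk]

variable [IsManifold 𝓘(𝕜, F) ∞ M] [FiniteDimensional 𝕜 E] [FiniteDimensional 𝕜 F]

/-- A slice for the action of the connected subgroup of `u` at `z`: near `z`, points are of the
form `f(s) σ(w)` with `σ` a transversal through `z` parametrized by a complement `W` of
`T_z (U z)`, and `η` is the coordinate `w`. -/
theorem SmoothAction.exists_slice (h : SmoothAction 𝕜 E F D M) {u : Submodule 𝕜 E} {f : u → D}
    (hf : IsTangentMap u f) (hf0 : f 0 = 1) (hf' : ∀ a : u, tderiv 𝕜 u E f 0 a = a) (z : M) :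
    ∃ (W : Submodule 𝕜 F) (η : M → W),
      Module.finrank 𝕜 (u.map (orbitDeriv 𝕜 E F D z).toLinearMap) + Module.finrank 𝕜 W =
        Module.finrank 𝕜 F ∧
      ∀ᶠ y in 𝓝 z, MDifferentiableAt 𝓘(𝕜, F) 𝓘(𝕜, W) η y ∧
        (∀ a, tderiv 𝕜 F W η y a = 0 → a ∈ u.map (orbitDeriv 𝕜 E F D y).toLinearMap) ∧
        (η y = η z → ∃ s, y = f s • z) := by
  have : IsManifold 𝓘(𝕜, F) 1 M := IsManifold.of_le (n := ∞) (by simp)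
  have : CompleteSpace F := FiniteDimensional.complete 𝕜 F
  set φ := extChartAt 𝓘(𝕜, F) z with hφ
  let K : u →ₗ[𝕜] F := (orbitDeriv 𝕜 E F D z).toLinearMap ∘ₗ u.subtype
  have hK : LinearMap.range K = u.map (orbitDeriv 𝕜 E F D z).toLinearMap := by
    rw [LinearMap.range_comp, Submodule.range_subtype]
  obtain ⟨v, hv⟩ := (LinearMap.ker K).exists_isCompl
  obtain ⟨W, hW⟩ := (LinearMap.range K).exists_isCompl
  have : CompleteSpace v := FiniteDimensional.complete 𝕜 v
  have : CompleteSpace W := FiniteDimensional.complete 𝕜 W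
  -- the slice parametrization, and its expression in the chart at `z`
  let σ : W → M := fun w => φ.symm (φ z + w)
  let g : v → D := fun a => f a
  let Ψ : v × W → M := fun p => g p.1 • σ p.2
  have hzt : φ z ∈ φ.target := mem_extChartAt_target (I := 𝓘(𝕜, F)) z
  have hσ0 : σ 0 = z := by
    change φ.symm (φ z + 0) = z
    rw [add_zero]
    exact extChartAt_to_inv (I := 𝓘(𝕜, F)) z
  have hg0 : g 0 = 1 := hf0
  have hΨ0 : Ψ 0 = z := by
    change g 0 • σ 0 = z
    rw [hg0, hσ0, one_smul]
  have hgt : IsTangentMap u g := hf.comp_clm v.subtypeL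
  have hσc : ∀ w : W, φ z + w ∈ φ.target → ContMDiffAt 𝓘(𝕜, W) 𝓘(𝕜, F) ∞ σ w := by
    intro w hw
    have ha : ContMDiffAt 𝓘(𝕜, W) 𝓘(𝕜, F) ∞ (fun w : W => φ z + w) w :=
      (contDiff_const.add W.subtypeL.contDiff).contMDiff.contMDiffAt
    exact ContMDiffAt.comp (g := φ.symm) w (contMDiffAt_extChartAt_symm hw) ha
  have hσ0c : ContMDiffAt 𝓘(𝕜, W) 𝓘(𝕜, F) ∞ σ 0 := hσc 0 (by simpa using hzt)
  have hσ0' : ∀ w : W, tderiv 𝕜 W F σ 0 w = w := by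
    intro w
    have ha : DifferentiableAt 𝕜 (fun w : W => φ z + w) 0 :=
      (differentiableAt_const _).add W.subtypeL.differentiableAt
    have e0 : φ z + ((0 : W) : F) = φ z := by simp
    have e := tderiv_comp_apply (𝕜 := 𝕜) (E := W) (F := F) (G := F) (g := φ.symm)
      (f := fun w : W => φ z + w) (x := 0)
      ((contMDiffAt_extChartAt_symm (by rw [e0]; exact hzt)).mdifferentiableAt (by simp))
      ha.mdifferentiableAt w
    refine e.trans ?_
    rw [e0, tderiv_extChartAt_symm_self, tderiv_eq_fderiv, fderiv_const_add]
    exact congrArg (fun A : W →L[𝕜] F => A w) (W.subtypeL.fderiv (x := 0))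
  have hfst : ContMDiffAt 𝓘(𝕜, v × W) 𝓘(𝕜, v) ∞ (Prod.fst : v × W → v) 0 :=
    contDiff_fst.contMDiff.contMDiffAt
  have hsnd : ContMDiffAt 𝓘(𝕜, v × W) 𝓘(𝕜, W) ∞ (Prod.snd : v × W → W) 0 :=
    contDiff_snd.contMDiff.contMDiffAt
  have hc1 : ContMDiffAt 𝓘(𝕜, v × W) 𝓘(𝕜, E) ∞ (fun p : v × W => g p.1) 0 :=
    ContMDiffAt.comp (g := g) (0 : v × W) (hgt.contMDiff _) hfst
  have hc2 : ContMDiffAt 𝓘(𝕜, v × W) 𝓘(𝕜, F) ∞ (fun p : v × W => σ p.2) 0 :=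
    ContMDiffAt.comp (g := σ) (0 : v × W) hσ0c hsnd
  have hΨc : ContMDiffAt 𝓘(𝕜, v × W) 𝓘(𝕜, F) ∞ Ψ 0 := h.contMDiffAt le_rfl hc1 hc2
  have hφz : ContMDiffAt 𝓘(𝕜, F) 𝓘(𝕜, F) ∞ φ (Ψ 0) := by
    rw [hΨ0]; exact contMDiffAt_extChartAt
  have hψc : ContDiffAt 𝕜 ∞ (fun p => φ (Ψ p)) 0 :=
    contMDiffAt_iff_contDiffAt.1 (ContMDiffAt.comp (g := φ) (0 : v × W) hφz hΨc)
  let L : (v × W) ≃L[𝕜] F := (LinearEquiv.ofBijective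
    ((K ∘ₗ v.subtype).coprod W.subtype) (bijective_add_of_isCompl K hv hW)).toContinuousLinearEquiv
  have hL : HasFDerivAt (fun p => φ (Ψ p)) (L : (v × W) →L[𝕜] F) 0 := by
    have hd := (hψc.differentiableAt (by simp)).hasFDerivAt
    refine hd.congr_fderiv (ContinuousLinearMap.ext fun p => ?_)
    have m1 : MDifferentiableAt 𝓘(𝕜, v × W) 𝓘(𝕜, E) (fun p : v × W => g p.1) 0 :=
      hc1.mdifferentiableAt (by simp)
    have m2 : MDifferentiableAt 𝓘(𝕜, v × W) 𝓘(𝕜, F) (fun p : v × W => σ p.2) 0 :=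
      hc2.mdifferentiableAt (by simp)
    have d1 : tderiv 𝕜 (v × W) E (fun p : v × W => g p.1) 0 p = ((p.1 : u) : E) := by
      rw [tderiv_comp_apply (g := f) (f := fun p : v × W => (p.1 : u)) (hf.mdiff _)
        (v.subtypeL.comp (ContinuousLinearMap.fst 𝕜 v W)).differentiableAt.mdifferentiableAt,
        tderiv_eq_fderiv]
      exact (congrArg (fun A : (v × W) →L[𝕜] u => tderiv 𝕜 u E f 0 (A p))
        (v.subtypeL.comp (ContinuousLinearMap.fst 𝕜 v W)).fderiv).trans (hf' _)
    have d2 : tderiv 𝕜 (v × W) F (fun p : v × W => σ p.2) 0 p = (p.2 : F) := by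
      rw [tderiv_comp_apply (g := σ) (f := fun p : v × W => p.2) (hσ0c.mdifferentiableAt (by simp))
        (ContinuousLinearMap.snd 𝕜 v W).differentiableAt.mdifferentiableAt, tderiv_eq_fderiv]
      exact (congrArg (fun A : (v × W) →L[𝕜] W => tderiv 𝕜 W F σ 0 (A p))
        (ContinuousLinearMap.snd 𝕜 v W).fderiv).trans (hσ0' _)
    have d3 : tderiv 𝕜 (v × W) F Ψ 0 p = orbitDeriv 𝕜 E F D z ((p.1 : u) : E) + (p.2 : F) := by
      refine (h.tderiv_smul m1 m2 p).trans ?_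
      rw [d1, d2]
      change tderiv 𝕜 E F (fun k : D => k • σ 0) (g 0) _ +
        tderiv 𝕜 F F (fun y : M => g 0 • y) (σ 0) _ = _
      rw [hσ0, hg0]
      simp only [one_smul, tderiv_id]
      rfl
    have d4 := tderiv_comp_apply (𝕜 := 𝕜) (E := v × W) (F := F) (G := F) (g := φ) (f := Ψ) (x := 0)
      (hφz.mdifferentiableAt (by simp)) (hΨc.mdifferentiableAt (by simp)) p
    rw [tderiv_eq_fderiv, hΨ0, tderiv_extChartAt_self, d3] at d4
    exact d4
  -- the local inverse
  let e := hψc.toOpenPartialHomeomorph (fun p => φ (Ψ p)) hL (by simp)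
  have he : ∀ p, e p = φ (Ψ p) := fun p => rfl
  have he0 : (0 : v × W) ∈ e.source := hψc.mem_toOpenPartialHomeomorph_source hL (by simp)
  have hez : φ z ∈ e.target := by
    have := e.map_source he0
    rwa [he, hΨ0] at this
  have hes : e.symm (φ z) = 0 := by
    have := e.left_inv he0
    rwa [he, hΨ0] at this
  have hec : ContDiffAt 𝕜 1 e.symm (φ z) := by
    have := hψc.to_localInverse hL (by simp)
    simp only [hΨ0] at this
    exact this.of_le (by simp)
  refine ⟨W, fun y => (e.symm (φ y)).2, ?_, ?_⟩
  · rw [← hK]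
    exact Submodule.finrank_add_eq_of_isCompl hW
  have hφc : Filter.Tendsto φ (𝓝 z) (𝓝 (φ z)) := continuousAt_extChartAt z
  have hec' : Filter.Tendsto (fun y => e.symm (φ y)) (𝓝 z) (𝓝 0) := by
    have : Filter.Tendsto e.symm (𝓝 (φ z)) (𝓝 0) := by
      have := hec.continuousAt
      rwa [ContinuousAt, hes] at this
    exact this.comp hφc
  have hΨ1 : ∀ᶠ p in 𝓝 (0 : v × W), Ψ p ∈ φ.source := by
    have := hΨc.continuousAt
    rw [ContinuousAt, hΨ0] at this
    exact this.eventually_mem (extChartAt_source_mem_nhds z)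
  have hσ1 : ∀ᶠ p in 𝓝 (0 : v × W), φ z + p.2 ∈ φ.target := by
    have hcont : Filter.Tendsto (fun p : v × W => φ z + (p.2 : F)) (𝓝 0) (𝓝 (φ z)) := by
      have : Continuous (fun p : v × W => φ z + (p.2 : F)) := by fun_prop
      have := this.tendsto 0
      simpa using this
    exact hcont.eventually_mem (extChartAt_target_mem_nhds z)
  have hinv : ∀ᶠ y in 𝓝 z, Ψ (e.symm (φ y)) = y := by
    filter_upwards [hφc.eventually_mem (e.open_target.mem_nhds hez), hec'.eventually hΨ1,
      extChartAt_source_mem_nhds (I := 𝓘(𝕜, F)) z] with y h1 h2 h3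
    have := e.right_inv h1
    rw [he] at this
    exact φ.injOn h2 h3 this
  have hsm : ∀ᶠ y in 𝓝 z, MDifferentiableAt 𝓘(𝕜, F) 𝓘(𝕜, v × W) (fun y => e.symm (φ y)) y := by
    have h1 : ∀ᶠ y in 𝓝 (φ z), ContDiffAt 𝕜 1 e.symm y := hec.eventually (by simp)
    filter_upwards [hφc.eventually h1, extChartAt_source_mem_nhds (I := 𝓘(𝕜, F)) z] with y h1 h3
    have h2 : MDifferentiableAt 𝓘(𝕜, F) 𝓘(𝕜, F) φ y :=
      mdifferentiableAt_extChartAt (by rwa [extChartAt_source] at h3)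
    exact MDifferentiableAt.comp (g := e.symm) y
      (h1.differentiableAt one_ne_zero).mdifferentiableAt h2
  filter_upwards [hinv.eventually_nhds, hsm, hec'.eventually hσ1] with y h1 h2 h3
  have m1 : MDifferentiableAt 𝓘(𝕜, F) 𝓘(𝕜, v) (fun y => (e.symm (φ y)).1) y :=
    MDifferentiableAt.comp (g := (Prod.fst : v × W → v)) y
      (differentiableAt_fst.mdifferentiableAt) h2
  have m2 : MDifferentiableAt 𝓘(𝕜, F) 𝓘(𝕜, W) (fun y => (e.symm (φ y)).2) y :=
    MDifferentiableAt.comp (g := (Prod.snd : v × W → W)) y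
      (differentiableAt_snd.mdifferentiableAt) h2
  refine ⟨m2, fun a ha => ?_, fun hy => ?_⟩
  · -- differentiate `y = g(a) σ(w)`; the second factor does not contribute, as `w' = 0`
    have m3 : MDifferentiableAt 𝓘(𝕜, F) 𝓘(𝕜, E) (fun y => g (e.symm (φ y)).1) y :=
      MDifferentiableAt.comp (g := g) y (hgt.mdiff _) m1
    have mσ := (hσc _ h3).mdifferentiableAt (by simp)
    have m4 : MDifferentiableAt 𝓘(𝕜, F) 𝓘(𝕜, F) (fun y => σ (e.symm (φ y)).2) y :=
      MDifferentiableAt.comp (g := σ) y mσ m2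
    have e1 : tderiv 𝕜 F F (fun y => Ψ (e.symm (φ y))) y a = a := by
      rw [tderiv_congr (g := fun y => y) h1, tderiv_id]; rfl
    have e2 := h.tderiv_smul m3 m4 a
    obtain ⟨X, hX, hX'⟩ := hgt.tangent (e.symm (φ y)).1
      (tderiv 𝕜 F v (fun y => (e.symm (φ y)).1) y a)
    rw [tderiv_comp_apply (g := σ) (f := fun y => (e.symm (φ y)).2) mσ m2, ha, map_zero, map_zero,
      add_zero, tderiv_comp_apply (g := g) (f := fun y => (e.symm (φ y)).1) (hgt.mdiff _) m1, hX',
      h.tderiv_orbit_orbitDeriv] at e2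
    refine ⟨X, hX, ?_⟩
    rw [← e1]
    refine Eq.trans ?_ e2.symm
    have := h1.self_of_nhds
    conv_lhs => rw [← this]
    rfl
  · refine ⟨(e.symm (φ y)).1, ?_⟩
    have h4 := h1.self_of_nhds
    simp only [hes] at hy
    conv_lhs => rw [← h4]
    change g (e.symm (φ y)).1 • σ (e.symm (φ y)).2 = _
    rw [hy]
    change g (e.symm (φ y)).1 • σ 0 = _
    rw [hσ0]

end Slices

end DrinfeldPoisson

/-! ### Curves in orbits -/

namespace DrinfeldPoisson

section Orbits

variable {𝕜 : Type*} [RCLike 𝕜] {E : Type*} [NormedAddCommGroup E] [NormedSpace 𝕜 E]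
  {F : Type*} [NormedAddCommGroup F] [NormedSpace 𝕜 F]
  {M : Type*} [TopologicalSpace M] [ChartedSpace F M]
  {D : Type*} [TopologicalSpace D] [ChartedSpace E D] [Group D] [LieGroup 𝓘(𝕜, E) ∞ D]
  [MulAction D M] [FiniteDimensional 𝕜 E] [CompleteSpace E]

lemma map_adDeriv_eq {u : Submodule 𝕜 E} (hu : ∀ v ∈ u, ∀ w ∈ u, modelBracket 𝕜 D v w ∈ u) {g : D}
    (hg : g ∈ connectedSubgroup (D := D) (E := E) u) : u.map (adDeriv 𝕜 E g).toLinearMap = u := by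
  apply Submodule.eq_of_le_of_finrank_eq
  · rintro _ ⟨z, hz, rfl⟩
    exact adDeriv_mem_of_mem_connectedSubgroup hu hg hz
  · exact (Submodule.equivMapOfInjective _ (adDeriv_injective g) u).finrank_eq.symm

/-- The spaces `κ_z(u)` have constant dimension along the orbits of the connected subgroup
of `u`. -/
lemma SmoothAction.finrank_map_orbitDeriv_smul (h : SmoothAction 𝕜 E F D M) {u : Submodule 𝕜 E}
    (hu : ∀ v ∈ u, ∀ w ∈ u, modelBracket 𝕜 D v w ∈ u) {g : D}
    (hg : g ∈ connectedSubgroup (D := D) (E := E) u) (z : M) :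
    Module.finrank 𝕜 (u.map (orbitDeriv 𝕜 E F D (g • z)).toLinearMap) =
      Module.finrank 𝕜 (u.map (orbitDeriv 𝕜 E F D z).toLinearMap) := by
  have e : (tderiv 𝕜 F F (fun z : M => g • z) z).toLinearMap ∘ₗ (orbitDeriv 𝕜 E F D z).toLinearMap =
      (orbitDeriv 𝕜 E F D (g • z)).toLinearMap ∘ₗ (adDeriv 𝕜 E g).toLinearMap := by
    ext X
    exact h.tderiv_translation_orbitDeriv g z X
  have e2 := congrArg (fun A => u.map A) e
  simp only [Submodule.map_comp, map_adDeriv_eq hu hg] at e2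
  rw [← e2]
  exact (Submodule.equivMapOfInjective _ (h.tderiv_translation_injective g z) _).finrank_eq.symm

lemma countable_image_of_eventually_eq {X Y : Type*} [TopologicalSpace X]
    [SecondCountableTopology X] {V : Set X} {φ : X → Y}
    (h : ∀ x ∈ V, ∀ᶠ x' in 𝓝[V] x, φ x' = φ x) : (φ '' V).Countable := by
  obtain ⟨t, htV, htc, ht⟩ :=
    TopologicalSpace.countable_cover_nhdsWithin (f := fun x => {x' | φ x' = φ x}) h
  refine (htc.image φ).mono ?_
  rintro _ ⟨x, hx, rfl⟩
  obtain ⟨y, hy, hxy⟩ := Set.mem_iUnion₂.1 (ht hx)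
  exact ⟨y, hy, hxy.symm⟩

lemma IsPreconnected.eq_of_countable {Y : Type*} [MetricSpace Y] {s : Set Y} (hs : IsPreconnected s)
    (hc : s.Countable) {x y : Y} (hx : x ∈ s) (hy : y ∈ s) : x = y :=
  hc.isTotallyDisconnected s subset_rfl hs hx hy

variable [IsManifold 𝓘(𝕜, F) ∞ M] [FiniteDimensional 𝕜 F]

omit [CompleteSpace E] in
/-- On the orbit, the kernel of the derivative of the slice coordinate is exactly the tangent space
of the orbit. -/
lemma SmoothAction.exists_slice_tderiv_eq_zero_iff (h : SmoothAction 𝕜 E F D M)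
    {u : Submodule 𝕜 E} {f : u → D}
    (hf : IsTangentMap u f) (hf0 : f 0 = 1) (hf' : ∀ a : u, tderiv 𝕜 u E f 0 a = a) (z : M) :
    ∃ (W : Submodule 𝕜 F) (η : M → W), ∀ᶠ y in 𝓝 z,
      MDifferentiableAt 𝓘(𝕜, F) 𝓘(𝕜, W) η y ∧
      (Module.finrank 𝕜 (u.map (orbitDeriv 𝕜 E F D y).toLinearMap) =
        Module.finrank 𝕜 (u.map (orbitDeriv 𝕜 E F D z).toLinearMap) →
        ∀ a, tderiv 𝕜 F W η y a = 0 ↔ a ∈ u.map (orbitDeriv 𝕜 E F D y).toLinearMap) ∧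
      (η y = η z → ∃ s, y = f s • z) := by
  obtain ⟨W, η, hW, hη⟩ := h.exists_slice hf hf0 hf' z
  refine ⟨W, η, ?_⟩
  filter_upwards [hη] with y ⟨h1, h2, h3⟩
  refine ⟨h1, fun hfr a => ?_, h3⟩
  have hle : LinearMap.ker (tderiv 𝕜 F W η y).toLinearMap ≤
      u.map (orbitDeriv 𝕜 E F D y).toLinearMap := fun a ha => h2 a ha
  have e := (tderiv 𝕜 F W η y).toLinearMap.finrank_range_add_finrank_ker
  have e2 := Submodule.finrank_le (LinearMap.range (tderiv 𝕜 F W η y).toLinearMap)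
  have := Submodule.eq_of_le_of_finrank_le hle (by omega)
  rw [← this]
  rfl

/-- The connected subgroup of `u` is generated by the values of a parametrization near `1`. -/
lemma exists_list_of_mem_connectedSubgroup {u : Submodule 𝕜 E}
    (hu : ∀ v ∈ u, ∀ w ∈ u, modelBracket 𝕜 D v w ∈ u) {f : u → D}
    (hf : IsTangentMap u f) (hf0 : f 0 = 1) (hf' : ∀ a : u, tderiv 𝕜 u E f 0 a = a) {g : D}
    (hg : g ∈ connectedSubgroup (D := D) (E := E) u) : ∃ l : List u, g = (l.map f).prod := by
  have hact := smoothAction_self (𝕜 := 𝕜) (E := E) (D := D)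
  have key : ∀ (γ : 𝕜 → D), ∀ X ∈ u, IsOneParameterSubgroup (E := E) γ X → ∀ t : 𝕜,
      ∃ l : List u, γ t = (l.map f).prod := by
    intro γ X hX hγ t
    obtain ⟨W, η, hη⟩ := hact.exists_slice_tderiv_eq_zero_iff hf hf0 hf' (1 : D)
    have hc : Filter.Tendsto γ (𝓝 0) (𝓝 1) := by
      have := (hγ.contMDiff 0).continuousAt
      rwa [ContinuousAt, hγ.map_zero] at this
    obtain ⟨r, hr, hball⟩ := Metric.eventually_nhds_iff_ball.1 (hc.eventually hη)
    have hsmall : ∀ s ∈ Metric.ball (0 : 𝕜) r, ∃ a : u, γ s = f a := by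
      intro s hs
      have hconst := eqOn_of_tderiv_eq_zero (𝕜 := 𝕜) (E := 𝕜) (F := W)
        (f := fun t => η (γ t)) (s := Metric.ball (0 : 𝕜) r) Metric.isOpen_ball
        (by
          let _ : NormedSpace ℝ 𝕜 := NormedSpace.restrictScalars ℝ 𝕜 𝕜
          exact (convex_ball (0 : 𝕜) r).isPreconnected) (x := s) (y := 0) ?_ hs (by simpa using hr)
      · simp only [hγ.map_zero] at hconst
        obtain ⟨a, ha⟩ := (hball s hs).2.2 hconst
        exact ⟨a, by simpa using ha⟩
      · intro t ht
        obtain ⟨h1, h2, -⟩ := hball t ht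
        refine ⟨MDifferentiableAt.comp (g := η) t h1 (hγ.mdiff t), ?_⟩
        ext
        rw [tderiv_comp_apply (g := η) (f := γ) h1 (hγ.mdiff t), hγ.tderiv_eq]
        refine congrArg Subtype.val ((h2 ?_ _).2 ⟨X, hX, rfl⟩)
        have := hact.finrank_map_orbitDeriv_smul hu (hγ.mem_connectedSubgroup hX t) 1
        rwa [smul_eq_mul, mul_one] at this
    obtain ⟨n, hn⟩ := exists_nat_gt (‖t‖ / r)
    have hn0 : 0 < (n : ℝ) := lt_of_le_of_lt (by positivity) hn
    have hn1 : (n : 𝕜) ≠ 0 := by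
      have : n ≠ 0 := by rintro rfl; simp at hn0
      exact_mod_cast this
    obtain ⟨a, ha⟩ := hsmall (t / n) (by
      rw [mem_ball_zero_iff, norm_div, RCLike.norm_natCast, div_lt_iff₀ hn0, mul_comm]
      exact (div_lt_iff₀ hr).1 hn)
    refine ⟨List.replicate n a, ?_⟩
    rw [List.map_replicate, List.prod_replicate, ← ha, ← hγ.map_nsmul, mul_div_cancel₀ _ hn1]
  have main : (∃ l : List u, g = (l.map f).prod) ∧ ∃ l : List u, g⁻¹ = (l.map f).prod := by
    induction hg using Subgroup.closure_induction with
    | mem g hg =>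
      obtain ⟨X, hX, γ, hγ, rfl⟩ := hg
      exact ⟨key γ X hX hγ 1, by rw [← hγ.map_neg]; exact key γ X hX hγ (-1)⟩
    | one => exact ⟨⟨[], rfl⟩, ⟨[], inv_one⟩⟩
    | mul a b _ _ ha hb =>
      obtain ⟨⟨l, rfl⟩, ⟨l', hl'⟩⟩ := ha
      obtain ⟨⟨m, rfl⟩, ⟨m', hm'⟩⟩ := hb
      exact ⟨⟨l ++ m, by simp⟩, ⟨m' ++ l', by rw [mul_inv_rev, hl', hm']; simp⟩⟩
    | inv a _ ha => exact ⟨ha.2, by rw [inv_inv]; exact ha.1⟩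
  exact main.1

omit [FiniteDimensional 𝕜 F] in
/-- The slice coordinate takes only countably many values on an orbit: the orbit is covered by
countably many smooth families of words in the parametrization, and the slice coordinate is locally
constant along each of them. -/
lemma SmoothAction.countable_slice_image (h : SmoothAction 𝕜 E F D M) {u : Submodule 𝕜 E}
    (hu : ∀ v ∈ u, ∀ w ∈ u, modelBracket 𝕜 D v w ∈ u) {f : u → D}
    (hf : IsTangentMap u f) (hf0 : f 0 = 1) (hf' : ∀ a : u, tderiv 𝕜 u E f 0 a = a) (z : M)
    {W : Submodule 𝕜 F} {η : M → W} {N : Set M} (hN : IsOpen N)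
    (hη : ∀ y ∈ N, MDifferentiableAt 𝓘(𝕜, F) 𝓘(𝕜, W) η y ∧
      (Module.finrank 𝕜 (u.map (orbitDeriv 𝕜 E F D y).toLinearMap) =
        Module.finrank 𝕜 (u.map (orbitDeriv 𝕜 E F D z).toLinearMap) →
        ∀ a, tderiv 𝕜 F W η y a = 0 ↔ a ∈ u.map (orbitDeriv 𝕜 E F D y).toLinearMap)) :
    (η '' (N ∩ MulAction.orbit (connectedSubgroup (D := D) (E := E) u) z)).Countable := by
  have : IsManifold 𝓘(𝕜, F) 1 M := IsManifold.of_le (n := ∞) (by simp)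
  let w : (k : ℕ) → (Fin k → u) → D := fun k s => (List.ofFn fun i => f (s i)).prod
  have hw : ∀ k, IsTangentMap u (w k) := fun k =>
    IsTangentMap.list_prod hu fun i =>
      hf.comp_clm (ContinuousLinearMap.proj (R := 𝕜) (φ := fun _ : Fin k => u) i)
  have hsub : η '' (N ∩ MulAction.orbit (connectedSubgroup (D := D) (E := E) u) z) ⊆
      ⋃ k, (fun s => η (w k s • z)) '' {s | w k s • z ∈ N} := by
    rintro _ ⟨_, ⟨hy, ⟨g, hg⟩, rfl⟩, rfl⟩
    obtain ⟨l, rfl⟩ := exists_list_of_mem_connectedSubgroup hu hf hf0 hf' hg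
    have e : w l.length (fun i => l.get i) = (l.map f).prod := by
      change (List.ofFn (f ∘ l.get)).prod = _
      rw [← List.map_ofFn, List.ofFn_get]
    refine Set.mem_iUnion.2 ⟨l.length, fun i => l.get i, ?_, ?_⟩
    · change w l.length _ • z ∈ N
      rw [e]; exact hy
    · change η (w l.length _ • z) = _
      rw [e]; rfl
  refine (Set.countable_iUnion fun k => ?_).mono hsub
  have : ProperSpace (Fin k → u) := FiniteDimensional.proper_rclike 𝕜 _
  refine countable_image_of_eventually_eq fun s hs =>
    Filter.Eventually.filter_mono nhdsWithin_le_nhds (eventually_eq_of_tderiv_eq_zero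
      (𝕜 := 𝕜) (E := Fin k → u) (F := W) (f := fun s => η (w k s • z)) ?_)
  have hd := fun s a => h.tderiv_tangentMap_smul (hw k) z s a
  have hop : ∀ᶠ s' in 𝓝 s, w k s' • z ∈ N :=
    (hd s 0).1.continuousAt.eventually_mem (hN.mem_nhds hs)
  filter_upwards [hop] with s' hs'
  obtain ⟨h1, h2⟩ := hη _ hs'
  refine ⟨MDifferentiableAt.comp (g := η) s' h1 (hd s' 0).1, ?_⟩
  refine ContinuousLinearMap.ext fun a => ?_
  rw [tderiv_comp_apply (g := η) (f := fun s => w k s • z) h1 (hd s' 0).1]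
  obtain ⟨X, hX, hX'⟩ := (hd s' a).2
  rw [hX']
  exact (h2 (h.finrank_map_orbitDeriv_smul hu ((hw k).mem s') z) _).2 ⟨X, hX, rfl⟩

/-- Smooth curves in an orbit of the connected subgroup of `u` are tangent to `κ(u)`. -/
theorem SmoothAction.tderiv_mem_of_eventually_mem_orbit (h : SmoothAction 𝕜 E F D M)
    {u : Submodule 𝕜 E} (hu : ∀ v ∈ u, ∀ w ∈ u, modelBracket 𝕜 D v w ∈ u) {c : 𝕜 → M}
    (hc : ContMDiffAt 𝓘(𝕜, 𝕜) 𝓘(𝕜, F) ∞ c 0)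
    (hmem : ∀ᶠ t in 𝓝 (0 : 𝕜),
      c t ∈ MulAction.orbit (connectedSubgroup (D := D) (E := E) u) (c 0)) :
    tderiv 𝕜 𝕜 F c 0 1 ∈ u.map (orbitDeriv 𝕜 E F D (c 0)).toLinearMap := by
  have : IsManifold 𝓘(𝕜, F) 1 M := IsManifold.of_le (n := ∞) (by simp)
  obtain ⟨f, hf, hf0, hf'⟩ := exists_isTangentMap hu
  obtain ⟨W, η, hη⟩ := h.exists_slice_tderiv_eq_zero_iff hf hf0 hf' (c 0)
  obtain ⟨N, hNη, hN, hzN⟩ := eventually_nhds_iff.1 hη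
  have hcount := h.countable_slice_image hu hf hf0 hf' (c 0) hN
    fun y hy => ⟨(hNη y hy).1, (hNη y hy).2.1⟩
  have hc1 : ∀ᶠ t in 𝓝 (0 : 𝕜), ContMDiffAt 𝓘(𝕜, 𝕜) 𝓘(𝕜, F) 1 c t := by
    exact (contMDiffAt_iff_contMDiffAt_nhds (by simp)).1 (hc.of_le (by simp))
  obtain ⟨r, hr, hball⟩ := Metric.eventually_nhds_iff_ball.1
    (hc1.and (hmem.and (hc.continuousAt.eventually_mem (hN.mem_nhds hzN))))
  have hpre : IsPreconnected ((fun t => η (c t)) '' Metric.ball (0 : 𝕜) r) := by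
    let _ : NormedSpace ℝ 𝕜 := NormedSpace.restrictScalars ℝ 𝕜 𝕜
    refine (convex_ball (0 : 𝕜) r).isPreconnected.image _
      fun t ht => ContinuousAt.continuousWithinAt ?_
    exact ContinuousAt.comp (g := η) (hNη _ (hball t ht).2.2).1.continuousAt
      (hball t ht).1.continuousAt
  have hconst : (fun t => η (c t)) =ᶠ[𝓝 0] fun _ => η (c 0) := by
    filter_upwards [Metric.ball_mem_nhds (0 : 𝕜) hr] with t ht
    refine IsPreconnected.eq_of_countable hpre (hcount.mono ?_) ⟨t, ht, rfl⟩
      ⟨0, Metric.mem_ball_self hr, rfl⟩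
    rintro _ ⟨t, ht, rfl⟩
    exact ⟨c t, ⟨(hball t ht).2.2, (hball t ht).2.1⟩, rfl⟩
  rw [← (hNη _ hzN).2.1 rfl, ← tderiv_comp_apply (g := η) (f := c) (hNη _ hzN).1
    (hc.mdifferentiableAt (by simp)), tderiv_congr hconst, tderiv_const]
  rfl

end Orbits

end DrinfeldPoisson

/-! ### Dimensions of orbits and of their intersections -/

namespace DrinfeldPoisson

section OrbitDimension

variable {𝕜 : Type*} [RCLike 𝕜] {E : Type*} [NormedAddCommGroup E] [NormedSpace 𝕜 E]
  {F : Type*} [NormedAddCommGroup F] [NormedSpace 𝕜 F]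
  {M : Type*} [TopologicalSpace M] [ChartedSpace F M]
  {D : Type*} [TopologicalSpace D] [ChartedSpace E D] [Group D] [LieGroup 𝓘(𝕜, E) ∞ D]
  [MulAction D M] [IsManifold 𝓘(𝕜, F) ∞ M]

omit [LieGroup 𝓘(𝕜, E) ∞ D] in
lemma SmoothAction.hasFDerivAt_chart_orbit (h : SmoothAction 𝕜 E F D M)
    {u : Submodule 𝕜 E} {f : u → D}
    (hf : IsTangentMap u f) (hf0 : f 0 = 1) (hf' : ∀ a : u, tderiv 𝕜 u E f 0 a = a) (z : M) :
    ContDiffAt 𝕜 ∞ (fun s => extChartAt 𝓘(𝕜, F) z (f s • z)) 0 ∧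
    HasFDerivAt (fun s => extChartAt 𝓘(𝕜, F) z (f s • z))
      ((orbitDeriv 𝕜 E F D z).comp u.subtypeL) 0 := by
  have : IsManifold 𝓘(𝕜, F) 1 M := IsManifold.of_le (n := ∞) (by simp)
  have h0 : f 0 • z = z := by rw [hf0, one_smul]
  have h1 : ContMDiffAt 𝓘(𝕜, u) 𝓘(𝕜, F) ∞ (fun s => f s • z) 0 :=
    h.contMDiffAt le_rfl (hf.contMDiff 0) contMDiffAt_const
  have h2 : ContMDiffAt 𝓘(𝕜, F) 𝓘(𝕜, F) ∞ (extChartAt 𝓘(𝕜, F) z) (f 0 • z) := by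
    rw [h0]; exact contMDiffAt_extChartAt
  have h3 : ContDiffAt 𝕜 ∞ (fun s => extChartAt 𝓘(𝕜, F) z (f s • z)) 0 :=
    contMDiffAt_iff_contDiffAt.1 (ContMDiffAt.comp (g := extChartAt 𝓘(𝕜, F) z) 0 h2 h1)
  refine ⟨h3, (h3.differentiableAt (by simp)).hasFDerivAt.congr_fderiv ?_⟩
  refine ContinuousLinearMap.ext fun a => ?_
  rw [← tderiv_eq_fderiv, tderiv_comp_apply (g := extChartAt 𝓘(𝕜, F) z) (f := fun s => f s • z)
    (h2.mdifferentiableAt (by simp)) (h1.mdifferentiableAt (by simp)), h0, tderiv_extChartAt_self,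
    tderiv_comp_apply (g := fun g : D => g • z) (f := f) (h.mdiff_orbit z _) (hf.mdiff 0), hf', hf0]
  rfl

variable [FiniteDimensional 𝕜 E] [CompleteSpace E] [FiniteDimensional 𝕜 F]

/-- Every common tangent vector of two transversal orbits is the velocity of a curve in their
intersection: solve `f(s) z = f'(s') z` by the implicit function theorem, with prescribed
`(s, s')` to first order. -/
theorem SmoothAction.exists_curve_mem_orbit_inter (h : SmoothAction 𝕜 E F D M)
    {u u' : Submodule 𝕜 E} (hu : ∀ v ∈ u, ∀ w ∈ u, modelBracket 𝕜 D v w ∈ u)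
    (hu' : ∀ v ∈ u', ∀ w ∈ u', modelBracket 𝕜 D v w ∈ u') (z : M)
    (hsup : u.map (orbitDeriv 𝕜 E F D z).toLinearMap ⊔
      u'.map (orbitDeriv 𝕜 E F D z).toLinearMap = ⊤)
    {v : F} (hv : v ∈ u.map (orbitDeriv 𝕜 E F D z).toLinearMap)
    (hv' : v ∈ u'.map (orbitDeriv 𝕜 E F D z).toLinearMap) :
    ∃ c : 𝕜 → M, ContMDiffAt 𝓘(𝕜, 𝕜) 𝓘(𝕜, F) ∞ c 0 ∧ c 0 = z ∧
      (∀ᶠ t in 𝓝 (0 : 𝕜), c t ∈ MulAction.orbit (connectedSubgroup (D := D) (E := E) u) z ∩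
        MulAction.orbit (connectedSubgroup (D := D) (E := E) u') z) ∧
      tderiv 𝕜 𝕜 F c 0 1 = v := by
  have : CompleteSpace F := FiniteDimensional.complete 𝕜 F
  obtain ⟨f, hf, hf0, hf1⟩ := exists_isTangentMap hu
  obtain ⟨f', hf', hf0', hf1'⟩ := exists_isTangentMap hu'
  obtain ⟨c1, d1⟩ := h.hasFDerivAt_chart_orbit hf hf0 hf1 z
  obtain ⟨c2, d2⟩ := h.hasFDerivAt_chart_orbit hf' hf0' hf1' z
  obtain ⟨X, hX, hXv⟩ := hv
  obtain ⟨X', hX', hXv'⟩ := hv'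
  set φ := extChartAt 𝓘(𝕜, F) z with hφ
  set κ := orbitDeriv 𝕜 E F D z with hκ
  -- `A` is the derivative at `0` of `Φ(s, s') = φ(f(s) z) - φ(f'(s') z)`, and `R` a right inverse
  let A : u × u' →L[𝕜] F := ((κ.comp u.subtypeL).comp (ContinuousLinearMap.fst 𝕜 u u')) -
    ((κ.comp u'.subtypeL).comp (ContinuousLinearMap.snd 𝕜 u u'))
  have hA : LinearMap.range A.toLinearMap = ⊤ := by
    rw [eq_top_iff, ← hsup, sup_le_iff]
    constructor
    · rintro _ ⟨Y, hY, rfl⟩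
      exact ⟨(⟨Y, hY⟩, 0), by simp [A]⟩
    · rintro _ ⟨Y, hY, rfl⟩
      exact ⟨(0, -⟨Y, hY⟩), by simp [A]⟩
  obtain ⟨R, hR⟩ := A.toLinearMap.exists_rightInverse_of_surjective hA
  let k : u × u' := (⟨X, hX⟩, ⟨X', hX'⟩)
  have hk : A k = 0 := by
    change κ X - κ X' = 0
    exact sub_eq_zero.2 (hXv.trans hXv'.symm)
  let Λ : 𝕜 × F →L[𝕜] u × u' := (ContinuousLinearMap.fst 𝕜 𝕜 F).smulRight k +
    (LinearMap.toContinuousLinearMap R).comp (ContinuousLinearMap.snd 𝕜 𝕜 F)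
  have hΛ : ∀ p : 𝕜 × F, A (Λ p) = p.2 := by
    intro p
    change A (p.1 • k + R p.2) = p.2
    rw [map_add, map_smul, hk, smul_zero, zero_add]
    exact LinearMap.congr_fun hR p.2
  let Φ : u × u' → F := fun s => φ (f s.1 • z) - φ (f' s.2 • z)
  have hΦc : ContDiffAt 𝕜 ∞ Φ 0 :=
    (ContDiffAt.comp (g := fun s : u => φ (f s • z)) (0 : u × u') c1 contDiffAt_fst).sub
      (ContDiffAt.comp (g := fun s : u' => φ (f' s • z)) (0 : u × u') c2 contDiffAt_snd)
  have hΦd : HasFDerivAt Φ A 0 :=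
    (HasFDerivAt.comp (g := fun s : u => φ (f s • z)) (0 : u × u') d1 hasFDerivAt_fst).sub
      (HasFDerivAt.comp (g := fun s : u' => φ (f' s • z)) (0 : u × u') d2 hasFDerivAt_snd)
  have hΛ0 : Λ 0 = 0 := map_zero Λ
  -- `G` is the identity to first order, so that `t ↦ Λ (G⁻¹ (t, 0))` is a curve of solutions with
  -- velocity `k`
  let G : 𝕜 × F → 𝕜 × F := fun p => (p.1, Φ (Λ p))
  have hGc : ContDiffAt 𝕜 ∞ G 0 := by
    refine contDiffAt_fst.prodMk (ContDiffAt.comp (g := Φ) (0 : 𝕜 × F) ?_ Λ.contDiff.contDiffAt)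
    rw [hΛ0]; exact hΦc
  have hGd : HasFDerivAt G (ContinuousLinearEquiv.refl 𝕜 (𝕜 × F) : 𝕜 × F →L[𝕜] 𝕜 × F) 0 := by
    have e : HasFDerivAt (fun p => Φ (Λ p)) (A.comp Λ) 0 :=
      HasFDerivAt.comp (g := Φ) (0 : 𝕜 × F) (by rw [hΛ0]; exact hΦd) Λ.hasFDerivAt
    refine (HasFDerivAt.prodMk hasFDerivAt_fst e).congr_fderiv ?_
    refine ContinuousLinearMap.ext fun p => Prod.ext rfl (hΛ p)
  have hG0 : G 0 = 0 := by
    change (_, φ (f (Λ 0).1 • z) - φ (f' (Λ 0).2 • z)) = _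
    rw [hΛ0]
    simp [hf0, hf0']
  let e := hGc.toOpenPartialHomeomorph G hGd (by simp)
  have he0 : (0 : 𝕜 × F) ∈ e.source := hGc.mem_toOpenPartialHomeomorph_source hGd (by simp)
  have he1 : (0 : 𝕜 × F) ∈ e.target := by
    have := e.map_source he0
    rwa [show e 0 = 0 from hG0] at this
  have hes : e.symm 0 = 0 := by
    have := e.left_inv he0
    rwa [show e 0 = 0 from hG0] at this
  have hec : ContDiffAt 𝕜 ∞ e.symm 0 := by
    have := hGc.to_localInverse hGd (by simp)
    rw [hG0] at this
    exact this
  have hed : HasFDerivAt e.symm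
      ((ContinuousLinearEquiv.refl 𝕜 (𝕜 × F)).symm : 𝕜 × F →L[𝕜] 𝕜 × F) 0 :=
    e.hasFDerivAt_symm he1 (by rw [hes]; exact hGd)
  -- the curve of parameters
  let q : 𝕜 → u × u' := fun t => Λ (e.symm (t, 0))
  have hi : ContDiffAt 𝕜 ∞ (fun t : 𝕜 => (t, (0 : F))) 0 := contDiffAt_id.prodMk contDiffAt_const
  have hqc : ContDiffAt 𝕜 ∞ q 0 :=
    Λ.contDiff.contDiffAt.comp (0 : 𝕜) (ContDiffAt.comp (g := e.symm) (0 : 𝕜) hec hi)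
  have hq0 : q 0 = 0 := by
    change Λ (e.symm 0) = 0
    rw [hes, hΛ0]
  have hqd : HasFDerivAt q (Λ.comp (ContinuousLinearMap.inl 𝕜 𝕜 F)) 0 := by
    have hl : HasFDerivAt (fun t : 𝕜 => (t, (0 : F))) (ContinuousLinearMap.inl 𝕜 𝕜 F) 0 :=
      hasFDerivAt_prodMk_left (0 : 𝕜) (0 : F)
    have hs : HasFDerivAt (fun t : 𝕜 => e.symm (t, (0 : F))) (ContinuousLinearMap.inl 𝕜 𝕜 F) 0 :=
      (HasFDerivAt.comp (g := e.symm) (0 : 𝕜) hed hl).congr_fderiv rfl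
    exact Λ.hasFDerivAt.comp (0 : 𝕜) hs
  have hq1 : ContDiffAt 𝕜 ∞ (fun t => (q t).1) 0 := contDiffAt_fst.comp (0 : 𝕜) hqc
  have hq2 : ContDiffAt 𝕜 ∞ (fun t => (q t).2) 0 := contDiffAt_snd.comp (0 : 𝕜) hqc
  have hcm : ContMDiffAt 𝓘(𝕜, 𝕜) 𝓘(𝕜, F) ∞ (fun t => f (q t).1 • z) 0 :=
    h.contMDiffAt le_rfl (ContMDiffAt.comp (g := f) (0 : 𝕜) (hf.contMDiff _) hq1.contMDiffAt)
      contMDiffAt_const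
  have hcm' : ContMDiffAt 𝓘(𝕜, 𝕜) 𝓘(𝕜, F) ∞ (fun t => f' (q t).2 • z) 0 :=
    h.contMDiffAt le_rfl (ContMDiffAt.comp (g := f') (0 : 𝕜) (hf'.contMDiff _) hq2.contMDiffAt)
      contMDiffAt_const
  have hc0 : f (q 0).1 • z = z := by rw [hq0, Prod.fst_zero, hf0, one_smul]
  have hc0' : f' (q 0).2 • z = z := by rw [hq0, Prod.snd_zero, hf0', one_smul]
  refine ⟨fun t => f (q t).1 • z, hcm, hc0, ?_, ?_⟩
  · have t1 : ∀ᶠ t in 𝓝 (0 : 𝕜), f (q t).1 • z ∈ φ.source :=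
      hcm.continuousAt.eventually_mem (by rw [hc0]; exact extChartAt_source_mem_nhds z)
    have t2 : ∀ᶠ t in 𝓝 (0 : 𝕜), f' (q t).2 • z ∈ φ.source :=
      hcm'.continuousAt.eventually_mem (by rw [hc0']; exact extChartAt_source_mem_nhds z)
    have t3 : ∀ᶠ t in 𝓝 (0 : 𝕜), (t, (0 : F)) ∈ e.target :=
      hi.continuousAt.eventually_mem (e.open_target.mem_nhds he1)
    filter_upwards [t1, t2, t3] with t h1 h2 h3
    have h4 : Φ (q t) = 0 := congrArg Prod.snd (e.right_inv h3)
    have h5 : f (q t).1 • z = f' (q t).2 • z := φ.injOn h1 h2 (sub_eq_zero.1 h4)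
    exact ⟨⟨⟨_, hf.mem _⟩, rfl⟩, ⟨⟨_, hf'.mem (q t).2⟩, h5.symm⟩⟩
  · have hq1d : fderiv 𝕜 (fun t => (q t).1) 0 1 = (⟨X, hX⟩ : u) := by
      have : HasFDerivAt (fun t => (q t).1)
          ((ContinuousLinearMap.fst 𝕜 u u').comp (Λ.comp (ContinuousLinearMap.inl 𝕜 𝕜 F))) 0 :=
        hasFDerivAt_fst.comp (0 : 𝕜) hqd
      rw [this.fderiv]
      change ((1 : 𝕜) • k + R 0).1 = _
      rw [one_smul, map_zero, add_zero]
    have hq10 : (q 0).1 = 0 := by rw [hq0]; rfl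
    have e1 : tderiv 𝕜 𝕜 E (fun t => f (q t).1) 0 1 = X := by
      rw [tderiv_comp_apply (g := f) (f := fun t => (q t).1) (hf.mdiff _)
        (hq1.differentiableAt (by simp)).mdifferentiableAt, tderiv_eq_fderiv, hq1d, hq10, hf1]
    have hd : MDifferentiableAt 𝓘(𝕜, 𝕜) 𝓘(𝕜, E) (fun t => f (q t).1) 0 :=
      MDifferentiableAt.comp (g := f) (0 : 𝕜) (hf.mdiff _)
        (hq1.differentiableAt (by simp)).mdifferentiableAt
    rw [tderiv_comp_apply (g := fun g : D => g • z) (f := fun t => f (q t).1)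
      (h.mdiff_orbit z _) hd, e1, hq10, hf0]
    exact hXv

/-- The tangent space of an orbit of the connected subgroup of `u` is `κ(u)`. -/
lemma SmoothAction.subsetTangentSpace_orbit (h : SmoothAction 𝕜 E F D M)
    {u : Submodule 𝕜 E} (hu : ∀ v ∈ u, ∀ w ∈ u, modelBracket 𝕜 D v w ∈ u) (z : M) :
    (subsetTangentSpace 𝕜 (F := F) (MulAction.orbit (connectedSubgroup (D := D) (E := E) u) z) z :
      Submodule 𝕜 F) = u.map (orbitDeriv 𝕜 E F D z).toLinearMap := by
  apply le_antisymm
  · refine Submodule.span_le.2 ?_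
    rintro v ⟨c, hc, rfl, hmem, rfl⟩
    exact h.tderiv_mem_of_eventually_mem_orbit hu hc hmem
  · rintro _ ⟨X, hX, rfl⟩
    obtain ⟨γ, hγ⟩ := exists_isOneParameterSubgroup (𝕜 := 𝕜) (D := D) X
    refine Submodule.subset_span ⟨fun t => γ t • z, ?_, ?_, ?_, ?_⟩
    · exact h.contMDiffAt le_rfl (hγ.contMDiff 0) contMDiffAt_const
    · simp only [hγ.map_zero, one_smul]
    · exact Filter.Eventually.of_forall fun t => ⟨⟨γ t, hγ.mem_connectedSubgroup hX t⟩, rfl⟩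
    · have := tderiv_comp_apply (𝕜 := 𝕜) (E := 𝕜) (F := E) (G := F)
        (g := fun g : D => g • z) (f := γ) (x := 0) (h.mdiff_orbit z _) (hγ.mdiff 0) 1
      refine Eq.trans this ?_
      rw [hγ.tderiv_eq, hγ.map_zero, orbitDeriv_one]
      rfl

/-- The dimension of an orbit is that of `κ(u)` at any of its points. -/
lemma SmoothAction.subsetDim_orbit (h : SmoothAction 𝕜 E F D M)
    {u : Submodule 𝕜 E} (hu : ∀ v ∈ u, ∀ w ∈ u, modelBracket 𝕜 D v w ∈ u) (z : M) :
    subsetDim 𝕜 (F := F) (MulAction.orbit (connectedSubgroup (D := D) (E := E) u) z) =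
      Module.finrank 𝕜 (u.map (orbitDeriv 𝕜 E F D z).toLinearMap) := by
  have key : ∀ p : MulAction.orbit (connectedSubgroup (D := D) (E := E) u) z,
      Module.finrank 𝕜 (subsetTangentSpace 𝕜 (F := F)
        (MulAction.orbit (connectedSubgroup (D := D) (E := E) u) z) (p : M)) =
      Module.finrank 𝕜 (u.map (orbitDeriv 𝕜 E F D z).toLinearMap) := by
    rintro ⟨y, hy⟩
    have e : (subsetTangentSpace 𝕜 (F := F)
        (MulAction.orbit (connectedSubgroup (D := D) (E := E) u) z) y : Submodule 𝕜 F) =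
        u.map (orbitDeriv 𝕜 E F D y).toLinearMap := by
      rw [← MulAction.orbit_eq_iff.2 hy]
      exact h.subsetTangentSpace_orbit hu y
    refine (congrArg (fun V : Submodule 𝕜 F => Module.finrank 𝕜 V) e).trans ?_
    obtain ⟨g, hg⟩ := hy
    have e1 := h.finrank_map_orbitDeriv_smul hu g.2 z
    rwa [show (g : D) • z = y from hg] at e1
  have : Nonempty (MulAction.orbit (connectedSubgroup (D := D) (E := E) u) z) :=
    ⟨z, MulAction.mem_orbit_self z⟩
  rw [subsetDim, iSup_congr key, ciSup_const]

/-- The dimension of a transversal intersection of two orbits. -/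
lemma SmoothAction.subsetDim_orbit_inter (h : SmoothAction 𝕜 E F D M)
    {u u' : Submodule 𝕜 E} (hu : ∀ v ∈ u, ∀ w ∈ u, modelBracket 𝕜 D v w ∈ u)
    (hu' : ∀ v ∈ u', ∀ w ∈ u', modelBracket 𝕜 D v w ∈ u') (huu' : u ⊔ u' = ⊤)
    (hsurj : ∀ z : M, Function.Surjective (orbitDeriv 𝕜 E F D z)) (z : M) :
    subsetDim 𝕜 (F := F) (MulAction.orbit (connectedSubgroup (D := D) (E := E) u) z ∩
        MulAction.orbit (connectedSubgroup (D := D) (E := E) u') z) + Module.finrank 𝕜 F =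
      Module.finrank 𝕜 (u.map (orbitDeriv 𝕜 E F D z).toLinearMap) +
        Module.finrank 𝕜 (u'.map (orbitDeriv 𝕜 E F D z).toLinearMap) := by
  set S := MulAction.orbit (connectedSubgroup (D := D) (E := E) u) z ∩
    MulAction.orbit (connectedSubgroup (D := D) (E := E) u') z with hS
  have htop : ∀ y : M, u.map (orbitDeriv 𝕜 E F D y).toLinearMap ⊔
      u'.map (orbitDeriv 𝕜 E F D y).toLinearMap = ⊤ := by
    intro y
    rw [← Submodule.map_sup, huu', Submodule.map_top]
    exact LinearMap.range_eq_top.2 (hsurj y)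
  have htan : ∀ y ∈ S, (subsetTangentSpace 𝕜 (F := F) S y : Submodule 𝕜 F) =
      u.map (orbitDeriv 𝕜 E F D y).toLinearMap ⊓ u'.map (orbitDeriv 𝕜 E F D y).toLinearMap := by
    intro y hy
    have hS' : S = MulAction.orbit (connectedSubgroup (D := D) (E := E) u) y ∩
        MulAction.orbit (connectedSubgroup (D := D) (E := E) u') y := by
      rw [hS, MulAction.orbit_eq_iff.2 hy.1, MulAction.orbit_eq_iff.2 hy.2]
    rw [hS']
    apply le_antisymm
    · refine Submodule.span_le.2 ?_
      rintro v ⟨c, hc, rfl, hmem, rfl⟩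
      exact ⟨h.tderiv_mem_of_eventually_mem_orbit hu hc (hmem.mono fun _ ht => ht.1),
        h.tderiv_mem_of_eventually_mem_orbit hu' hc (hmem.mono fun _ ht => ht.2)⟩
    · rintro v ⟨hv, hv'⟩
      obtain ⟨c, hc, hc0, hmem, hcv⟩ :=
        h.exists_curve_mem_orbit_inter hu hu' y (htop y) hv hv'
      exact Submodule.subset_span ⟨c, hc, hc0, hmem, hcv⟩
  have hdim : ∀ p : S, Module.finrank 𝕜 (subsetTangentSpace 𝕜 (F := F) S (p : M)) =
      Module.finrank 𝕜 (u.map (orbitDeriv 𝕜 E F D z).toLinearMap) +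
        Module.finrank 𝕜 (u'.map (orbitDeriv 𝕜 E F D z).toLinearMap) - Module.finrank 𝕜 F := by
    rintro ⟨y, hy⟩
    refine (congrArg (fun V : Submodule 𝕜 F => Module.finrank 𝕜 V) (htan y hy)).trans ?_
    have e := Submodule.finrank_sup_add_finrank_inf_eq
      (u.map (orbitDeriv 𝕜 E F D y).toLinearMap) (u'.map (orbitDeriv 𝕜 E F D y).toLinearMap)
    rw [htop y, finrank_top] at e
    obtain ⟨⟨g, hg⟩, ⟨g', hg'⟩⟩ := hy
    have e1 := h.finrank_map_orbitDeriv_smul hu g.2 z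
    have e2 := h.finrank_map_orbitDeriv_smul hu' g'.2 z
    rw [show (g : D) • z = y from hg] at e1
    rw [show (g' : D) • z = y from hg'] at e2
    rw [← e1, ← e2]
    omega
  have : Nonempty S := ⟨z, MulAction.mem_orbit_self z, MulAction.mem_orbit_self z⟩
  rw [subsetDim, iSup_congr hdim, ciSup_const]
  have e := Submodule.finrank_add_le_finrank_add_finrank
    (u.map (orbitDeriv 𝕜 E F D z).toLinearMap) (u'.map (orbitDeriv 𝕜 E F D z).toLinearMap)
  rw [htop z, finrank_top] at e
  omega

end OrbitDimension

end DrinfeldPoisson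

/-! ### The homogeneous space -/

namespace DrinfeldPoisson

section HomogeneousSpace

variable {𝕜 : Type*} [RCLike 𝕜] {E : Type*} [NormedAddCommGroup E] [NormedSpace 𝕜 E]
  {F : Type*} [NormedAddCommGroup F] [NormedSpace 𝕜 F]

/-- Submersions have local sections. -/
lemma exists_local_section {M : Type*} [TopologicalSpace M] [ChartedSpace E M]
    {N : Type*} [TopologicalSpace N] [ChartedSpace F N] [IsManifold 𝓘(𝕜, E) ∞ M]
    [IsManifold 𝓘(𝕜, F) ∞ N] {f : M → N} {x : M}
    (h : Manifold.IsSubmersionAt 𝓘(𝕜, E) 𝓘(𝕜, F) ∞ f x) :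
    ∃ s : N → M, ContMDiffAt 𝓘(𝕜, F) 𝓘(𝕜, E) ∞ s (f x) ∧ s (f x) = x ∧
      ∀ᶠ y in 𝓝 (f x), f (s y) = y := by
  set A := h.domChart with hA
  set C := h.codChart with hC
  set L := h.equiv with hL
  have hxA : x ∈ A.source := h.mem_domChart_source
  have hxC : f x ∈ C.source := h.mem_codChart_source
  have hw : ∀ e ∈ A.target, C (f (A.symm e)) = (L e).1 := by
    intro e he
    have he' : e ∈ (h.domChart.extend 𝓘(𝕜, E)).target := by simpa using he
    simpa using h.writtenInCharts he'
  have hfx : C (f x) = (L (A x)).1 := by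
    have := hw _ (A.map_source hxA)
    rwa [A.left_inv hxA] at this
  let p : N → E := fun y => L.symm (C y, (L (A x)).2)
  have hpx : p (f x) = A x := by
    change L.symm (C (f x), (L (A x)).2) = A x
    rw [hfx, Prod.mk.eta, L.symm_apply_apply]
  have hCc : ContMDiffAt 𝓘(𝕜, F) 𝓘(𝕜, F) ∞ C (f x) :=
    (contMDiffOn_of_mem_maximalAtlas h.codChart_mem_maximalAtlas).contMDiffAt
      (C.open_source.mem_nhds hxC)
  have hpc : ContMDiffAt 𝓘(𝕜, F) 𝓘(𝕜, E) ∞ p (f x) := by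
    have hl : ContMDiffAt 𝓘(𝕜, F) 𝓘(𝕜, E) ∞ (fun a : F => L.symm (a, (L (A x)).2)) (C (f x)) :=
      (L.symm.contDiff.comp (contDiff_id.prodMk contDiff_const)).contMDiff.contMDiffAt
    exact ContMDiffAt.comp (g := fun a : F => L.symm (a, (L (A x)).2)) (f x) hl hCc
  have hAc : ContMDiffAt 𝓘(𝕜, E) 𝓘(𝕜, E) ∞ A.symm (p (f x)) :=
    (contMDiffOn_symm_of_mem_maximalAtlas h.domChart_mem_maximalAtlas).contMDiffAt
      (A.open_target.mem_nhds (by rw [hpx]; exact A.map_source hxA))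
  refine ⟨fun y => A.symm (p y), ContMDiffAt.comp (g := A.symm) (f x) hAc hpc, ?_, ?_⟩
  · simp only [hpx, A.left_inv hxA]
  · have h1 : ∀ᶠ y in 𝓝 (f x), p y ∈ A.target :=
      hpc.continuousAt.eventually_mem (A.open_target.mem_nhds (by rw [hpx]; exact A.map_source hxA))
    filter_upwards [h1, C.open_source.mem_nhds hxC] with y hy hyC
    refine C.injOn (h.source_subset_preimage_source (A.map_target hy)) hyC ?_
    rw [hw _ hy, L.apply_symm_apply]

variable {D : Type*} [TopologicalSpace D] [ChartedSpace E D] [Group D] [LieGroup 𝓘(𝕜, E) ∞ D]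
  {Q : Subgroup D} [ChartedSpace F (D ⧸ Q)] [IsManifold 𝓘(𝕜, F) ∞ (D ⧸ Q)]

/-- The action of `D` on `D / Q` is smooth. -/
lemma smoothAction_quotient
    (hπ : Manifold.IsSubmersion 𝓘(𝕜, E) 𝓘(𝕜, F) ∞ (QuotientGroup.mk : D → D ⧸ Q)) :
    SmoothAction 𝕜 E F D (D ⧸ Q) := by
  rintro ⟨g, y⟩
  obtain ⟨d, rfl⟩ := QuotientGroup.mk_surjective y
  obtain ⟨s, hs, hsd, hse⟩ := exists_local_section (hπ.isSubmersionAt d)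
  have hfst : ContMDiffAt (𝓘(𝕜, E).prod 𝓘(𝕜, F)) 𝓘(𝕜, E) ∞
      (Prod.fst : D × (D ⧸ Q) → D) (g, (d : D ⧸ Q)) := contMDiffAt_fst
  have hsnd : ContMDiffAt (𝓘(𝕜, E).prod 𝓘(𝕜, F)) 𝓘(𝕜, F) ∞
      (Prod.snd : D × (D ⧸ Q) → D ⧸ Q) (g, (d : D ⧸ Q)) := contMDiffAt_snd
  have h1 : ContMDiffAt (𝓘(𝕜, E).prod 𝓘(𝕜, F)) 𝓘(𝕜, E) ∞
      (fun x : D × (D ⧸ Q) => x.1 * s x.2) (g, (d : D ⧸ Q)) :=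
    hfst.mul (ContMDiffAt.comp (g := s) (g, (d : D ⧸ Q)) hs hsnd)
  have h2 := ContMDiffAt.comp (g := (QuotientGroup.mk : D → D ⧸ Q)) (g, (d : D ⧸ Q))
    ((hπ.isSubmersionAt _).contMDiffAt) h1
  refine h2.congr_of_eventuallyEq ?_
  have h3 : ∀ᶠ x : D × (D ⧸ Q) in 𝓝 (g, (d : D ⧸ Q)), ((s x.2 : D) : D ⧸ Q) = x.2 :=
    hsnd.continuousAt.eventually hse
  filter_upwards [h3] with x hx
  change x.1 • x.2 = ((x.1 * s x.2 : D) : D ⧸ Q)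
  rw [← smul_eq_mul, ← MulAction.Quotient.smul_coe, hx]

lemma orbitDeriv_quotient_surjective
    (hπ : Manifold.IsSubmersion 𝓘(𝕜, E) 𝓘(𝕜, F) ∞ (QuotientGroup.mk : D → D ⧸ Q)) (z : D ⧸ Q) :
    Function.Surjective (orbitDeriv 𝕜 E F D z) := by
  obtain ⟨d, rfl⟩ := QuotientGroup.mk_surjective z
  obtain ⟨s, hs, hsd, hse⟩ := exists_local_section (hπ.isSubmersionAt d)
  have hact := smoothAction_quotient hπ
  intro v
  have h1 : MDifferentiableAt 𝓘(𝕜, F) 𝓘(𝕜, E) (fun y => s y * d⁻¹) (d : D ⧸ Q) :=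
    mdiff_mul (hs.mdifferentiableAt (by simp)) mdifferentiableAt_const
  refine ⟨tderiv 𝕜 F E (fun y => s y * d⁻¹) (d : D ⧸ Q) v, ?_⟩
  have h2 : s (d : D ⧸ Q) * d⁻¹ = 1 := by rw [hsd, mul_inv_cancel]
  have e := tderiv_comp_apply (𝕜 := 𝕜) (E := F) (F := E) (G := F)
    (g := fun g : D => g • (d : D ⧸ Q)) (f := fun y => s y * d⁻¹) (x := (d : D ⧸ Q))
    (hact.mdiff_orbit _ _) h1 v
  rw [h2] at e
  refine e.symm.trans ?_
  rw [tderiv_congr (g := fun y => y), tderiv_id]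
  · rfl
  · filter_upwards [hse] with y hy
    rw [MulAction.Quotient.smul_coe, smul_eq_mul, inv_mul_cancel_right, hy]

/-- The stabilizer subalgebra of the base point of `D / Q` is the Lie algebra of `Q`. -/
lemma orbitDeriv_quotient_one_eq_zero_iff [CompleteSpace E]
    (hπ : Manifold.IsSubmersion 𝓘(𝕜, E) 𝓘(𝕜, F) ∞ (QuotientGroup.mk : D → D ⧸ Q))
    {q : Submodule 𝕜 E} (hq : HasLieAlgebra (E := E) Q q) (X : E) :
    orbitDeriv 𝕜 E F D ((1 : D) : D ⧸ Q) X = 0 ↔ X ∈ q := by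
  have : IsManifold 𝓘(𝕜, F) 1 (D ⧸ Q) := IsManifold.of_le (n := ∞) (by simp)
  have hact := smoothAction_quotient hπ
  set o : D ⧸ Q := ((1 : D) : D ⧸ Q) with ho
  have hfix : ∀ g : D, g • o = o ↔ g ∈ Q := by
    intro g
    rw [ho, MulAction.Quotient.smul_coe, smul_eq_mul, mul_one, eq_comm, QuotientGroup.eq, inv_one,
      one_mul]
  have hd : ∀ γ : 𝕜 → D, IsOneParameterSubgroup (E := E) γ X →
      ∀ t, MDifferentiableAt 𝓘(𝕜, 𝕜) 𝓘(𝕜, F) (fun t => γ t • o) t := fun γ hγ t =>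
    hact.mdifferentiableAt (hγ.mdiff t) mdifferentiableAt_const
  have hvel : ∀ γ : 𝕜 → D, IsOneParameterSubgroup (E := E) γ X →
      tderiv 𝕜 𝕜 F (fun t => γ t • o) 0 1 = orbitDeriv 𝕜 E F D o X := by
    intro γ hγ
    rw [tderiv_comp_apply (g := fun g : D => g • o) (f := γ) (hact.mdiff_orbit _ _) (hγ.mdiff 0),
      hγ.tderiv_eq, hact.tderiv_orbit_orbitDeriv, hγ.map_zero, one_smul]
  constructor
  · intro hX
    obtain ⟨γ, hγ⟩ := exists_isOneParameterSubgroup (𝕜 := 𝕜) (D := D) X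
    refine (hq X).2 ⟨γ, hγ, fun t => ?_⟩
    have hconst := eqOn_of_tderiv_eq_zero (𝕜 := 𝕜) (E := 𝕜) (F := F)
      (f := fun t => γ t • o) isOpen_univ (by
        let _ : NormedSpace ℝ 𝕜 := NormedSpace.restrictScalars ℝ 𝕜 𝕜
        exact (convex_univ (𝕜 := ℝ) (E := 𝕜)).isPreconnected) (fun t _ => ⟨hd γ hγ t, ?_⟩)
      (Set.mem_univ (t : 𝕜)) (Set.mem_univ 0)
    · simp only [hγ.map_zero, one_smul] at hconst
      exact (hfix _).1 hconst
    · -- near `t` the curve is the translate by `γ(t)` of the curve near `0`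
      have hsub : MDifferentiableAt 𝓘(𝕜, 𝕜) 𝓘(𝕜, 𝕜) (fun s : 𝕜 => s - t) t :=
        (differentiableAt_id.sub_const t).mdifferentiableAt
      have hd0 : MDifferentiableAt 𝓘(𝕜, 𝕜) 𝓘(𝕜, F) (fun s => γ s • o) (t - t) := hd γ hγ _
      have e : (fun s => γ s • o) = fun s => γ t • (γ (s - t) • o) := by
        funext s
        rw [smul_smul, ← hγ.map_add, add_sub_cancel]
      ext
      rw [e, tderiv_comp_apply (g := fun y : D ⧸ Q => γ t • y) (f := fun s => γ (s - t) • o)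
        (hact.mdiff_translation _ _) (MDifferentiableAt.comp (g := fun s => γ s • o) t hd0 hsub),
        tderiv_comp_apply (g := fun s => γ s • o) (f := fun s => s - t) hd0 hsub,
        tderiv_eq_fderiv, fderiv_sub_const, sub_self]
      have e2 : fderiv 𝕜 (fun s : 𝕜 => s) t 1 = 1 := by simp
      rw [e2, hvel γ hγ, hX, map_zero]
      rfl
  · intro hX
    obtain ⟨γ, hγ, hγQ⟩ := (hq X).1 hX
    rw [← hvel γ hγ]
    set φ := extChartAt 𝓘(𝕜, F) o with hφ
    have h0 : γ 0 • o = o := by rw [hγ.map_zero, one_smul]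
    have hφd : MDifferentiableAt 𝓘(𝕜, F) 𝓘(𝕜, F) φ (γ 0 • o) := by
      rw [h0]; exact (contMDiffAt_extChartAt (n := ∞)).mdifferentiableAt (by simp)
    have e1 := tderiv_comp_apply (𝕜 := 𝕜) (E := 𝕜) (F := F) (G := F) (g := φ)
      (f := fun t => γ t • o) (x := 0) hφd (hd γ hγ 0) 1
    rw [h0, tderiv_extChartAt_self, tderiv_eq_fderiv] at e1
    have hdiff : DifferentiableAt 𝕜 (fun t => φ (γ t • o)) 0 :=
      mdifferentiableAt_iff_differentiableAt.1
        (MDifferentiableAt.comp (g := φ) (0 : 𝕜) hφd (hd γ hγ 0))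
    -- restrict to real times, where the curve is constant
    let _ : NormedSpace ℝ F := NormedSpace.restrictScalars ℝ 𝕜 F
    have : IsScalarTower ℝ 𝕜 F := IsScalarTower.restrictScalars ℝ 𝕜 F
    have hof : HasDerivAt (fun s : ℝ => (s : 𝕜)) 1 0 := by
      simpa using (RCLike.ofRealCLM (K := 𝕜)).hasDerivAt (x := (0 : ℝ))
    have h1 : HasDerivAt (fun t => φ (γ t • o)) (fderiv 𝕜 (fun t => φ (γ t • o)) 0 1)
        (((0 : ℝ) : ℝ) : 𝕜) := by
      rw [RCLike.ofReal_zero]; exact hdiff.hasFDerivAt.hasDerivAt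
    have h2 := h1.scomp (0 : ℝ) hof
    rw [one_smul] at h2
    have h3 : ((fun t => φ (γ t • o)) ∘ fun s : ℝ => (s : 𝕜)) = fun _ => φ o := by
      funext s
      simp only [Function.comp_apply, (hfix _).2 (hγQ s)]
    rw [h3] at h2
    have h4 := h2.unique (hasDerivAt_const (0 : ℝ) (φ o))
    rw [h4] at e1
    exact e1.symm

/-- The stabilizer subalgebra of `d Q` is `Ad_d q`. -/
lemma ker_orbitDeriv_quotient [CompleteSpace E]
    (hπ : Manifold.IsSubmersion 𝓘(𝕜, E) 𝓘(𝕜, F) ∞ (QuotientGroup.mk : D → D ⧸ Q))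
    {q : Submodule 𝕜 E} (hq : HasLieAlgebra (E := E) Q q) (d : D) :
    LinearMap.ker (orbitDeriv 𝕜 E F D (d : D ⧸ Q)).toLinearMap =
      q.map (adDeriv 𝕜 E d).toLinearMap := by
  have hact := smoothAction_quotient hπ
  have hd : (d : D ⧸ Q) = d • ((1 : D) : D ⧸ Q) := by
    rw [MulAction.Quotient.smul_coe, smul_eq_mul, mul_one]
  have key : ∀ Y, orbitDeriv 𝕜 E F D (d : D ⧸ Q) (adDeriv 𝕜 E d Y) = 0 ↔ Y ∈ q := by
    intro Y
    rw [← orbitDeriv_quotient_one_eq_zero_iff hπ hq, hd, ← hact.tderiv_translation_orbitDeriv]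
    exact (hact.tderiv_translation_injective d _).eq_iff' (map_zero _)
  ext X
  constructor
  · intro hX
    refine ⟨adDeriv 𝕜 E d⁻¹ X, (key _).1 ?_, adDeriv_apply_inv d X⟩
    rw [adDeriv_apply_inv]
    exact hX
  · rintro ⟨Y, hY, rfl⟩
    exact (key Y).2 hY

end HomogeneousSpace

end DrinfeldPoisson

/-! ### The Lie algebra of the group, and the conclusion -/

namespace DrinfeldPoisson

section LieAlgebra

variable {𝕜 : Type*} [RCLike 𝕜] {E : Type*} [NormedAddCommGroup E] [NormedSpace 𝕜 E]
  [FiniteDimensional 𝕜 E] [CompleteSpace E]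
  {D : Type*} [TopologicalSpace D] [ChartedSpace E D] [Group D] [LieGroup 𝓘(𝕜, E) ∞ D]

omit [FiniteDimensional 𝕜 E] [CompleteSpace E] in
lemma Ad_apply_inv (d : D) (X : GroupLieAlgebra 𝓘(𝕜, E) D) : Ad d (Ad d⁻¹ X) = X :=
  adDeriv_apply_inv (𝕜 := 𝕜) (E := E) d X

omit [FiniteDimensional 𝕜 E] in
lemma Ad_lie (d : D) (X Y : GroupLieAlgebra 𝓘(𝕜, E) D) : Ad d ⁅X, Y⁆ = ⁅Ad d X, Ad d Y⁆ :=
  adDeriv_modelBracket (𝕜 := 𝕜) (E := E) d X Y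

variable [ConnectedSpace D] {B : LinearMap.BilinForm 𝕜 (GroupLieAlgebra 𝓘(𝕜, E) D)}

lemma IsQuadratic.apply_Ad_Ad (hB : IsQuadratic B) (d : D) (X Y : GroupLieAlgebra 𝓘(𝕜, E) D) :
    B (Ad d X) (Ad d Y) = B X Y := by
  have : FiniteDimensional 𝕜 (GroupLieAlgebra 𝓘(𝕜, E) D) := inferInstanceAs (FiniteDimensional 𝕜 E)
  let B' : E →ₗ[𝕜] E →ₗ[𝕜] 𝕜 := B
  let b : E →L[𝕜] E →L[𝕜] 𝕜 := LinearMap.toContinuousLinearMap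
    ((LinearMap.toContinuousLinearMap : (E →ₗ[𝕜] 𝕜) ≃ₗ[𝕜] E →L[𝕜] 𝕜).toLinearMap ∘ₗ B')
  refine bilin_adDeriv_eq (𝕜 := 𝕜) b (fun Z v w => ?_) d X Y
  have h : ∀ Z v w : GroupLieAlgebra 𝓘(𝕜, E) D, B ⁅Z, v⁆ w + B v ⁅Z, w⁆ = 0 := by
    intro Z v w
    rw [← hB.invariant, ← lie_skew v Z, map_neg, LinearMap.neg_apply, add_neg_cancel]
  exact h Z v w

/-- The adjoint action commutes with taking orthogonals. -/
lemma IsQuadratic.orthogonal_map_Ad (hB : IsQuadratic B) (d : D)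
    (q : Submodule 𝕜 (GroupLieAlgebra 𝓘(𝕜, E) D)) :
    B.orthogonal (q.map (Ad d)) = (B.orthogonal q).map (Ad d) := by
  ext X
  constructor
  · intro hX
    refine ⟨Ad d⁻¹ X, fun Y hY => ?_, Ad_apply_inv d X⟩
    have := hX (Ad d Y) ⟨Y, hY, rfl⟩
    change B Y (Ad d⁻¹ X) = 0
    rw [← hB.apply_Ad_Ad d, Ad_apply_inv]
    exact this
  · rintro ⟨X, hX, rfl⟩ _ ⟨Y, hY, rfl⟩
    change B (Ad d Y) (Ad d X) = 0
    rw [hB.apply_Ad_Ad]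
    exact hX Y hY

end LieAlgebra

end DrinfeldPoisson

theorem mainTheorem10
    {𝕜 : Type*} [RCLike 𝕜]
    -- a connected Lie group `D` over `𝕜`, with quadratic Lie algebra `𝔡 = T_1 D`
    {E : Type*} [NormedAddCommGroup E] [NormedSpace 𝕜 E] [FiniteDimensional 𝕜 E] [CompleteSpace E]
    {D : Type*} [TopologicalSpace D] [T2Space D] [ConnectedSpace D] [ChartedSpace E D]
    [Group D] [LieGroup 𝓘(𝕜, E) ∞ D]
    (B : LinearMap.BilinForm 𝕜 (GroupLieAlgebra 𝓘(𝕜, E) D))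
    (hB : DrinfeldPoisson.IsQuadratic B)
    -- a closed subgroup `Q` with coisotropic Lie algebra `q`
    (Q : Subgroup D) (hQ : IsClosed (Q : Set D))
    (q : LieSubalgebra 𝕜 (GroupLieAlgebra 𝓘(𝕜, E) D))
    (hq : DrinfeldPoisson.HasLieAlgebra Q q.toSubmodule)
    (hcoiso : B.orthogonal q.toSubmodule ≤ q.toSubmodule)
    -- the quotient manifold structure of `D / Q`: the one for which `D → D / Q` is a submersion
    {F : Type*} [NormedAddCommGroup F] [NormedSpace 𝕜 F] [FiniteDimensional 𝕜 F]
    [ChartedSpace F (D ⧸ Q)] [IsManifold 𝓘(𝕜, F) ∞ (D ⧸ Q)]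
    (hπ : Manifold.IsSubmersion 𝓘(𝕜, E) 𝓘(𝕜, F) ∞ (QuotientGroup.mk : D → D ⧸ Q))
    -- a Lagrangian splitting with dual bases
    (u u' : LieSubalgebra 𝕜 (GroupLieAlgebra 𝓘(𝕜, E) D))
    (hu : DrinfeldPoisson.IsLagrangianSplitting B u u')
    {n : ℕ} (x : Module.Basis (Fin n) 𝕜 u) (ξ : Module.Basis (Fin n) 𝕜 u')
    (hdual : ∀ i j, B (x i : GroupLieAlgebra 𝓘(𝕜, E) D) (ξ j : GroupLieAlgebra 𝓘(𝕜, E) D) =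
      if i = j then 1 else 0)
    (d : D) :
    ∃ l : LieSubalgebra 𝕜 (GroupLieAlgebra 𝓘(𝕜, E) D),
      -- `l` is the Drinfeld subalgebra at the point `dQ`, and it is Lagrangian
      (l : Set (GroupLieAlgebra 𝓘(𝕜, E) D)) =
        DrinfeldPoisson.drinfeldSubalgebra B
          (DrinfeldPoisson.infinitesimalAction (F := F) (d : D ⧸ Q))
          u.toSubmodule u'.toSubmodule (q.toSubmodule.map (DrinfeldPoisson.Ad d))
          (DrinfeldPoisson.splittingBivector (F := F) x ξ (d : D ⧸ Q)) ∧
      B.orthogonal l.toSubmodule = l.toSubmodule ∧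
      -- `l = Ad_d q^⊥ + (u ∩ Ad_d q)`
      l.toSubmodule = (B.orthogonal q.toSubmodule).map (DrinfeldPoisson.Ad d) ⊔
        (u.toSubmodule ⊓ q.toSubmodule.map (DrinfeldPoisson.Ad d)) ∧
      -- the rank formula
      (DrinfeldPoisson.bivectorRank
          (DrinfeldPoisson.splittingBivector (F := F) x ξ (d : D ⧸ Q)) : ℤ) =
        (DrinfeldPoisson.subsetDim 𝕜 (F := F)
            ((MulAction.orbit (DrinfeldPoisson.connectedSubgroup u.toSubmodule) (d : D ⧸ Q)) ∩
              (MulAction.orbit (DrinfeldPoisson.connectedSubgroup u'.toSubmodule) (d : D ⧸ Q))) : ℤ) +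
          (Module.finrank 𝕜 F : ℤ) -
          (DrinfeldPoisson.subsetDim 𝕜 (F := F)
            (MulAction.orbit (DrinfeldPoisson.connectedSubgroup u'.toSubmodule) (d : D ⧸ Q)) : ℤ) -
          (Module.finrank 𝕜 (u'.toSubmodule ⊓ l.toSubmodule :
            Submodule 𝕜 (GroupLieAlgebra 𝓘(𝕜, E) D)) : ℤ) := by
  have : FiniteDimensional 𝕜 (GroupLieAlgebra 𝓘(𝕜, E) D) := inferInstanceAs (FiniteDimensional 𝕜 E)
  have hact := DrinfeldPoisson.smoothAction_quotient hπ
  set a := q.toSubmodule.map (DrinfeldPoisson.Ad d) with ha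
  have haorth : B.orthogonal a = (B.orthogonal q.toSubmodule).map (DrinfeldPoisson.Ad d) :=
    hB.orthogonal_map_Ad d _
  have hacoiso : B.orthogonal a ≤ a := by
    rw [haorth]
    exact Submodule.map_mono hcoiso
  have hlie : ∀ y ∈ a, ∀ z ∈ a, ⁅y, z⁆ ∈ a := by
    rintro _ ⟨y, hy, rfl⟩ _ ⟨z, hz, rfl⟩
    exact ⟨⁅y, z⁆, q.lie_mem hy hz, DrinfeldPoisson.Ad_lie d y z⟩
  have hker : LinearMap.ker
      (DrinfeldPoisson.infinitesimalAction (𝕜 := 𝕜) (E := E) (F := F) (d : D ⧸ Q)) = a :=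
    DrinfeldPoisson.ker_orbitDeriv_quotient hπ hq d
  have hsurj : Function.Surjective
      (DrinfeldPoisson.infinitesimalAction (𝕜 := 𝕜) (E := E) (F := F) (d : D ⧸ Q)) :=
    DrinfeldPoisson.orbitDeriv_quotient_surjective hπ _
  let l : LieSubalgebra 𝕜 (GroupLieAlgebra 𝓘(𝕜, E) D) :=
    { B.orthogonal a ⊔ (u.toSubmodule ⊓ a) with
      lie_mem' := fun hy hz => DrinfeldPoisson.lie_mem_orthogonal_sup_inf hB
        (fun _ hy _ hz => u.lie_mem hy hz) hlie hacoiso hy hz }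
  have hl : l.toSubmodule = B.orthogonal a ⊔ (u.toSubmodule ⊓ a) := rfl
  refine ⟨l, ?_, ?_, ?_, ?_⟩
  · exact (DrinfeldPoisson.drinfeldSubalgebra_eq_sup hB.nondegenerate hB.symm hu.isCompl
      hu.lagrangian_left hu.lagrangian_right hacoiso _ hsurj hker x ξ hdual).symm
  · rw [hl]
    exact DrinfeldPoisson.orthogonal_sup_inf_eq_self hB.nondegenerate hB.symm hu.lagrangian_left
      hacoiso
  · rw [hl, haorth]
  · have hrank := DrinfeldPoisson.bivectorRank_map_rMatrix hB.nondegenerate hB.symm hu.isCompl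
      hu.lagrangian_left hu.lagrangian_right hacoiso _ hsurj hker x ξ hdual
    have h1 := hact.subsetDim_orbit (u := u'.toSubmodule) (fun _ hv _ hw => u'.lie_mem hv hw)
      (d : D ⧸ Q)
    have h2 := hact.subsetDim_orbit_inter (u := u.toSubmodule) (u' := u'.toSubmodule)
      (fun _ hv _ hw => u.lie_mem hv hw) (fun _ hv _ hw => u'.lie_mem hv hw) hu.isCompl.sup_eq_top
      (DrinfeldPoisson.orbitDeriv_quotient_surjective hπ) (d : D ⧸ Q)
    have harith : ∀ r S S' a b k m : ℕ, r + k = a → S + m = a + b → S' = b →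
        (r : ℤ) = S + m - S' - k := by omega
    exact harith _ _ _ _ _ _ _ hrank h2 h1
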